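/- Let $R$ and $V$ be compact embedded $C^1$ submanifolds of $\mathbb{R}^d$, possibly with boundary and corners, with surface measures $\sigma$ and $\sigma'$; assume that every connected component of $R$ has nonempty boundary. Let $B$ be a compact subset of $\mathbb{R}^p$, and let $B'\supset B$ be an open subset of $\mathbb{R}^p$. Let $H_m(x,y)$ be a real-valued kernel, $m\in B'$, $x\in V$, $y\in R$. Let $H^1_0(R)$ be the closure in $H^1(R)$ of the smooth functions on $R$ which vanish near $\partial R$, with the inner product $\langle\phi,\psi\rangle=\int_R\nabla\phi\cdot\nabla\psi\,d\sigma$ and the norm $\|\phi\|=(\int_R|\nabla\phi|^2d\sigma)^{1/2}$; let $L^2(V)$ carry its usual inner product and norm $\|\psi\|=(\int_V|\psi|^2d\sigma')^{1/2}$. Define $A_m:H^1_0(R)\to L^2(V)$ by $$A_m g(x)=\int_R H_m(x,y)\,g(y)\,d\sigma(y),$$ and for a unit vector $q\in\mathbb{R}^p$ let $\partial_q A_m$ be the derivative of $m\mapsto A_m$ in the direction $q$. (Gradients on $R$ and on $V$ are tangential gradients.) Assume: (R1) $H_m(x,y)$ is continuous in $(m,x,y)\in B\times V\times R$, and $\nabla_xH_m(x,y)$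 exists and is continuous on $B\times V\times R$. (R2) $\partial_{m_i}H_m(x,y)$, $\partial_{m_i}\nabla_xH_m(x,y)$ and $\partial_{m_i}\partial_{m_j}H_m(x,y)$ exist and are continuous on $B'\times V\times R$ for $1\le i,j\le p$. (U1) For all $m_1,m_2\in B$ and $u,v\in H^1_0(R)$: if $A_{m_1}u=A_{m_2}v$ in $L^2(V)$ and $u\ne0$ or $v\ne0$, then $m_1=m_2$ and $u=v$. (U2) For all unit vectors $q\in\mathbb{R}^p$, all $m\in B$ and all $u,v\in H^1_0(R)$: if $\partial_qA_mu=A_mv$ in $L^2(V)$, then $u=v=0$. Let $\beta>0$. For $m\in B$ let $A_m^*:L^2(V)\to H^1_0(R)$ be the adjoint of $A_m$ for the inner products above, and let $E_m\subset H^1_0(R)$ be the span of the eigenvectors of $A_m^*A_m$ whose eigenvalue is strictly greater than $\beta^2$. Let $A_1,A_2$ be positive constants. Then there is a constant $C>0$ such that $$\|A_mu-A_{m'}v\|_{L^2(V)}\ \ge\ C\,|m-m'|$$ for all $m,m'\in B$, all $u\in E_m$, and all $v\in E_{m'}$ with $\|A_{m'}v\|\ge A_1$ and $\|v\|\le A_2$.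 -/

import Mathlib

open Set MeasureTheory Topology
open scoped ContDiff RealInnerProductSpace

namespace LipStab

/-- The Euclidean space `ℝⁿ`. -/
abbrev Eu (n : ℕ) : Type := EuclideanSpace ℝ (Fin n)

/-! ### Embedded submanifolds of `ℝᵈ` -/

/-- The local model of a `k`-dimensional submanifold with boundary (and possibly corners): the
points of `ℝᵏ × {0} ⊆ ℝᵈ` whose coordinates with index in `J` are nonnegative. With `J = ∅` this is
`ℝᵏ`, with `J` a singleton it is a half-space. -/
def modelSet {d : ℕ} (k : ℕ) (J : Set (Fin d)) : Set (Eu d) :=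
  {z | (∀ i, k ≤ i.val → z i = 0) ∧ ∀ i ∈ J, 0 ≤ z i}

/-- `Φ` is a `C¹` diffeomorphism between open subsets of `ℝᵈ` which, on its source, straightens `M`
to the `k`-dimensional model with faces `J`. -/
structure IsAdaptedChart {d : ℕ} (k : ℕ) (M : Set (Eu d))
    (Φ : OpenPartialHomeomorph (Eu d) (Eu d)) (J : Set (Fin d)) : Prop where
  faces : ∀ i ∈ J, i.val < k
  contDiffOn : ContDiffOn ℝ 1 Φ Φ.source
  contDiffOn_symm : ContDiffOn ℝ 1 Φ.symm Φ.target
  straightens : Φ.IsImage M (modelSet k J)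

/-- `M` is a compact `k`-dimensional embedded `C¹` submanifold of `ℝᵈ`, possibly with boundary
and corners. -/
structure IsCompactSubmanifold {d : ℕ} (k : ℕ) (M : Set (Eu d)) : Prop where
  dim_le : k ≤ d
  isCompact : IsCompact M
  exists_chart : ∀ y ∈ M, ∃ (Φ : OpenPartialHomeomorph (Eu d) (Eu d)) (J : Set (Fin d)),
    IsAdaptedChart k M Φ J ∧ y ∈ Φ.source

/-- The manifold boundary of `M`: the points lying on a face in some adapted chart. -/
def bdry {d : ℕ} (k : ℕ) (M : Set (Eu d)) : Set (Eu d) :=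
  {y | y ∈ M ∧ ∃ (Φ : OpenPartialHomeomorph (Eu d) (Eu d)) (J : Set (Fin d)),
    IsAdaptedChart k M Φ J ∧ y ∈ Φ.source ∧ ∃ j ∈ J, Φ y j = 0}

/-- The surface measure of a `k`-dimensional submanifold of `ℝᵈ`: the `k`-dimensional Hausdorff
measure, normalized so that it agrees with Lebesgue measure on `ℝᵏ`, restricted to `M`. -/
noncomputable def surf {d : ℕ} (k : ℕ) (M : Set (Eu d)) : Measure (Eu d) :=
  (Measure.euclideanHausdorffMeasure k).restrict M

/-- The tangent space of `M` at `x`: the linear span of the tangent cone (which also gives the full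
tangent space at boundary points). -/
noncomputable def tangentSpan {d : ℕ} (M : Set (Eu d)) (x : Eu d) : Submodule ℝ (Eu d) :=
  Submodule.span ℝ (tangentConeAt ℝ M x)

/-- The (tangential) gradient at `x` of a function on `M`, as a vector tangent to `M`. -/
noncomputable def tgrad {d : ℕ} (M : Set (Eu d)) (f : Eu d → ℝ) (x : Eu d) : Eu d :=
  (tangentSpan M x).starProjection (gradientWithin f M x)

/-! ### The space `H¹₀(R)` -/

/-- The pairs `(f, ∇f) ∈ L²(R) × L²(R)` for the smooth functions `f` on `R` which vanish near the
boundary of `R`. -/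
def testGraph {d : ℕ} (k : ℕ) (R : Set (Eu d)) :
    Set (Lp ℝ 2 (surf k R) × Lp (Eu d) 2 (surf k R)) :=
  {w | ∃ f : Eu d → ℝ, ContDiff ℝ ∞ f ∧ Disjoint (tsupport f) (bdry k R) ∧
    w.1 =ᵐ[surf k R] f ∧ w.2 =ᵐ[surf k R] tgrad R f}

/-- `H¹₀(R)`: the closure, in the `H¹` norm, of the smooth functions vanishing near the boundary.
An element is recorded as the pair of the function and its weak gradient. -/
noncomputable def H10 {d : ℕ} (k : ℕ) (R : Set (Eu d)) :
    Submodule ℝ (Lp ℝ 2 (surf k R) × Lp (Eu d) 2 (surf k R)) :=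
  (Submodule.span ℝ (testGraph k R)).topologicalClosure

/-- The function underlying an element of `H¹₀(R)`. -/
noncomputable def H10fn {d k : ℕ} {R : Set (Eu d)} (u : H10 k R) : Lp ℝ 2 (surf k R) := u.1.1

/-- The gradient of an element of `H¹₀(R)`. -/
noncomputable def H10grad {d k : ℕ} {R : Set (Eu d)} (u : H10 k R) : Lp (Eu d) 2 (surf k R) :=
  u.1.2

/-- The inner product `∫_R ∇u · ∇v dσ` of `H¹₀(R)`. -/
noncomputable def gradInner {d k : ℕ} {R : Set (Eu d)} (u v : H10 k R) : ℝ :=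
  ∫ y, ⟪H10grad u y, H10grad v y⟫ ∂(surf k R)

/-- The norm `(∫_R |∇u|² dσ)^(1/2)` of `H¹₀(R)`. -/
noncomputable def gradNorm {d k : ℕ} {R : Set (Eu d)} (u : H10 k R) : ℝ :=
  Real.sqrt (∫ y, ‖H10grad u y‖ ^ 2 ∂(surf k R))

/-! ### The norm of `L²(V)` -/

/-- The inner product `∫_V φ ψ dσ'` of `L²(V)`. -/
noncomputable def l2Inner {d : ℕ} (l : ℕ) (V : Set (Eu d)) (φ ψ : Eu d → ℝ) : ℝ :=
  ∫ x, φ x * ψ x ∂(surf l V)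

/-- The norm `(∫_V |ψ|² dσ')^(1/2)` of `L²(V)`. -/
noncomputable def l2Norm {d : ℕ} (l : ℕ) (V : Set (Eu d)) (ψ : Eu d → ℝ) : ℝ :=
  Real.sqrt (∫ x, |ψ x| ^ 2 ∂(surf l V))

/-! ### The operators -/

/-- `(A_m g)(x) = ∫_R H_m(x, y) g(y) dσ(y)`. -/
noncomputable def opA {p d k : ℕ} {R : Set (Eu d)} (H : Eu p → Eu d → Eu d → ℝ) (m : Eu p)
    (g : H10 k R) (x : Eu d) : ℝ :=
  ∫ y, H m x y * H10fn g y ∂(surf k R)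

/-- The directional derivative `∂_q A_m` of `m ↦ A_m`, applied to `g`. -/
noncomputable def opDA {p d k : ℕ} {R : Set (Eu d)} (H : Eu p → Eu d → Eu d → ℝ) (q m : Eu p)
    (g : H10 k R) (x : Eu d) : ℝ :=
  lineDeriv ℝ (fun m' => opA H m' g x) m q

/-- `w = A_m^* ψ`, where the adjoint is taken with respect to the inner product of `L²(V)` and the
inner product `∫_R ∇u · ∇v` of `H¹₀(R)`. -/
def IsAdjointValue {p d k : ℕ} {R : Set (Eu d)} (l : ℕ) (V : Set (Eu d))
    (H : Eu p → Eu d → Eu d → ℝ) (m : Eu p) (ψ : Eu d → ℝ) (w : H10 k R) : Prop :=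
  ∀ φ : H10 k R, l2Inner l V (opA H m φ) ψ = gradInner φ w

/-- `φ` is an eigenvector of `A_m^* A_m` with eigenvalue `lam`. -/
def IsEigenvector {p d k : ℕ} {R : Set (Eu d)} (l : ℕ) (V : Set (Eu d))
    (H : Eu p → Eu d → Eu d → ℝ) (m : Eu p) (lam : ℝ) (φ : H10 k R) : Prop :=
  φ ≠ 0 ∧ IsAdjointValue l V H m (opA H m φ) (lam • φ)

/-- `E_m`: the span of the eigenvectors of `A_m^* A_m` with eigenvalue strictly greater
than `β²`. -/
noncomputable def eigenSpan {p d : ℕ} (k l : ℕ) (R V : Set (Eu d)) (H : Eu p → Eu d → Eu d → ℝ)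
    (β : ℝ) (m : Eu p) : Submodule ℝ (H10 k R) :=
  Submodule.span ℝ {φ | ∃ lam : ℝ, β ^ 2 < lam ∧ IsEigenvector l V H m lam φ}

/-! ### The assumptions on the kernel -/

/-- The gradient `∇_x H_m(x, y)`, for `x ∈ V`. -/
noncomputable def gradX {p d : ℕ} (V : Set (Eu d)) (H : Eu p → Eu d → Eu d → ℝ)
    (m : Eu p) (x y : Eu d) : Eu d :=
  tgrad V (fun x' => H m x' y) x

/-- The `i`-th standard basis vector of `ℝᵖ`. -/
noncomputable def stdVec {p : ℕ} (i : Fin p) : Eu p := EuclideanSpace.single i 1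

/-- The partial derivative of `F` with respect to the `i`-th coordinate of `m`. -/
noncomputable def pd {p : ℕ} {X : Type*} [NormedAddCommGroup X] [NormedSpace ℝ X] (i : Fin p)
    (F : Eu p → X) (m : Eu p) : X :=
  lineDeriv ℝ F m (stdVec i)

/-- Regularity assumption (R1): `H` and `∇_x H` exist and are continuous on `B × V × R`. -/
structure Reg1 {p d : ℕ} (B : Set (Eu p)) (V R : Set (Eu d))
    (H : Eu p → Eu d → Eu d → ℝ) : Prop where
  cont : ContinuousOn (fun z : Eu p × Eu d × Eu d => H z.1 z.2.1 z.2.2) (B ×ˢ V ×ˢ R)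
  diff_x : ∀ m ∈ B, ∀ x ∈ V, ∀ y ∈ R, DifferentiableWithinAt ℝ (fun x' => H m x' y) V x
  cont_x : ContinuousOn (fun z : Eu p × Eu d × Eu d => gradX V H z.1 z.2.1 z.2.2) (B ×ˢ V ×ˢ R)

/-- Regularity assumption (R2) on the open set `B'`: the derivatives `∂_{m_i} H`,
`∂_{m_i} ∇_x H` and `∂_{m_i} ∂_{m_j} H` exist and are continuous on `B' × V × R`. -/
structure Reg2 {p d : ℕ} (B' : Set (Eu p)) (V R : Set (Eu d))
    (H : Eu p → Eu d → Eu d → ℝ) : Prop where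
  diff_m : ∀ i, ∀ m ∈ B', ∀ x ∈ V, ∀ y ∈ R,
    LineDifferentiableAt ℝ (fun m' => H m' x y) m (stdVec i)
  cont_m : ∀ i, ContinuousOn
    (fun z : Eu p × Eu d × Eu d => pd i (fun m' => H m' z.2.1 z.2.2) z.1) (B' ×ˢ V ×ˢ R)
  diff_x : ∀ m ∈ B', ∀ x ∈ V, ∀ y ∈ R, DifferentiableWithinAt ℝ (fun x' => H m x' y) V x
  diff_mx : ∀ i, ∀ m ∈ B', ∀ x ∈ V, ∀ y ∈ R,
    LineDifferentiableAt ℝ (fun m' => gradX V H m' x y) m (stdVec i)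
  cont_mx : ∀ i, ContinuousOn
    (fun z : Eu p × Eu d × Eu d => pd i (fun m' => gradX V H m' z.2.1 z.2.2) z.1)
    (B' ×ˢ V ×ˢ R)
  diff_mm : ∀ i j, ∀ m ∈ B', ∀ x ∈ V, ∀ y ∈ R,
    LineDifferentiableAt ℝ (pd j (fun m' => H m' x y)) m (stdVec i)
  cont_mm : ∀ i j, ContinuousOn
    (fun z : Eu p × Eu d × Eu d => pd i (pd j (fun m' => H m' z.2.1 z.2.2)) z.1)
    (B' ×ˢ V ×ˢ R)

/-- Uniqueness assumption (U1). -/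
def Uniq1 {p d : ℕ} (k l : ℕ) (B : Set (Eu p)) (R V : Set (Eu d))
    (H : Eu p → Eu d → Eu d → ℝ) : Prop :=
  ∀ m₁ ∈ B, ∀ m₂ ∈ B, ∀ u v : H10 k R, opA H m₁ u =ᵐ[surf l V] opA H m₂ v →
    (u ≠ 0 ∨ v ≠ 0) → m₁ = m₂ ∧ u = v

/-- Uniqueness assumption (U2). -/
def Uniq2 {p d : ℕ} (k l : ℕ) (B : Set (Eu p)) (R V : Set (Eu d))
    (H : Eu p → Eu d → Eu d → ℝ) : Prop :=
  ∀ q : Eu p, ‖q‖ = 1 → ∀ m ∈ B, ∀ u v : H10 k R,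
    opDA H q m u =ᵐ[surf l V] opA H m v → u = 0 ∧ v = 0

end LipStab

/-! The proof is by contradiction and compactness, with a spectral estimate doing what compactness
alone cannot. If no `C` works, there are `m n`, `m' n`, `u n`, `v n` with `‖A_m u - A_{m'} v‖`
smaller than `t / (n + 1)`, where `t = ‖m - m'‖`. On `E_m` one has `β ‖u‖ ≤ ‖A_m u‖`, so the `u n`
are bounded, and along an ultrafilter the parameters converge while `u n`, `v n` converge weakly.
The lower bound `A₁` and compactness of the operators make the weak limit of `v n` nonzero, so (U1)
identifies the two parameter limits and the two weak limits.

Dividing by `t` then gives `D n (u n) = A_{m'} (w n) + o(1)`, where `D n` is the difference quotient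
of the operators and `w n = (v n - u n) / t`. If `w n` is bounded, a weak limit gives `∂_q A_a u₀ =
A_a w₀` with `u₀ ≠ 0`, against (U2). Boundedness is not automatic, since a compact injective
operator on an infinite-dimensional space has no bounded inverse and `E_m` moves with `m`. It comes
from `norm_sub_le_of_mem_specSpan`: cutting the spectrum of `A_{m'}^* A_{m'}` at `β² / 2` leaves a
gap below `β²`, and `norm_spectral_leak_le` shows that the part of `u` below the cut is of order
`‖A_m^* A_m - A_{m'}^* A_{m'}‖`, hence `O(t)`. The abstract result is `exists_lipschitz_stability`.

Two concrete facts feed it. Continuous kernels give compact operators, strictly differentiable in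
`m` (`exists_kernelOp`, `hasStrictFDerivAt_kernelOp`). The Dirichlet norm makes `H¹₀(R)` a Hilbert
space by a Poincaré inequality (`IsCompactSubmanifold.poincareOn`), proved in charts near the
boundary and carried through each component by connectedness. -/

namespace LipStab

/-! ### Spectral subspaces of symmetric and compact operators -/

section Spectral

variable {E : Type*} [NormedAddCommGroup E] [InnerProductSpace ℝ E]

/-- The sum of the eigenspaces of `T` with eigenvalue in `S`. -/
def specSpan (T : E →L[ℝ] E) (S : Set ℝ) : Submodule ℝ E :=
  ⨆ μ ∈ S, Module.End.eigenspace (T : Module.End ℝ E) μ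

lemma mem_specSpan_of_eigen {T : E →L[ℝ] E} {S : Set ℝ} {μ : ℝ} (hμ : μ ∈ S) {x : E}
    (hx : T x = μ • x) : x ∈ specSpan T S :=
  (le_iSup₂_of_le (f := fun μ (_ : μ ∈ S) => Module.End.eigenspace (T : Module.End ℝ E) μ)
    μ hμ le_rfl) (Module.End.mem_eigenspace_iff.2 hx)

/-- This reduces spectral estimates to finite orthogonal sums. The family vanishes off its support,
so the eigenvector equation can be stated for every real `μ`, without side conditions. -/
lemma exists_sum_of_mem_specSpan {T : E →L[ℝ] E} {S : Set ℝ} {u : E} (hu : u ∈ specSpan T S) :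
    ∃ (s : Finset ℝ) (f : ℝ → E), ↑s ⊆ S ∧ (∀ μ, T (f μ) = μ • f μ) ∧ ∑ μ ∈ s, f μ = u := by
  rw [specSpan, Submodule.mem_iSup_iff_exists_finsupp] at hu
  obtain ⟨f, hf, rfl⟩ := hu
  refine ⟨f.support, f, fun μ hμ => ?_, fun μ => ?_, rfl⟩
  · by_contra h
    have h0 := hf μ
    simp only [h, not_false_eq_true, iSup_neg, Submodule.mem_bot] at h0
    simp [h0] at hμ
  · have h0 := hf μ
    by_cases h : μ ∈ S
    · simpa [h, Module.End.mem_eigenspace_iff] using h0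
    · simp only [h, not_false_eq_true, iSup_neg, Submodule.mem_bot] at h0
      simp [h0]

/-- Eigenvectors of a symmetric operator for distinct eigenvalues are orthogonal, so only the
diagonal terms survive. -/
lemma inner_sum_eigen {T : E →L[ℝ] E} (hT : (T : E →ₗ[ℝ] E).IsSymmetric) (s : Finset ℝ) {f g : ℝ → E}
    (hf : ∀ μ, T (f μ) = μ • f μ) (hg : ∀ μ, T (g μ) = μ • g μ) :
    ⟪∑ μ ∈ s, f μ, ∑ μ ∈ s, g μ⟫ = ∑ μ ∈ s, ⟪f μ, g μ⟫ := by
  simp_rw [sum_inner, inner_sum]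
  refine Finset.sum_congr rfl fun μ hμ => ?_
  refine Finset.sum_eq_single_of_mem μ hμ fun ν _ hν => ?_
  have h := hT (f μ) (g ν)
  simp only [ContinuousLinearMap.coe_coe, hf, hg, inner_smul_left, inner_smul_right] at h
  simp only [conj_trivial] at h
  rcases mul_eq_mul_right_iff.1 h with h | h
  · exact absurd h.symm hν
  · exact h

lemma norm_sq_sum_eigen {T : E →L[ℝ] E} (hT : (T : E →ₗ[ℝ] E).IsSymmetric) (s : Finset ℝ) {f : ℝ → E}
    (hf : ∀ μ, T (f μ) = μ • f μ) :
    ‖∑ μ ∈ s, f μ‖ ^ 2 = ∑ μ ∈ s, ‖f μ‖ ^ 2 := by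
  simp_rw [← real_inner_self_eq_norm_sq]
  exact inner_sum_eigen hT s hf hf

lemma specSpan_lower {T : E →L[ℝ] E} (hT : (T : E →ₗ[ℝ] E).IsSymmetric) {S : Set ℝ} {c : ℝ}
    (hS : ∀ μ ∈ S, c ≤ μ) {u : E} (hu : u ∈ specSpan T S) : c * ‖u‖ ^ 2 ≤ ⟪T u, u⟫ := by
  obtain ⟨s, f, hs, hf, rfl⟩ := exists_sum_of_mem_specSpan hu
  have hTf : ∀ μ, T (T (f μ)) = μ • T (f μ) := fun μ => by rw [hf, map_smul, hf]
  rw [map_sum, inner_sum_eigen hT s hTf hf, norm_sq_sum_eigen hT s hf, Finset.mul_sum]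
  refine Finset.sum_le_sum fun μ hμ => ?_
  rw [hf, inner_smul_left, real_inner_self_eq_norm_sq]
  exact mul_le_mul_of_nonneg_right (hS μ (hs hμ)) (sq_nonneg _)

lemma specSpan_upper {T : E →L[ℝ] E} (hT : (T : E →ₗ[ℝ] E).IsSymmetric) {S : Set ℝ} {c : ℝ}
    (hc : 0 ≤ c) (hS : ∀ μ ∈ S, |μ| ≤ c) {u : E} (hu : u ∈ specSpan T S) : ‖T u‖ ≤ c * ‖u‖ := by
  obtain ⟨s, f, hs, hf, rfl⟩ := exists_sum_of_mem_specSpan hu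
  have hTf : ∀ μ, T (T (f μ)) = μ • T (f μ) := fun μ => by rw [hf, map_smul, hf]
  refine abs_le_of_sq_le_sq' ?_ (by positivity) |>.2
  rw [map_sum, norm_sq_sum_eigen hT s hTf, mul_pow, norm_sq_sum_eigen hT s hf, Finset.mul_sum]
  refine Finset.sum_le_sum fun μ hμ => ?_
  rw [hf, norm_smul, mul_pow]
  exact mul_le_mul_of_nonneg_right (pow_le_pow_left₀ (norm_nonneg _) (hS μ (hs hμ)) 2)
    (sq_nonneg _)

/-- On a spectral subspace away from zero, `T` is boundedly invertible. -/
lemma specSpan_exists_preimage {T : E →L[ℝ] E} (hT : (T : E →ₗ[ℝ] E).IsSymmetric) {S : Set ℝ}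
    {c : ℝ} (hc : 0 < c) (hS : ∀ μ ∈ S, c ≤ μ) {u : E} (hu : u ∈ specSpan T S) :
    ∃ z ∈ specSpan T S, T z = u ∧ ‖z‖ ≤ c⁻¹ * ‖u‖ := by
  obtain ⟨s, f, hs, hf, rfl⟩ := exists_sum_of_mem_specSpan hu
  have hg : ∀ μ, T (μ⁻¹ • f μ) = μ • μ⁻¹ • f μ := fun μ => by rw [map_smul, hf, smul_comm]
  refine ⟨∑ μ ∈ s, μ⁻¹ • f μ, ?_, ?_, ?_⟩
  · exact Submodule.sum_mem _ fun μ hμ => mem_specSpan_of_eigen (hs hμ) (hg μ)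
  · rw [map_sum]
    refine Finset.sum_congr rfl fun μ hμ => ?_
    have : 0 < μ := hc.trans_le (hS μ (hs hμ))
    rw [hg, smul_inv_smul₀ this.ne']
  · refine abs_le_of_sq_le_sq' ?_ (by positivity) |>.2
    rw [norm_sq_sum_eigen hT s hg, mul_pow, norm_sq_sum_eigen hT s hf, Finset.mul_sum]
    refine Finset.sum_le_sum fun μ hμ => ?_
    have h1 : c ≤ μ := hS μ (hs hμ)
    have h2 : 0 < μ := hc.trans_le h1
    rw [norm_smul, mul_pow, norm_inv, Real.norm_of_nonneg h2.le]
    gcongr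

lemma specSpan_inner_eq_zero {T : E →L[ℝ] E} (hT : (T : E →ₗ[ℝ] E).IsSymmetric) {S S' : Set ℝ}
    (hd : Disjoint S S') {u v : E} (hu : u ∈ specSpan T S) (hv : v ∈ specSpan T S') :
    ⟪u, v⟫ = 0 := by
  obtain ⟨s, f, hs, hf, rfl⟩ := exists_sum_of_mem_specSpan hu
  obtain ⟨s', g, hs', hg, rfl⟩ := exists_sum_of_mem_specSpan hv
  simp_rw [sum_inner, inner_sum]
  refine Finset.sum_eq_zero fun μ hμ => Finset.sum_eq_zero fun ν hν => ?_
  have h := hT (f μ) (g ν)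
  simp only [ContinuousLinearMap.coe_coe, hf, hg, inner_smul_left, inner_smul_right] at h
  simp only [conj_trivial] at h
  rcases mul_eq_mul_right_iff.1 h with h | h
  · exact absurd h (hd.ne_of_mem (hs hμ) (hs' hν))
  · exact h

/-- Splitting the spectrum of a compact nonnegative operator at a level `c > 0`. -/
lemma exists_spectral_cut [CompleteSpace E] {T : E →L[ℝ] E} (hT : (T : E →ₗ[ℝ] E).IsSymmetric)
    (hpos : ∀ x, 0 ≤ ⟪T x, x⟫) (hcpt : IsCompactOperator T) {c : ℝ} (hc : 0 < c) :
    ∃ P : E →L[ℝ] E, (∀ x, ‖x - P x‖ ≤ ‖x‖) ∧ (∀ x, T (P x) = P (T x)) ∧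
      (∀ x y, ⟪P x, y - P y⟫ = 0) ∧
      (∀ x, c * ‖P x‖ ^ 2 ≤ ⟪T (P x), P x⟫) ∧ (∀ x, ‖T (x - P x)‖ ≤ c * ‖x - P x‖) ∧
      (∀ x ∈ specSpan T (Ioi c), P x = x) := by
  set W := (specSpan T (Ioi c)).topologicalClosure with hW
  have hWc : IsClosed (W : Set E) := Submodule.isClosed_topologicalClosure _
  have : CompleteSpace W := hWc.completeSpace_coe
  set D := (specSpan T (Icc 0 c)).topologicalClosure with hD
  have : CompleteSpace D :=
    (Submodule.isClosed_topologicalClosure (specSpan T (Icc 0 c))).completeSpace_coe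
  have hinv : ∀ S : Set ℝ, ∀ x ∈ specSpan T S, T x ∈ specSpan T S := by
    intro S x hx
    obtain ⟨s, f, hs, hf, rfl⟩ := exists_sum_of_mem_specSpan hx
    rw [map_sum]
    refine Submodule.sum_mem _ fun μ hμ => ?_
    exact mem_specSpan_of_eigen (hs hμ) (by rw [hf, map_smul, hf])
  have hWinv : ∀ x ∈ W, T x ∈ W := by
    intro x hx
    have : MapsTo T (closure (specSpan T (Ioi c) : Set E)) (closure (specSpan T (Ioi c) : Set E)) :=
      MapsTo.closure (fun x hx => hinv _ x hx) T.continuous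
    exact this hx
  have hWoinv : ∀ x ∈ Wᗮ, T x ∈ Wᗮ := by
    intro x hx
    rw [Submodule.mem_orthogonal] at hx ⊢
    intro w hw
    have := hT w x
    simp only [ContinuousLinearMap.coe_coe] at this
    rw [← this]
    exact hx _ (hWinv w hw)
  have hlow : ∀ x ∈ W, c * ‖x‖ ^ 2 ≤ ⟪T x, x⟫ := by
    intro x hx
    have hcl : IsClosed {x : E | c * ‖x‖ ^ 2 ≤ ⟪T x, x⟫} :=
      isClosed_le (by fun_prop) (by fun_prop)
    exact closure_minimal (fun y hy => specSpan_lower hT (fun μ hμ => le_of_lt hμ) hy) hcl hx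
  have hDup : ∀ x ∈ D, ‖T x‖ ≤ c * ‖x‖ := by
    intro x hx
    have hcl : IsClosed {x : E | ‖T x‖ ≤ c * ‖x‖} :=
      isClosed_le (by fun_prop) (by fun_prop)
    exact closure_minimal (fun y hy => specSpan_upper hT hc.le
      (fun μ hμ => by rw [abs_of_nonneg hμ.1]; exact hμ.2) hy) hcl hx
  have htot := ContinuousLinearMap.orthogonalComplement_iSup_eigenspaces_eq_bot hcpt hT
  -- The upper bound for `T` is known on `D`, not on `Wᗮ`. For `x ∈ Wᗮ` the vector `x -
  -- D.starProjection x` is orthogonal to every eigenvector: those with eigenvalue at most `c` lie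
  -- in `D`, the others in `W`, which is orthogonal to both `x` and `D`. Eigenvectors are total by
  -- compactness, so the vector is zero.
  have hsub : Wᗮ ≤ D := by
    intro x hx
    have hx0 : x - D.starProjection x = 0 := by
      rw [← Submodule.mem_bot ℝ, ← htot, Submodule.mem_orthogonal']
      intro y hy
      rw [Submodule.mem_iSup_iff_exists_finsupp] at hy
      obtain ⟨f, hf, rfl⟩ := hy
      rw [Finsupp.sum, inner_sum]
      refine Finset.sum_eq_zero fun μ _ => ?_
      have hfμ : T (f μ) = μ • f μ := Module.End.mem_eigenspace_iff.1 (hf μ)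
      by_cases h0 : f μ = 0
      · simp [h0]
      have hμ0 : 0 ≤ μ := by
        have := hpos (f μ)
        rw [hfμ, inner_smul_left, real_inner_self_eq_norm_sq] at this
        exact nonneg_of_mul_nonneg_left this (by positivity)
      by_cases hμ : μ ≤ c
      · have hmem : f μ ∈ D := Submodule.le_topologicalClosure _
          (mem_specSpan_of_eigen (mem_Icc.2 ⟨hμ0, hμ⟩) hfμ)
        exact Submodule.starProjection_inner_eq_zero x _ hmem
      · have hmem : f μ ∈ specSpan T (Ioi c) := mem_specSpan_of_eigen (not_le.1 hμ) hfμ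
        have hWf : f μ ∈ W := Submodule.le_topologicalClosure _ hmem
        have h1 : ⟪x, f μ⟫ = 0 :=
          (Submodule.mem_orthogonal' _ _).1 hx _ hWf
        have h2 : D ≤ (specSpan T (Ioi c))ᗮ := by
          refine Submodule.topologicalClosure_minimal _ ?_ (Submodule.isClosed_orthogonal _)
          intro z hz
          rw [Submodule.mem_orthogonal]
          intro w hw
          refine specSpan_inner_eq_zero hT ?_ hw hz
          rw [Set.disjoint_left]
          intro a ha ha'
          exact absurd ha'.2 (not_le.2 ha)
        have h3 : ⟪D.starProjection x, f μ⟫ = 0 :=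
          (Submodule.mem_orthogonal' _ _).1 (h2 (Submodule.starProjection_apply_mem D x)) _ hmem
        rw [inner_sub_left, h1, h3, sub_zero]
    rw [sub_eq_zero.1 hx0]
    exact Submodule.starProjection_apply_mem D x
  have hQ : ∀ x, x - W.starProjection x ∈ Wᗮ := fun x =>
    Submodule.sub_starProjection_mem_orthogonal x
  refine ⟨W.starProjection, fun x => ?_, fun x => ?_, fun x y => ?_, fun x => ?_, fun x => ?_,
    fun x hx => ?_⟩
  · have := Submodule.norm_starProjection_apply_le Wᗮ x
    rwa [Submodule.starProjection_orthogonal'] at this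
  · have h := Submodule.eq_starProjection_of_mem_orthogonal (u := T x)
      (hWinv _ (Submodule.starProjection_apply_mem W x))
      (by rw [← map_sub]; exact hWoinv _ (hQ x))
    exact h.symm
  · exact (Submodule.mem_orthogonal _ _).1 (hQ y) _ (Submodule.starProjection_apply_mem W x)
  · exact hlow _ (Submodule.starProjection_apply_mem W x)
  · exact hDup _ (hsub (hQ x))
  · exact Submodule.starProjection_eq_self_iff.2 (Submodule.le_topologicalClosure _ hx)

/-- A vector in a spectral subspace of `S`, cut down to the complementary spectral subspace of a
nearby operator `T`, is small. -/
lemma norm_spectral_leak_le {S T P : E →L[ℝ] E} (hS : (S : E →ₗ[ℝ] E).IsSymmetric) {b : ℝ}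
    (hb : 0 < b) (hP : ∀ x, ‖x - P x‖ ≤ ‖x‖) (hPT : ∀ x, T (P x) = P (T x))
    (hQ : ∀ x, ‖T (x - P x)‖ ≤ b / 2 * ‖x - P x‖) {u : E} (hu : u ∈ specSpan S (Ioi b)) :
    ‖u - P u‖ ≤ 2 / b * ‖S - T‖ * ‖u‖ := by
  set W := specSpan S (Ioi b)
  set Q : W →L[ℝ] E := (ContinuousLinearMap.id ℝ E - P) ∘L W.subtypeL with hQdef
  have hQa : ∀ w : W, Q w = w - P w := fun w => by simp [hQdef]
  -- A self-improving bound: with `S z = w` and `‖z‖ ≤ b⁻¹ ‖w‖`, one has `(1 - P) w = T (1 - P) z +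
  -- (1 - P) (S - T) z`. Since `T` is at most `b / 2` on the range of `1 - P`, the first term is at
  -- most half of `‖Q‖ ‖w‖` and is absorbed.
  have key : ‖Q‖ ≤ 1 / 2 * ‖Q‖ + b⁻¹ * ‖S - T‖ := by
    refine ContinuousLinearMap.opNorm_le_bound _ (by positivity) fun w => ?_
    obtain ⟨z, hz, hzw, hzn⟩ := specSpan_exists_preimage hS hb (fun μ hμ => le_of_lt hμ) w.2
    have e : Q w = T (z - P z) + ((S - T) z - P ((S - T) z)) := by
      rw [hQa, ← hzw]
      simp only [_root_.sub_apply, map_sub, hPT]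
      abel
    rw [e]
    have h1 : ‖z - P z‖ ≤ ‖Q‖ * ‖z‖ := by
      have := Q.le_opNorm ⟨z, hz⟩
      rwa [hQa] at this
    calc _ ≤ ‖T (z - P z)‖ + ‖(S - T) z - P ((S - T) z)‖ := norm_add_le _ _
      _ ≤ b / 2 * (‖Q‖ * ‖z‖) + ‖S - T‖ * ‖z‖ := by
        refine add_le_add ((hQ z).trans ?_) ((hP _).trans (ContinuousLinearMap.le_opNorm _ _))
        gcongr
      _ ≤ b / 2 * (‖Q‖ * (b⁻¹ * ‖w‖)) + ‖S - T‖ * (b⁻¹ * ‖w‖) := by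
        have : ‖(w : E)‖ = ‖w‖ := rfl
        rw [this] at hzn
        gcongr
      _ = _ := by field_simp
  have hk : ‖Q‖ ≤ 2 / b * ‖S - T‖ := by
    have : 2 / b * ‖S - T‖ = 2 * (b⁻¹ * ‖S - T‖) := by ring
    linarith
  have h := Q.le_opNorm ⟨u, hu⟩
  rw [hQa] at h
  exact h.trans (mul_le_mul_of_nonneg_right hk (norm_nonneg _))

end Spectral

/-! ### Comparison of the operators `A^* A` at nearby parameters -/

section Operators

variable {E F : Type*} [NormedAddCommGroup E] [InnerProductSpace ℝ E] [CompleteSpace E]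
  [NormedAddCommGroup F] [InnerProductSpace ℝ F] [CompleteSpace F]

/-- The operator `A^* A`. -/
noncomputable def gram (A : E →L[ℝ] F) : E →L[ℝ] E := ContinuousLinearMap.adjoint A ∘L A

lemma inner_gram (A : E →L[ℝ] F) (x y : E) : ⟪gram A x, y⟫ = ⟪A x, A y⟫ := by
  simp [gram, ContinuousLinearMap.adjoint_inner_left]

lemma gram_isSymmetric (A : E →L[ℝ] F) : (gram A : E →ₗ[ℝ] E).IsSymmetric := by
  intro x y
  change ⟪gram A x, y⟫ = ⟪x, gram A y⟫
  rw [inner_gram, real_inner_comm (gram A y), inner_gram, real_inner_comm]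

lemma gram_isCompact {A : E →L[ℝ] F} (hA : IsCompactOperator A) : IsCompactOperator (gram A) :=
  hA.clm_comp (ContinuousLinearMap.adjoint A)

lemma norm_gram_sub_le (A A' : E →L[ℝ] F) :
    ‖gram A - gram A'‖ ≤ (‖A‖ + ‖A'‖) * ‖A - A'‖ := by
  have e : gram A - gram A' = ContinuousLinearMap.adjoint A ∘L (A - A') +
      ContinuousLinearMap.adjoint (A - A') ∘L A' := by
    ext x
    simp [gram, map_sub]
  rw [e, add_mul]
  refine (norm_add_le _ _).trans (add_le_add ?_ ?_)
  · refine (ContinuousLinearMap.opNorm_comp_le _ _).trans ?_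
    rw [LinearIsometryEquiv.norm_map]
  · refine (ContinuousLinearMap.opNorm_comp_le _ _).trans ?_
    rw [LinearIsometryEquiv.norm_map, mul_comm]

/-- `‖A u‖²` is the quadratic form of `gram A` at `u`. This is the only source of a bound on `u` in
the compactness argument. -/
lemma norm_le_of_mem_specSpan_gram (A : E →L[ℝ] F) {β : ℝ} {u : E}
    (hu : u ∈ specSpan (gram A) (Ioi (β ^ 2))) : β * ‖u‖ ≤ ‖A u‖ := by
  have h := specSpan_lower (gram_isSymmetric A) (fun μ hμ => le_of_lt hμ) hu
  rw [inner_gram, real_inner_self_eq_norm_sq, ← mul_pow] at h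
  exact abs_le_of_sq_le_sq' h (norm_nonneg _) |>.2

/-- Vectors in the upper spectral subspaces of two nearby operators are close if their images
are. -/
lemma norm_sub_le_of_mem_specSpan {A A' : E →L[ℝ] F} (hA' : IsCompactOperator A') {β : ℝ}
    (hβ : 0 < β) {u v : E} (hu : u ∈ specSpan (gram A) (Ioi (β ^ 2)))
    (hv : v ∈ specSpan (gram A') (Ioi (β ^ 2))) :
    ‖u - v‖ ≤ 2 / β * ‖A' (u - v)‖ + 2 / β ^ 2 * ‖gram A - gram A'‖ * ‖u‖ := by
  have hβ2 : 0 < β ^ 2 := by positivity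
  -- Cutting at `β² / 2` rather than `β²` leaves room for the spectrum to move, while `P` still
  -- fixes `v`; so `x - P x = u - P u`, which is pure leakage.
  obtain ⟨P, hP1, hPT, hPo, hPlow, hPup, hPid⟩ := exists_spectral_cut (gram_isSymmetric A')
    (fun x => by rw [inner_gram, real_inner_self_eq_norm_sq]; positivity) (gram_isCompact hA')
    (half_pos hβ2)
  have hPv : P v = v := by
    obtain ⟨s, f, hs, hf, rfl⟩ := exists_sum_of_mem_specSpan hv
    refine hPid _ (Submodule.sum_mem _ fun μ hμ => mem_specSpan_of_eigen ?_ (hf μ))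
    have : β ^ 2 < μ := hs hμ
    simp only [mem_Ioi]
    linarith
  have hleak := norm_spectral_leak_le (gram_isSymmetric A) hβ2 hP1 hPT hPup hu
  set x := u - v with hx
  have hQx : x - P x = u - P u := by rw [hx, map_sub, hPv]; abel
  -- As `P` commutes with `gram A'`, the operator `A'` keeps the two pieces orthogonal, and
  -- Pythagoras bounds `‖A' (P x)‖` by `‖A' x‖`.
  have horth : ⟪A' (P x), A' (x - P x)⟫ = 0 := by
    rw [← inner_gram, hPT]
    exact hPo _ _
  have hpy : ‖A' (P x)‖ ≤ ‖A' x‖ := by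
    have e : A' x = A' (P x) + A' (x - P x) := by rw [← map_add]; congr 1; abel
    have := norm_add_sq_eq_norm_sq_add_norm_sq_of_inner_eq_zero _ _ horth
    rw [← e] at this
    nlinarith [norm_nonneg (A' (P x)), norm_nonneg (A' x), norm_nonneg (A' (x - P x))]
  -- The cut level gives the constant `√2 / β`, rounded up to `2 / β`.
  have hPx : ‖P x‖ ≤ 2 / β * ‖A' x‖ := by
    have h := hPlow x
    rw [inner_gram, real_inner_self_eq_norm_sq] at h
    have h2 : (β * ‖P x‖) ^ 2 ≤ (2 * ‖A' x‖) ^ 2 := by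
      have := pow_le_pow_left₀ (norm_nonneg _) hpy 2
      nlinarith [sq_nonneg ‖A' x‖]
    have h3 := abs_le_of_sq_le_sq' h2 (by positivity) |>.2
    rw [div_mul_eq_mul_div, le_div_iff₀ hβ]
    linarith
  calc ‖x‖ = ‖P x + (x - P x)‖ := by congr 1; abel
    _ ≤ ‖P x‖ + ‖x - P x‖ := norm_add_le _ _
    _ ≤ _ := by rw [hQx]; exact add_le_add hPx hleak

end Operators

/-! ### Weak convergence along filters and ultrafilters -/

section Weak

open Filter

variable {E F : Type*} [NormedAddCommGroup E] [InnerProductSpace ℝ E]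
  [NormedAddCommGroup F] [InnerProductSpace ℝ F]

/-- Weak convergence in an inner product space. -/
def WeakTendsto {ι : Type*} (u : ι → E) (l : Filter ι) (a : E) : Prop :=
  ∀ y : E, Tendsto (fun n => ⟪y, u n⟫) l (𝓝 ⟪y, a⟫)

lemma WeakTendsto.unique {ι : Type*} {u : ι → E} {l : Filter ι} [l.NeBot] {a b : E}
    (ha : WeakTendsto u l a) (hb : WeakTendsto u l b) : a = b :=
  ext_inner_left ℝ fun y => tendsto_nhds_unique (ha y) (hb y)

lemma WeakTendsto.of_tendsto {ι : Type*} {u : ι → E} {l : Filter ι} {a : E}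
    (h : Tendsto u l (𝓝 a)) : WeakTendsto u l a :=
  fun _ => tendsto_const_nhds.inner h

lemma WeakTendsto.map [CompleteSpace E] [CompleteSpace F] {ι : Type*} {u : ι → E} {l : Filter ι}
    {a : E} (h : WeakTendsto u l a) (T : E →L[ℝ] F) : WeakTendsto (fun n => T (u n)) l (T a) := by
  intro y
  simp_rw [← ContinuousLinearMap.adjoint_inner_left]
  exact h _

/-- Splitting `T n = T₀ + (T n - T₀)`, the second part tends to zero in norm on bounded vectors and
the first is weakly continuous. -/
lemma WeakTendsto.clm_apply [CompleteSpace E] [CompleteSpace F] {ι : Type*} {u : ι → E}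
    {l : Filter ι} {a : E} (h : WeakTendsto u l a) {M : ℝ} (hM : ∀ᶠ n in l, ‖u n‖ ≤ M)
    {T : ι → E →L[ℝ] F} {T₀ : E →L[ℝ] F} (hT : Tendsto T l (𝓝 T₀)) :
    WeakTendsto (fun n => T n (u n)) l (T₀ a) := by
  intro y
  have h0 : Tendsto (fun n => (T n - T₀) (u n)) l (𝓝 0) := by
    have hz : Tendsto (fun n => ‖T n - T₀‖ * M) l (𝓝 0) := by
      simpa using (tendsto_iff_norm_sub_tendsto_zero.1 hT).mul_const M
    refine squeeze_zero_norm' ?_ hz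
    filter_upwards [hM] with n hn
    exact ((T n - T₀).le_opNorm _).trans (by gcongr)
  have := ((tendsto_const_nhds (x := y)).inner h0).add (h.map T₀ y)
  simpa [← inner_add_right] using this

/-- The images eventually lie in a compact set, so along an ultrafilter they converge in norm;
uniqueness of weak limits identifies the limit. -/
lemma IsCompactOperator.tendsto_of_weakTendsto [CompleteSpace E] [CompleteSpace F] {ι : Type*}
    {u : ι → E} {l : Ultrafilter ι} {a : E} (h : WeakTendsto u l a) {M : ℝ}
    (hM : ∀ᶠ n in l, ‖u n‖ ≤ M) {T : E →L[ℝ] F} (hT : IsCompactOperator T) :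
    Tendsto (fun n => T (u n)) l (𝓝 (T a)) := by
  obtain ⟨K, hK, hTK⟩ := IsCompactOperator.image_closedBall_subset_compact (f := (T : E →ₗ[ℝ] F)) hT M
  have hmem : ∀ᶠ n in l, T (u n) ∈ K := by
    filter_upwards [hM] with n hn
    exact hTK ⟨u n, by simpa using hn, rfl⟩
  obtain ⟨b, -, hb⟩ := hK.ultrafilter_le_nhds (l.map fun n => T (u n)) (by
    rw [Ultrafilter.coe_map, le_principal_iff]; exact hmem)
  have hb' : Tendsto (fun n => T (u n)) l (𝓝 b) := hb
  rwa [(h.map T).unique (WeakTendsto.of_tendsto hb')]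

/-- Banach–Alaoglu, transported by the Riesz isomorphism. -/
lemma exists_weakTendsto [CompleteSpace E] {ι : Type*} {u : ι → E} {l : Ultrafilter ι} {M : ℝ}
    (hM : ∀ᶠ n in l, ‖u n‖ ≤ M) : ∃ a, WeakTendsto u l a := by
  let φ : ι → WeakDual ℝ E := fun n => StrongDual.toWeakDual (InnerProductSpace.toDual ℝ E (u n))
  have hK := WeakDual.isCompact_closedBall (𝕜 := ℝ) (0 : StrongDual ℝ E) M
  obtain ⟨b, -, hb⟩ := hK.ultrafilter_le_nhds (l.map φ) (by
    simp only [Ultrafilter.coe_map, le_principal_iff, mem_map]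
    filter_upwards [hM] with n hn
    simpa [φ] using hn)
  have hb' : Tendsto φ l (𝓝 b) := hb
  refine ⟨(InnerProductSpace.toDual ℝ E).symm (WeakDual.toStrongDual b), fun y => ?_⟩
  have := ((WeakDual.eval_continuous y).tendsto b).comp hb'
  rw [real_inner_comm, InnerProductSpace.toDual_symm_apply]
  refine this.congr fun n => ?_
  rw [real_inner_comm]
  simp [φ]

end Weak

/-! ### The stability theorem for families of compact operators -/

section Abstract

open Filter

variable {X E F : Type*} [NormedAddCommGroup X] [NormedSpace ℝ X] [FiniteDimensional ℝ X]
  [NormedAddCommGroup E] [InnerProductSpace ℝ E] [CompleteSpace E]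
  [NormedAddCommGroup F] [InnerProductSpace ℝ F] [CompleteSpace F]

/-- Lipschitz stability for an injective family of compact operators, restricted to the spectral
subspaces of `A_m^* A_m` above the level `β ^ 2`. -/
theorem exists_lipschitz_stability {B : Set X} (hB : IsCompact B) {A : X → E →L[ℝ] F}
    {A' : X → X →L[ℝ] E →L[ℝ] F} (hA : ∀ m ∈ B, HasStrictFDerivAt A (A' m) m)
    (hcpt : ∀ m ∈ B, IsCompactOperator (A m))
    (hU1 : ∀ m₁ ∈ B, ∀ m₂ ∈ B, ∀ u v : E, A m₁ u = A m₂ v → v ≠ 0 → m₁ = m₂ ∧ u = v)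
    (hU2 : ∀ q : X, ‖q‖ = 1 → ∀ m ∈ B, ∀ u v : E, A' m q u = A m v → u = 0)
    {A₁ A₂ β : ℝ} (hA₁ : 0 < A₁) (hβ : 0 < β) :
    ∃ C : ℝ, 0 < C ∧ ∀ m ∈ B, ∀ m' ∈ B, ∀ u ∈ specSpan (gram (A m)) (Ioi (β ^ 2)),
      ∀ v ∈ specSpan (gram (A m')) (Ioi (β ^ 2)), A₁ ≤ ‖A m' v‖ → ‖v‖ ≤ A₂ →
        C * ‖m - m'‖ ≤ ‖A m u - A m' v‖ := by
  by_contra! hcon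
  have hC : ∀ n : ℕ, (0 : ℝ) < 1 / ((n : ℝ) + 1) := fun n => by positivity
  choose m hm m' hm' u hu v hv hv1 hv2 hlt using fun n : ℕ => hcon _ (hC n)
  -- A free ultrafilter makes all later limits exist simultaneously and replaces nested
  -- subsequences.
  set l : Ultrafilter ℕ := hyperfilter ℕ
  have hl : (l : Filter ℕ) ≤ atTop := by
    rw [← Nat.cofinite_eq_atTop]; exact hyperfilter_le_cofinite
  have hC0 : Tendsto (fun n : ℕ => 1 / ((n : ℝ) + 1)) l (𝓝 0) :=
    tendsto_one_div_add_atTop_nhds_zero_nat.mono_left hl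
  obtain ⟨a, haB, ha⟩ := hB.ultrafilter_le_nhds (l.map m)
    (by rw [le_principal_iff]; exact Filter.Eventually.of_forall (f := (l : Filter ℕ)) hm)
  obtain ⟨b, hbB, hb⟩ := hB.ultrafilter_le_nhds (l.map m')
    (by rw [le_principal_iff]; exact Filter.Eventually.of_forall (f := (l : Filter ℕ)) hm')
  replace ha : Tendsto m l (𝓝 a) := ha
  replace hb : Tendsto m' l (𝓝 b) := hb
  have hAm : Tendsto (fun n => A (m n)) l (𝓝 (A a)) :=
    ((hA a haB).hasFDerivAt.continuousAt.tendsto).comp ha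
  have hAm' : Tendsto (fun n => A (m' n)) l (𝓝 (A b)) :=
    ((hA b hbB).hasFDerivAt.continuousAt.tendsto).comp hb
  set t : ℕ → ℝ := fun n => ‖m n - m' n‖ with ht
  -- The failed inequality is strict, so equal parameters are excluded and division by `t n` is
  -- legitimate.
  have ht0 : ∀ n, 0 < t n := fun n => by
    have := (norm_nonneg _).trans_lt (hlt n)
    exact pos_of_mul_pos_right this (hC n).le
  have htt : Tendsto t l (𝓝 ‖a - b‖) := (ha.sub hb).norm
  -- the images are close
  have hdiff : Tendsto (fun n => A (m n) (u n) - A (m' n) (v n)) l (𝓝 0) := by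
    have : Tendsto (fun n : ℕ => 1 / ((n : ℝ) + 1) * t n) l (𝓝 0) := by
      simpa using hC0.mul htt
    exact squeeze_zero_norm (fun n => (hlt n).le) this
  -- weak limits
  have hvb : ∀ᶠ n in l, ‖v n‖ ≤ A₂ := Filter.Eventually.of_forall hv2
  have hMu : ∀ᶠ n in l, ‖u n‖ ≤ ((‖A b‖ + 1) * A₂ + 1) / β := by
    filter_upwards [hAm'.norm.eventually_le_const (lt_add_one _),
      hdiff.norm.eventually_le_const (by simp : ‖(0 : F)‖ < 1)] with n h1 h2
    rw [le_div_iff₀ hβ, mul_comm]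
    calc β * ‖u n‖ ≤ ‖A (m n) (u n)‖ := norm_le_of_mem_specSpan_gram _ (hu n)
      _ = ‖A (m' n) (v n) + (A (m n) (u n) - A (m' n) (v n))‖ := by congr 1; abel
      _ ≤ ‖A (m' n) (v n)‖ + 1 := (norm_add_le _ _).trans (by gcongr)
      _ ≤ (‖A b‖ + 1) * A₂ + 1 := by
        gcongr
        exact ((A (m' n)).le_opNorm _).trans
          (mul_le_mul h1 (hv2 n) (norm_nonneg _) (by positivity))
  set Mu := ((‖A b‖ + 1) * A₂ + 1) / β
  obtain ⟨u₀, hu₀⟩ := exists_weakTendsto hMu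
  obtain ⟨v₀, hv₀⟩ := exists_weakTendsto hvb
  have hAu := hu₀.clm_apply hMu hAm
  have hAv := hv₀.clm_apply hvb hAm'
  have heq : A a u₀ = A b v₀ := by
    refine hAu.unique fun y => ?_
    have := (hAv y).add (WeakTendsto.of_tendsto hdiff y)
    simpa [← inner_add_right] using this
  -- If the weak limit were zero, compactness of `A b` would send `A b (v n)`, and hence `A (m' n)
  -- (v n)`, to zero in norm, against the lower bound `A₁`.
  have hv₀0 : v₀ ≠ 0 := by
    rintro rfl
    have h1 := IsCompactOperator.tendsto_of_weakTendsto hv₀ hvb (hcpt b hbB)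
    have h2 : Tendsto (fun n => (A (m' n) - A b) (v n)) l (𝓝 0) := by
      have hz : Tendsto (fun n => ‖A (m' n) - A b‖ * A₂) l (𝓝 0) := by
        simpa using (tendsto_iff_norm_sub_tendsto_zero.1 hAm').mul_const A₂
      exact squeeze_zero_norm (fun n => ((A (m' n) - A b).le_opNorm _).trans
        (mul_le_mul_of_nonneg_left (hv2 n) (norm_nonneg _))) hz
    have h3 := (h1.add h2).norm
    simp only [_root_.sub_apply, add_sub_cancel, map_zero, add_zero, norm_zero] at h3
    exact absurd (ge_of_tendsto' h3 hv1) (not_le.2 hA₁)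
  obtain ⟨rfl, rfl⟩ := hU1 a haB b hbB u₀ v₀ heq hv₀0
  -- difference quotients
  set q : ℕ → X := fun n => (t n)⁻¹ • (m n - m' n) with hq
  have hqn : ∀ n, ‖q n‖ = 1 := fun n => by
    rw [hq, norm_smul, norm_inv, Real.norm_of_nonneg (ht0 n).le]
    exact inv_mul_cancel₀ (ht0 n).ne'
  obtain ⟨q₀, hq₀n, hq₀⟩ := (isCompact_sphere (0 : X) 1).ultrafilter_le_nhds (l.map q)
    (by rw [le_principal_iff]; exact Filter.Eventually.of_forall (f := (l : Filter ℕ)) fun n => by simp [hqn n])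
  replace hq₀ : Tendsto q l (𝓝 q₀) := hq₀
  have hq₀1 : ‖q₀‖ = 1 := by simpa using hq₀n
  set D : ℕ → E →L[ℝ] F := fun n => (t n)⁻¹ • (A (m n) - A (m' n)) with hD
  have hDt : Tendsto D l (𝓝 (A' a q₀)) := by
    have h1 : Tendsto (fun n => A' a (q n)) l (𝓝 (A' a q₀)) :=
      ((A' a).continuous.tendsto _).comp hq₀
    -- Both `m n` and `m' n` move towards `a`, so strict differentiability at `a` is what is needed
    -- here.
    have h2 : Tendsto (fun n => D n - A' a (q n)) l (𝓝 0) := by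
      have hs := (hA a haB).isLittleO.comp_tendsto (ha.prodMk_nhds hb)
      refine tendsto_zero_iff_norm_tendsto_zero.2 ?_
      have := hs.norm_norm.tendsto_div_nhds_zero
      refine this.congr fun n => ?_
      simp only [Function.comp_apply, hD, hq, map_smul, ← smul_sub, norm_smul, norm_inv,
        Real.norm_of_nonneg (ht0 n).le]
      rw [div_eq_inv_mul]
    simpa using h2.add h1
  have hAD : ∀ n x, A (m n) x - A (m' n) x = t n • D n x := fun n x => by
    simp [hD, smul_inv_smul₀ (ht0 n).ne']
  set w : ℕ → E := fun n => (t n)⁻¹ • (v n - u n) with hw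
  have hAw : ∀ n, A (m' n) (w n) =
      D n (u n) - (t n)⁻¹ • (A (m n) (u n) - A (m' n) (v n)) := fun n => by
    have : D n (u n) = (t n)⁻¹ • (A (m n) (u n) - A (m' n) (u n)) := by
      rw [hAD, inv_smul_smul₀ (ht0 n).ne']
    rw [this, ← smul_sub, hw, map_smul, map_sub]
    congr 1
    abel
  have hrem : Tendsto (fun n => (t n)⁻¹ • (A (m n) (u n) - A (m' n) (v n))) l (𝓝 0) := by
    refine squeeze_zero_norm (fun n => ?_) hC0
    rw [norm_smul, norm_inv, Real.norm_of_nonneg (ht0 n).le, inv_mul_le_iff₀ (ht0 n), mul_comm]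
    exact (hlt n).le
  set Md := ‖A' a q₀‖ + 1
  set Ma := ‖A a‖ + 1
  -- The crux. In the spectral estimate for `u n - v n`, the image term is `t n * ‖A (m' n) (w n)‖`,
  -- with the last factor bounded by `hAw`, and the leakage term is `O(t n)` by the operator
  -- increment; the factor `t n` cancels.
  have hwb : ∀ᶠ n in l, ‖w n‖ ≤ 2 / β * (Md * Mu + 1) + 2 / β ^ 2 * ((Ma + Ma) * Md) * Mu := by
    filter_upwards [hAm.norm.eventually_le_const (lt_add_one _),
      hAm'.norm.eventually_le_const (lt_add_one _), hMu,
      hDt.norm.eventually_le_const (lt_add_one _),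
      hrem.norm.eventually_le_const (by simp : ‖(0 : F)‖ < 1)] with n h1 h2 h3 h4 h5
    have hkey := norm_sub_le_of_mem_specSpan (hcpt _ (hm' n)) hβ (hu n) (hv n)
    have hg := norm_gram_sub_le (A (m n)) (A (m' n))
    have hDn : ‖A (m n) - A (m' n)‖ = t n * ‖D n‖ := by
      rw [hD, norm_smul, norm_inv, Real.norm_of_nonneg (ht0 n).le,
        mul_inv_cancel_left₀ (ht0 n).ne']
    have hwn : ‖u n - v n‖ = t n * ‖w n‖ := by
      rw [hw, norm_smul, norm_inv, Real.norm_of_nonneg (ht0 n).le,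
        mul_inv_cancel_left₀ (ht0 n).ne', norm_sub_rev]
    have hAwn : ‖A (m' n) (u n - v n)‖ = t n * ‖A (m' n) (w n)‖ := by
      rw [hw, map_smul, norm_smul, norm_inv, Real.norm_of_nonneg (ht0 n).le,
        mul_inv_cancel_left₀ (ht0 n).ne', ← norm_neg, ← map_neg, neg_sub]
    have hAw1 : ‖A (m' n) (w n)‖ ≤ Md * Mu + 1 := by
      rw [hAw]
      refine (norm_sub_le _ _).trans (add_le_add ?_ h5)
      exact ((D n).le_opNorm _).trans (mul_le_mul h4 h3 (norm_nonneg _) (by positivity))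
    rw [hwn, hAwn] at hkey
    rw [hDn] at hg
    have hg2 : ‖gram (A (m n)) - gram (A (m' n))‖ ≤ t n * ((Ma + Ma) * Md) := by
      refine hg.trans ?_
      rw [mul_left_comm]
      have := (ht0 n).le
      gcongr
    refine le_of_mul_le_mul_left (hkey.trans ?_) (ht0 n)
    have h0 : 0 ≤ t n := (ht0 n).le
    calc _ ≤ 2 / β * (t n * (Md * Mu + 1)) + 2 / β ^ 2 * (t n * ((Ma + Ma) * Md)) * Mu := by
          gcongr
      _ = _ := by ring
  obtain ⟨w₀, hw₀⟩ := exists_weakTendsto hwb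
  have hfin : A' a q₀ u₀ = A a w₀ := by
    refine WeakTendsto.unique (l := (l : Filter ℕ)) (fun y => ?_) (hw₀.clm_apply hwb hAm')
    have := ((hu₀.clm_apply hMu hDt) y).sub (WeakTendsto.of_tendsto hrem y)
    simp_rw [hAw, inner_sub_right]
    simpa using this
  exact hv₀0 (hU2 q₀ hq₀1 a haB u₀ w₀ hfin)

end Abstract

/-! ### Integral operators with continuous kernel on `L²` -/

section Kernel

set_option linter.unusedSectionVars false

open Filter
open scoped ENNReal

variable {X Y : Type*} [MetricSpace X] [MeasurableSpace X] [BorelSpace X]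
  [SecondCountableTopology X] [MetricSpace Y] [MeasurableSpace Y] [BorelSpace Y]
  [SecondCountableTopology Y]

lemma integral_abs_le_norm {μ : Measure Y} [IsFiniteMeasure μ] (g : Lp ℝ 2 μ) :
    ∫ y, |g y| ∂μ ≤ (μ univ ^ (1 / 2 : ℝ)).toReal * ‖g‖ := by
  have h := eLpNorm_le_eLpNorm_mul_rpow_measure_univ (p := 1) (q := 2) (μ := μ)
    (by norm_num) (Lp.aestronglyMeasurable g)
  have hfin : eLpNorm g 2 μ * μ univ ^ (1 / (1 : ℝ≥0∞).toReal - 1 / (2 : ℝ≥0∞).toReal) ≠ ⊤ := by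
    refine ENNReal.mul_ne_top (Lp.eLpNorm_ne_top g) ?_
    exact ENNReal.rpow_ne_top_of_nonneg (by norm_num) (measure_ne_top _ _)
  have h2 := ENNReal.toReal_mono hfin h
  rw [ENNReal.toReal_mul, eLpNorm_one_eq_lintegral_enorm,
    ← integral_norm_eq_lintegral_enorm (Lp.aestronglyMeasurable g)] at h2
  simp only [Real.norm_eq_abs] at h2
  rw [Lp.norm_def, mul_comm]
  convert h2 using 4
  norm_num

variable {μ : Measure Y} {ν : Measure X} {R : Set Y} {V : Set X}

lemma ContinuousOn.aestronglyMeasurable_section {κ : X → Y → ℝ} (hR : IsCompact R)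
    (hκ : ContinuousOn (fun z : X × Y => κ z.1 z.2) (V ×ˢ R)) {x : X} (hx : x ∈ V) :
    AEStronglyMeasurable (κ x) (μ.restrict R) := by
  have : ContinuousOn (κ x) R :=
    hκ.comp (f := fun y => (x, y)) (by fun_prop) (fun y hy => ⟨hx, hy⟩)
  exact this.aestronglyMeasurable hR.measurableSet

lemma exists_kernel_bound {κ : X → Y → ℝ} (hV : IsCompact V) (hR : IsCompact R)
    (hκ : ContinuousOn (fun z : X × Y => κ z.1 z.2) (V ×ˢ R)) :
    ∃ M, 0 ≤ M ∧ ∀ x ∈ V, ∀ y ∈ R, |κ x y| ≤ M := by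
  obtain ⟨M, hM⟩ := (hV.prod hR).exists_bound_of_continuousOn hκ
  exact ⟨max M 0, le_max_right _ _, fun x hx y hy => (hM (x, y) ⟨hx, hy⟩).trans (le_max_left _ _)⟩

lemma ae_abs_section_le {κ : X → Y → ℝ} (hR : IsCompact R) {M : ℝ}
    (hM : ∀ x ∈ V, ∀ y ∈ R, |κ x y| ≤ M) {x : X} (hx : x ∈ V) :
    ∀ᵐ y ∂(μ.restrict R), |κ x y| ≤ M :=
  (ae_restrict_mem hR.measurableSet).mono fun y hy => hM x hx y hy

lemma integrable_kernel_mul [IsFiniteMeasure (μ.restrict R)] {κ : X → Y → ℝ} (hV : IsCompact V)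
    (hR : IsCompact R) (hκ : ContinuousOn (fun z : X × Y => κ z.1 z.2) (V ×ˢ R)) {x : X}
    (hx : x ∈ V) (g : Lp ℝ 2 (μ.restrict R)) :
    Integrable (fun y => κ x y * g y) (μ.restrict R) := by
  obtain ⟨M, -, hM⟩ := exists_kernel_bound hV hR hκ
  exact ((Lp.memLp g).integrable (by norm_num)).bdd_mul
    (ContinuousOn.aestronglyMeasurable_section hR hκ hx) (ae_abs_section_le hR hM hx)

lemma abs_kernel_integral_le [IsFiniteMeasure (μ.restrict R)] {κ : X → Y → ℝ} (hR : IsCompact R)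
    {M : ℝ} (hM0 : 0 ≤ M) (hM : ∀ x ∈ V, ∀ y ∈ R, |κ x y| ≤ M) {x : X} (hx : x ∈ V)
    (g : Lp ℝ 2 (μ.restrict R)) :
    |∫ y, κ x y * g y ∂(μ.restrict R)| ≤
      M * ((μ.restrict R univ ^ (1 / 2 : ℝ)).toReal * ‖g‖) := by
  have hg : Integrable (fun y => |g y|) (μ.restrict R) :=
    ((Lp.memLp g).integrable (by norm_num)).abs
  have h1 : |∫ y, κ x y * g y ∂(μ.restrict R)| ≤ ∫ y, M * |g y| ∂(μ.restrict R) := by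
    rw [← Real.norm_eq_abs]
    refine norm_integral_le_of_norm_le (hg.const_mul M) ?_
    filter_upwards [ae_abs_section_le hR hM hx] with y hy
    rw [norm_mul]
    exact mul_le_mul_of_nonneg_right hy (abs_nonneg _)
  rw [integral_const_mul] at h1
  exact h1.trans (mul_le_mul_of_nonneg_left (integral_abs_le_norm g) hM0)

lemma continuousOn_kernel_integral [IsFiniteMeasure (μ.restrict R)] {κ : X → Y → ℝ}
    (hV : IsCompact V) (hR : IsCompact R)
    (hκ : ContinuousOn (fun z : X × Y => κ z.1 z.2) (V ×ˢ R)) (g : Lp ℝ 2 (μ.restrict R)) :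
    ContinuousOn (fun x => ∫ y, κ x y * g y ∂(μ.restrict R)) V := by
  obtain ⟨M, hM0, hM⟩ := exists_kernel_bound hV hR hκ
  refine continuousOn_of_dominated (bound := fun y => M * |g y|) (fun x hx => ?_) (fun x hx => ?_)
    ?_ ?_
  · exact (integrable_kernel_mul hV hR hκ hx g).aestronglyMeasurable
  · filter_upwards [ae_abs_section_le hR hM hx] with y hy
    rw [norm_mul]
    exact mul_le_mul_of_nonneg_right hy (abs_nonneg _)
  · exact ((Lp.memLp g).integrable (by norm_num)).abs.const_mul M
  · filter_upwards [ae_restrict_mem hR.measurableSet] with y hy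
    refine ContinuousOn.mul ?_ continuousOn_const
    exact hκ.comp (f := fun x => (x, y)) (by fun_prop) (fun x hx => ⟨hx, hy⟩)

lemma memLp_kernel_integral [IsFiniteMeasure (μ.restrict R)] [IsFiniteMeasure (ν.restrict V)]
    {κ : X → Y → ℝ} (hV : IsCompact V) (hR : IsCompact R)
    (hκ : ContinuousOn (fun z : X × Y => κ z.1 z.2) (V ×ˢ R)) (g : Lp ℝ 2 (μ.restrict R)) :
    MemLp (fun x => ∫ y, κ x y * g y ∂(μ.restrict R)) 2 (ν.restrict V) := by
  have hc := continuousOn_kernel_integral (μ := μ) hV hR hκ g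
  obtain ⟨M, hM⟩ := hV.exists_bound_of_continuousOn hc
  exact MemLp.of_bound (hc.aestronglyMeasurable hV.measurableSet) M
    ((ae_restrict_mem hV.measurableSet).mono hM)

lemma exists_weak_subseq {E : Type*} [NormedAddCommGroup E] [InnerProductSpace ℝ E]
    [CompleteSpace E] [TopologicalSpace.SeparableSpace E] {u : ℕ → E} {M : ℝ}
    (hM : ∀ n, ‖u n‖ ≤ M) :
    ∃ a, ‖a‖ ≤ M ∧ ∃ φ : ℕ → ℕ, StrictMono φ ∧ WeakTendsto (u ∘ φ) atTop a := by
  let F : ℕ → WeakDual ℝ E := fun n => StrongDual.toWeakDual (InnerProductSpace.toDual ℝ E (u n))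
  obtain ⟨b, hbM, φ, hφ, hb⟩ := WeakDual.isSeqCompact_closedBall ℝ E 0 M
    (x := F) (fun n => by simpa [F] using hM n)
  refine ⟨(InnerProductSpace.toDual ℝ E).symm (WeakDual.toStrongDual b), ?_, φ, hφ, fun y => ?_⟩
  · rw [LinearIsometryEquiv.norm_map]
    simpa using hbM
  have := ((WeakDual.eval_continuous y).tendsto b).comp hb
  rw [real_inner_comm, InnerProductSpace.toDual_symm_apply]
  refine this.congr fun n => ?_
  rw [real_inner_comm]
  simp [F]

/-- Integral operators with continuous kernel between the `L²` spaces of finite measures on compact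
sets. -/
lemma exists_kernelOp [IsFiniteMeasure (μ.restrict R)] [IsFiniteMeasure (ν.restrict V)]
    (hV : IsCompact V) (hR : IsCompact R) {κ : X → Y → ℝ}
    (hκ : ContinuousOn (fun z : X × Y => κ z.1 z.2) (V ×ˢ R)) :
    ∃ T : Lp ℝ 2 (μ.restrict R) →L[ℝ] Lp ℝ 2 (ν.restrict V),
      (∀ g, T g =ᵐ[ν.restrict V] fun x => ∫ y, κ x y * g y ∂(μ.restrict R)) ∧
      (∀ M, 0 ≤ M → (∀ x ∈ V, ∀ y ∈ R, |κ x y| ≤ M) →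
        ‖T‖ ≤ (measureUnivNNReal (ν.restrict V) : ℝ) ^ (2 : ℝ≥0∞).toReal⁻¹ *
          (μ.restrict R univ ^ (1 / 2 : ℝ)).toReal * M) ∧
      IsCompactOperator T := by
  set c₁ : ℝ := (measureUnivNNReal (ν.restrict V) : ℝ) ^ (2 : ℝ≥0∞).toReal⁻¹
  have hc₁ : 0 ≤ c₁ := by positivity
  set c₂ : ℝ := (μ.restrict R univ ^ (1 / 2 : ℝ)).toReal
  have hc₂ : 0 ≤ c₂ := ENNReal.toReal_nonneg
  have hmem := fun g => memLp_kernel_integral (μ := μ) (ν := ν) hV hR hκ g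
  have hint := fun x hx g => integrable_kernel_mul (μ := μ) hV hR hκ (x := x) hx g
  have hbd : ∀ M, 0 ≤ M → (∀ x ∈ V, ∀ y ∈ R, |κ x y| ≤ M) → ∀ g,
      ‖(hmem g).toLp _‖ ≤ c₁ * c₂ * M * ‖g‖ := by
    intro M hM0 hM g
    have h1 : ∀ᵐ x ∂(ν.restrict V), ‖(hmem g).toLp _ x‖ ≤ M * (c₂ * ‖g‖) := by
      filter_upwards [(hmem g).coeFn_toLp, ae_restrict_mem hV.measurableSet] with x hx hxV
      rw [hx]
      exact abs_kernel_integral_le hR hM0 hM hxV g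
    have h2 := Lp.norm_le_of_ae_bound (by positivity) h1
    refine h2.trans (le_of_eq ?_)
    ring
  let T₀ : Lp ℝ 2 (μ.restrict R) →ₗ[ℝ] Lp ℝ 2 (ν.restrict V) :=
    { toFun := fun g => (hmem g).toLp _
      map_add' := fun g h => by
        rw [← MemLp.toLp_add]
        refine MemLp.toLp_congr _ _ ?_
        filter_upwards [ae_restrict_mem hV.measurableSet] with x hx
        rw [Pi.add_apply, ← integral_add (hint x hx g) (hint x hx h)]
        refine integral_congr_ae ?_
        filter_upwards [Lp.coeFn_add g h] with y hy
        rw [hy, Pi.add_apply, mul_add]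
      map_smul' := fun a g => by
        rw [RingHom.id_apply, ← MemLp.toLp_const_smul]
        refine MemLp.toLp_congr _ _ ?_
        filter_upwards with x
        rw [Pi.smul_apply, smul_eq_mul, ← integral_const_mul]
        refine integral_congr_ae ?_
        filter_upwards [Lp.coeFn_smul a g] with y hy
        rw [hy, Pi.smul_apply, smul_eq_mul, mul_left_comm] }
  obtain ⟨M₀, hM₀0, hM₀⟩ := exists_kernel_bound hV hR hκ
  let T := T₀.mkContinuous (c₁ * c₂ * M₀) (hbd M₀ hM₀0 hM₀)
  have hT : ∀ g, T g =ᵐ[ν.restrict V] fun x => ∫ y, κ x y * g y ∂(μ.restrict R) :=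
    fun g => (hmem g).coeFn_toLp
  refine ⟨T, hT, fun M hM0 hM => ?_, ?_⟩
  · exact T.opNorm_le_bound (by positivity) (hbd M hM0 hM)
  -- weak convergence becomes strong
  have hstrong : ∀ (h : ℕ → Lp ℝ 2 (μ.restrict R)) (a : Lp ℝ 2 (μ.restrict R)) (N : ℝ),
      (∀ n, ‖h n‖ ≤ N) → WeakTendsto h atTop a → Tendsto (fun n => T (h n)) atTop (𝓝 (T a)) := by
    intro h a N hN hw
    -- For fixed `x` the integral is the inner product with the section `κ x`, so weak convergence
    -- gives pointwise convergence of the images. Norm convergence then follows by domination with a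
    -- constant on a finite measure space.
    have hpt : ∀ x ∈ V, Tendsto (fun n => ∫ y, κ x y * h n y ∂(μ.restrict R)) atTop
        (𝓝 (∫ y, κ x y * a y ∂(μ.restrict R))) := by
      intro x hx
      have hκx : MemLp (κ x) 2 (μ.restrict R) :=
        MemLp.of_bound (ContinuousOn.aestronglyMeasurable_section hR hκ hx) M₀
          (ae_abs_section_le hR hM₀ hx)
      have hin : ∀ g : Lp ℝ 2 (μ.restrict R),
          ⟪hκx.toLp _, g⟫ = ∫ y, κ x y * g y ∂(μ.restrict R) := by
        intro g
        rw [L2.inner_def]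
        refine integral_congr_ae ?_
        filter_upwards [hκx.coeFn_toLp] with y hy
        rw [hy]
        simp [mul_comm]
      simpa only [hin] using hw (hκx.toLp _)
    rw [tendsto_iff_norm_sub_tendsto_zero]
    have hsq : Tendsto (fun n => ‖T (h n) - T a‖ ^ 2) atTop (𝓝 0) := by
      have e : ∀ n, ‖T (h n) - T a‖ ^ 2 = ∫ x, ((∫ y, κ x y * h n y ∂(μ.restrict R)) -
          ∫ y, κ x y * a y ∂(μ.restrict R)) ^ 2 ∂(ν.restrict V) := by
        intro n
        rw [← real_inner_self_eq_norm_sq, L2.inner_def]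
        refine integral_congr_ae ?_
        filter_upwards [Lp.coeFn_sub (T (h n)) (T a), hT (h n), hT a] with x h1 h2 h3
        rw [h1, Pi.sub_apply, h2, h3, real_inner_self_eq_norm_sq, Real.norm_eq_abs, sq_abs]
      simp_rw [e]
      have h0 : (0 : ℝ) = ∫ x, (0 : ℝ) ∂(ν.restrict V) := by simp
      rw [h0]
      refine tendsto_integral_of_dominated_convergence
        (fun _ => (M₀ * (c₂ * N) + M₀ * (c₂ * ‖a‖)) ^ 2) (fun n => ?_) (integrable_const _)
        (fun n => ?_) ?_
      · exact (((hmem (h n)).aestronglyMeasurable).sub (hmem a).aestronglyMeasurable).pow 2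
      · filter_upwards [ae_restrict_mem hV.measurableSet] with x hx
        rw [norm_pow]
        refine pow_le_pow_left₀ (norm_nonneg _) ?_ 2
        refine (norm_sub_le _ _).trans (add_le_add ?_ (abs_kernel_integral_le hR hM₀0 hM₀ hx a))
        refine (abs_kernel_integral_le hR hM₀0 hM₀ hx (h n)).trans ?_
        have := hN n
        gcongr
      · filter_upwards [ae_restrict_mem hV.measurableSet] with x hx
        have := ((hpt x hx).sub_const (∫ y, κ x y * a y ∂(μ.restrict R))).pow 2
        simpa using this
    have := (Real.continuous_sqrt.tendsto 0).comp hsq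
    simpa [Function.comp_def, Real.sqrt_sq (norm_nonneg _)] using this
  refine (isCompactOperator_iff_image_closedBall_subset_compact (T : Lp ℝ 2 (μ.restrict R) →ₗ[ℝ] Lp ℝ 2 (ν.restrict V)) one_pos).2
    ⟨_, ?_, Subset.rfl⟩
  -- The weak limit stays in the closed unit ball, so the image of the ball is itself compact and
  -- serves as the required compact set.
  refine IsSeqCompact.isCompact fun y hy => ?_
  choose g hg hgy using hy
  have : Fact ((2 : ℝ≥0∞) ≠ ⊤) := ⟨by norm_num⟩
  obtain ⟨a, ha, φ, hφ, hw⟩ := exists_weak_subseq (u := g) (M := 1) (fun n => by simpa using hg n)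
  refine ⟨T a, ⟨a, by simpa using ha, rfl⟩, φ, hφ, ?_⟩
  have := hstrong _ a 1 (fun n => by simpa using hg (φ n)) hw
  refine this.congr fun n => ?_
  exact hgy (φ n)

end Kernel

/-! ### Regularity of the kernel in the parameter -/

section Parameter

open Filter

variable {p : ℕ}

/-- Two points of `ℝᵖ` are joined by a path along the coordinate directions. -/
lemma exists_coord_path (a b : Eu p) : ∃ c : ℕ → Eu p, c 0 = a ∧ c p = b ∧
    ∀ i : Fin p, c (i + 1) = c i + (b i - a i) • stdVec i ∧
      ∀ s ∈ uIcc 0 (b i - a i), ‖c i + s • stdVec i - a‖ ≤ ‖b - a‖ := by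
  -- After `n` steps the coordinates of index below `n` are those of `b`. Every coordinate stays
  -- between its values at `a` and `b`, so the path never gets farther from `a` than `b` is.
  refine ⟨fun n => WithLp.toLp 2 fun j => if j.val < n then b j else a j, ?_, ?_, fun i => ⟨?_, ?_⟩⟩
  · ext j; simp
  · ext j; simp
  · ext j
    by_cases h : j = i
    · subst h; simp [stdVec]
    · have h' : j.val ≠ i.val := fun e => h (Fin.ext e)
      have : j.val < i.val + 1 ↔ j.val < i.val := by omega
      simp [stdVec, h, this]
  · intro s hs
    rw [EuclideanSpace.norm_eq, EuclideanSpace.norm_eq]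
    refine Real.sqrt_le_sqrt (Finset.sum_le_sum fun j _ => ?_)
    refine pow_le_pow_left₀ (norm_nonneg _) ?_ 2
    by_cases h : j = i
    · subst h
      have := abs_sub_left_of_mem_uIcc hs
      simpa [stdVec] using this
    · by_cases h' : j < i
      · simp [stdVec, h, h']
      · simp [stdVec, h, h']

lemma hasDerivAt_coord_line {f : Eu p → ℝ} {c : Eu p} {i : Fin p} {s : ℝ}
    (h : LineDifferentiableAt ℝ f (c + s • stdVec i) (stdVec i)) :
    HasDerivAt (fun t : ℝ => f (c + t • stdVec i)) (pd i f (c + s • stdVec i)) s := by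
  have h1 : HasDerivAt (fun t : ℝ => f (c + s • stdVec i + t • stdVec i))
      (pd i f (c + s • stdVec i)) (s - s) := by
    rw [sub_self]; exact h.hasLineDerivAt
  have h2 := h1.comp_sub_const s s
  refine h2.congr_of_eventuallyEq (Eventually.of_forall fun t => ?_)
  simp only
  congr 1
  rw [add_assoc, ← add_smul]
  congr 2
  ring

/-- A quantitative form of the statement that continuous partial derivatives give strict
differentiability. -/
lemma abs_sub_sub_partial_le {f : Eu p → ℝ} {a m₁ m₂ : Eu p} {δ ε : ℝ} {D : Fin p → ℝ}
    (hd : ∀ i, ∀ m ∈ Metric.ball a δ, LineDifferentiableAt ℝ f m (stdVec i))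
    (hD : ∀ i, ∀ m ∈ Metric.ball a δ, |pd i f m - D i| ≤ ε) (h : ‖m₂ - a‖ + ‖m₁ - m₂‖ < δ) :
    |f m₁ - f m₂ - ∑ i, (m₁ - m₂) i * D i| ≤ p * ε * ‖m₁ - m₂‖ := by
  obtain ⟨c, hc0, hcp, hc⟩ := exists_coord_path m₂ m₁
  have htel : f m₁ - f m₂ = ∑ i : Fin p, (f (c (i + 1)) - f (c i)) := by
    rw [Fin.sum_univ_eq_sum_range (fun i => f (c (i + 1)) - f (c i)) p,
      Finset.sum_range_sub (fun i => f (c i)), hc0, hcp]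
  rw [htel, ← Finset.sum_sub_distrib]
  have hstep : ∀ i : Fin p, |f (c (i + 1)) - f (c i) - (m₁ - m₂) i * D i| ≤ ε * ‖m₁ - m₂‖ := by
    intro i
    obtain ⟨h1, h2⟩ := hc i
    set τ := m₁ i - m₂ i with hτ
    have hball : ∀ s ∈ uIcc 0 τ, c i + s • stdVec i ∈ Metric.ball a δ := by
      intro s hs
      rw [mem_ball_iff_norm]
      calc ‖c i + s • stdVec i - a‖ = ‖(m₂ - a) + (c i + s • stdVec i - m₂)‖ := by congr 1; abel
        _ ≤ ‖m₂ - a‖ + ‖m₁ - m₂‖ := (norm_add_le _ _).trans (by gcongr; exact h2 s hs)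
        _ < δ := h
    have hε : 0 ≤ ε := (abs_nonneg _).trans (hD i _ (hball 0 left_mem_uIcc))
    -- Once the linear part is subtracted, the derivative along the step is at most `ε`, and the
    -- mean value inequality applies.
    have hder : ∀ s ∈ uIcc 0 τ, HasDerivWithinAt (fun t : ℝ => f (c i + t • stdVec i) - t * D i)
        (pd i f (c i + s • stdVec i) - D i) (uIcc 0 τ) s := by
      intro s hs
      have := (hasDerivAt_coord_line (hd i _ (hball s hs))).sub
        ((hasDerivAt_id s).mul_const (D i))
      rw [one_mul] at this
      exact this.hasDerivWithinAt
    have hmv := (convex_uIcc (0 : ℝ) τ).norm_image_sub_le_of_norm_hasDerivWithin_le hder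
      (fun s hs => hD i _ (hball s hs)) left_mem_uIcc right_mem_uIcc
    have hτn : |τ| ≤ ‖m₁ - m₂‖ := by
      have := PiLp.norm_apply_le (m₁ - m₂) i
      simpa [hτ] using this
    have e : (m₁ - m₂) i = τ := by simp [hτ]
    rw [h1, e]
    simp only [zero_smul, add_zero, zero_mul, sub_zero] at hmv
    calc _ = ‖f (c i + τ • stdVec i) - τ * D i - f (c i)‖ := by
          rw [Real.norm_eq_abs]; congr 1; ring
      _ ≤ _ := hmv
      _ ≤ _ := by gcongr; exact hτn
  calc _ ≤ ∑ i : Fin p, |f (c (i + 1)) - f (c i) - (m₁ - m₂) i * D i| :=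
        Finset.abs_sum_le_sum_abs _ _
    _ ≤ ∑ _i : Fin p, ε * ‖m₁ - m₂‖ := Finset.sum_le_sum fun i _ => hstep i
    _ = _ := by simp [mul_assoc]

variable {X Y : Type*} [MetricSpace X] [MetricSpace Y] {R : Set Y} {V : Set X}
  {H : Eu p → X → Y → ℝ} {B' : Set (Eu p)}

/-- The kernels and their partial derivatives in the parameter are uniformly controlled. -/
lemma exists_uniform_partial (hV : IsCompact V) (hR : IsCompact R) (hB' : IsOpen B')
    (hcm : ∀ i, ContinuousOn
      (fun z : Eu p × X × Y => pd i (fun m' => H m' z.2.1 z.2.2) z.1) (B' ×ˢ V ×ˢ R))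
    {a : Eu p} (ha : a ∈ B') {ε : ℝ} (hε : 0 < ε) :
    ∃ δ > 0, Metric.ball a δ ⊆ B' ∧ ∀ i, ∀ m ∈ Metric.ball a δ, ∀ x ∈ V, ∀ y ∈ R,
      |pd i (fun m' => H m' x y) m - pd i (fun m' => H m' x y) a| ≤ ε := by
  have h1 : ∀ i, ∀ᶠ m in 𝓝 a, ∀ z ∈ V ×ˢ R,
      |pd i (fun m' => H m' z.1 z.2) m - pd i (fun m' => H m' z.1 z.2) a| ≤ ε := by
    intro i
    -- Compactness of `V ×ˢ R` turns joint continuity into continuity in `m` uniform over `(x, y)`.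
    obtain ⟨v, hv, hvε⟩ := (hV.prod hR).mem_uniformity_of_prod
      (f := fun m (z : X × Y) => pd i (fun m' => H m' z.1 z.2) m) (s := B') (hcm i) ha
      (Metric.dist_mem_uniformity hε)
    rw [hB'.nhdsWithin_eq ha] at hv
    filter_upwards [hv] with m hm z hz
    have := hvε m hm z hz
    exact le_of_lt this
  have h2 : ∀ᶠ m in 𝓝 a, m ∈ B' ∧ ∀ i, ∀ z ∈ V ×ˢ R,
      |pd i (fun m' => H m' z.1 z.2) m - pd i (fun m' => H m' z.1 z.2) a| ≤ ε :=
    Filter.Eventually.and (hB'.mem_nhds ha) (eventually_all.2 h1)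
  obtain ⟨δ, hδ, hball⟩ := Metric.eventually_nhds_iff_ball.1 h2
  exact ⟨δ, hδ, fun m hm => (hball m hm).1, fun i m hm x hx y hy => (hball m hm).2 i (x, y) ⟨hx, hy⟩⟩

/-- Continuity of the kernel in `(x, y)` propagates along a coordinate segment. -/
lemma continuousOn_coord_step (hV : IsCompact V) (hR : IsCompact R)
    (hdm : ∀ i, ∀ m ∈ B', ∀ x ∈ V, ∀ y ∈ R,
      LineDifferentiableAt ℝ (fun m' => H m' x y) m (stdVec i))
    (hcm : ∀ i, ContinuousOn
      (fun z : Eu p × X × Y => pd i (fun m' => H m' z.2.1 z.2.2) z.1) (B' ×ˢ V ×ˢ R))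
    {c : Eu p} {i : Fin p} {τ : ℝ} (hseg : ∀ s ∈ uIcc 0 τ, c + s • stdVec i ∈ B')
    (hc : ContinuousOn (fun z : X × Y => H c z.1 z.2) (V ×ˢ R)) :
    ContinuousOn (fun z : X × Y => H (c + τ • stdVec i) z.1 z.2) (V ×ˢ R) := by
  set G : X × Y → ℝ → ℝ := fun z s => pd i (fun m' => H m' z.1 z.2) (c + s • stdVec i) with hG
  have hGc : ContinuousOn (fun w : (X × Y) × ℝ => G w.1 w.2) ((V ×ˢ R) ×ˢ uIcc 0 τ) :=
    (hcm i).comp (f := fun w : (X × Y) × ℝ => (c + w.2 • stdVec i, w.1.1, w.1.2))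
      (by fun_prop) (fun w hw => ⟨hseg _ hw.2, hw.1.1, hw.1.2⟩)
  have hGs : ∀ z ∈ V ×ˢ R, ContinuousOn (G z) (uIcc 0 τ) := fun z hz =>
    hGc.comp (f := fun s => (z, s)) (by fun_prop) (fun s hs => ⟨hz, hs⟩)
  -- The new kernel is the old one plus an integral of the jointly continuous partial derivative,
  -- hence again continuous.
  have hFTC : ∀ z ∈ V ×ˢ R, H (c + τ • stdVec i) z.1 z.2 = H c z.1 z.2 + ∫ s in 0..τ, G z s := by
    intro z hz
    have := intervalIntegral.integral_eq_sub_of_hasDerivAt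
      (f := fun s : ℝ => H (c + s • stdVec i) z.1 z.2) (f' := G z) (a := 0) (b := τ)
      (fun s hs => hasDerivAt_coord_line (f := fun m' => H m' z.1 z.2)
        (hdm i _ (hseg s hs) _ hz.1 _ hz.2))
      (hGs z hz).intervalIntegrable
    rw [this]
    simp
  refine ContinuousOn.congr ?_ hFTC
  refine hc.add fun z₀ hz₀ => ?_
  obtain ⟨M, hM⟩ := ((hV.prod hR).prod isCompact_uIcc).exists_bound_of_continuousOn hGc
  refine intervalIntegral.continuousWithinAt_of_dominated_interval (bound := fun _ => M)
    ?_ ?_ intervalIntegrable_const ?_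
  · filter_upwards [self_mem_nhdsWithin] with z hz
    exact ((hGs z hz).mono uIoc_subset_uIcc).aestronglyMeasurable measurableSet_uIoc
  · filter_upwards [self_mem_nhdsWithin] with z hz
    exact Eventually.of_forall fun s hs => hM (z, s) ⟨hz, uIoc_subset_uIcc hs⟩
  · refine Eventually.of_forall fun s hs => ?_
    exact (hGc.comp (f := fun z => (z, s)) (by fun_prop)
      (fun z hz => ⟨hz, uIoc_subset_uIcc hs⟩)) z₀ hz₀

/-- Continuity in `(x, y)` is assumed only for parameters in `B`, while differentiation needs all
nearby parameters. It is propagated along a coordinate path, which stays in the ball. -/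
lemma continuousOn_kernel_of_mem_ball (hV : IsCompact V) (hR : IsCompact R)
    (hdm : ∀ i, ∀ m ∈ B', ∀ x ∈ V, ∀ y ∈ R,
      LineDifferentiableAt ℝ (fun m' => H m' x y) m (stdVec i))
    (hcm : ∀ i, ContinuousOn
      (fun z : Eu p × X × Y => pd i (fun m' => H m' z.2.1 z.2.2) z.1) (B' ×ˢ V ×ˢ R))
    {a : Eu p} {δ : ℝ} (hball : Metric.ball a δ ⊆ B')
    (ha : ContinuousOn (fun z : X × Y => H a z.1 z.2) (V ×ˢ R)) {m : Eu p}
    (hm : m ∈ Metric.ball a δ) :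
    ContinuousOn (fun z : X × Y => H m z.1 z.2) (V ×ˢ R) := by
  obtain ⟨c, hc0, hcp, hc⟩ := exists_coord_path a m
  have : ∀ n : ℕ, n ≤ p → ContinuousOn (fun z : X × Y => H (c n) z.1 z.2) (V ×ˢ R) := by
    intro n
    induction n with
    | zero => intro _; rwa [hc0]
    | succ n ih =>
      intro hn
      obtain ⟨h1, h2⟩ := hc ⟨n, hn⟩
      simp only at h1 h2
      rw [h1]
      refine continuousOn_coord_step hV hR hdm hcm (fun s hs => hball ?_) (ih (by omega))
      rw [mem_ball_iff_norm] at hm ⊢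
      exact (h2 s hs).trans_lt hm
  rw [← hcp]
  exact this p le_rfl

end Parameter

/-! ### Differentiability of the operator family -/

section KernelFamily

set_option linter.unusedSectionVars false

open Filter

variable {p : ℕ} {X Y : Type*} [MetricSpace X] [MeasurableSpace X] [BorelSpace X]
  [SecondCountableTopology X] [MetricSpace Y] [MeasurableSpace Y] [BorelSpace Y]
  [SecondCountableTopology Y] {μ : Measure Y} {ν : Measure X} {R : Set Y} {V : Set X}

/-- `T` is the integral operator with kernel `κ`. -/
def IsKernelOp (T : Lp ℝ 2 (μ.restrict R) →L[ℝ] Lp ℝ 2 (ν.restrict V)) (κ : X → Y → ℝ) : Prop :=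
  ∀ g, T g =ᵐ[ν.restrict V] fun x => ∫ y, κ x y * g y ∂(μ.restrict R)

open Classical in
/-- The integral operator with kernel `κ`, or zero if there is none. -/
noncomputable def kernelOp (μ : Measure Y) (ν : Measure X) (R : Set Y) (V : Set X)
    (κ : X → Y → ℝ) : Lp ℝ 2 (μ.restrict R) →L[ℝ] Lp ℝ 2 (ν.restrict V) :=
  if h : ∃ T : Lp ℝ 2 (μ.restrict R) →L[ℝ] Lp ℝ 2 (ν.restrict V), IsKernelOp T κ
  then h.choose else 0

lemma IsKernelOp.unique {T S : Lp ℝ 2 (μ.restrict R) →L[ℝ] Lp ℝ 2 (ν.restrict V)} {κ : X → Y → ℝ}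
    (hT : IsKernelOp T κ) (hS : IsKernelOp S κ) : T = S := by
  ext1 g
  exact Lp.ext ((hT g).trans (hS g).symm)

variable [IsFiniteMeasure (μ.restrict R)] [IsFiniteMeasure (ν.restrict V)]

lemma isKernelOp_kernelOp (hV : IsCompact V) (hR : IsCompact R) {κ : X → Y → ℝ}
    (hκ : ContinuousOn (fun z : X × Y => κ z.1 z.2) (V ×ˢ R)) :
    IsKernelOp (kernelOp μ ν R V κ) κ := by
  obtain ⟨T, hT, -⟩ := exists_kernelOp (μ := μ) (ν := ν) hV hR hκ
  have h : ∃ T : Lp ℝ 2 (μ.restrict R) →L[ℝ] Lp ℝ 2 (ν.restrict V), IsKernelOp T κ := ⟨T, hT⟩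
  rw [kernelOp, dif_pos h]
  exact h.choose_spec

lemma isCompactOperator_kernelOp (hV : IsCompact V) (hR : IsCompact R) {κ : X → Y → ℝ}
    (hκ : ContinuousOn (fun z : X × Y => κ z.1 z.2) (V ×ˢ R)) :
    IsCompactOperator (kernelOp μ ν R V κ) := by
  obtain ⟨T, hT, -, hc⟩ := exists_kernelOp (μ := μ) (ν := ν) hV hR hκ
  rwa [(isKernelOp_kernelOp hV hR hκ).unique hT]

/-- The constant depends only on the masses of `R` and `V`, so the bound can be applied to a Taylor
remainder kernel that varies with the parameters. -/
lemma exists_norm_kernelOp_le (μ : Measure Y) (ν : Measure X) [IsFiniteMeasure (μ.restrict R)]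
    [IsFiniteMeasure (ν.restrict V)] (hV : IsCompact V) (hR : IsCompact R) :
    ∃ C, 0 ≤ C ∧ ∀ (T : Lp ℝ 2 (μ.restrict R) →L[ℝ] Lp ℝ 2 (ν.restrict V)) (κ : X → Y → ℝ) (M : ℝ),
      ContinuousOn (fun z : X × Y => κ z.1 z.2) (V ×ˢ R) → IsKernelOp T κ → 0 ≤ M →
      (∀ x ∈ V, ∀ y ∈ R, |κ x y| ≤ M) → ‖T‖ ≤ C * M := by
  refine ⟨(measureUnivNNReal (ν.restrict V) : ℝ) ^ (2 : ENNReal).toReal⁻¹ *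
    (μ.restrict R univ ^ (1 / 2 : ℝ)).toReal, mul_nonneg (by positivity) ENNReal.toReal_nonneg,
    fun T κ M hκ hT hM0 hM => ?_⟩
  obtain ⟨S, hS, hb, -⟩ := exists_kernelOp (μ := μ) (ν := ν) hV hR hκ
  rw [hT.unique hS]
  exact hb M hM0 hM

variable {H : Eu p → X → Y → ℝ} {B' : Set (Eu p)}

/-- The derivative of a family of integral operators with respect to the parameter. -/
noncomputable def kernelOpDeriv (μ : Measure Y) (ν : Measure X) (R : Set Y) (V : Set X)
    (H : Eu p → X → Y → ℝ) (m : Eu p) :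
    Eu p →L[ℝ] Lp ℝ 2 (μ.restrict R) →L[ℝ] Lp ℝ 2 (ν.restrict V) :=
  ∑ i, (EuclideanSpace.proj i : Eu p →L[ℝ] ℝ).smulRight
    (kernelOp μ ν R V fun x y => pd i (fun m' => H m' x y) m)

lemma kernelOpDeriv_apply (m q : Eu p) : kernelOpDeriv μ ν R V H m q =
    ∑ i, q i • kernelOp μ ν R V fun x y => pd i (fun m' => H m' x y) m := by
  simp [kernelOpDeriv]

lemma continuousOn_pd_section {m : Eu p} (hm : m ∈ B')
    (hcm : ∀ i, ContinuousOn
      (fun z : Eu p × X × Y => pd i (fun m' => H m' z.2.1 z.2.2) z.1) (B' ×ˢ V ×ˢ R)) (i : Fin p) :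
    ContinuousOn (fun z : X × Y => pd i (fun m' => H m' z.1 z.2) m) (V ×ˢ R) :=
  (hcm i).comp (f := fun z : X × Y => (m, z.1, z.2)) (by fun_prop) (fun z hz => ⟨hm, hz.1, hz.2⟩)

lemma integral_sub_sub_partial (hV : IsCompact V) (hR : IsCompact R)
    (hcm : ∀ i, ContinuousOn
      (fun z : Eu p × X × Y => pd i (fun m' => H m' z.2.1 z.2.2) z.1) (B' ×ˢ V ×ˢ R))
    {a m₁ m₂ : Eu p} (ha : a ∈ B')
    (h₁ : ContinuousOn (fun z : X × Y => H m₁ z.1 z.2) (V ×ˢ R))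
    (h₂ : ContinuousOn (fun z : X × Y => H m₂ z.1 z.2) (V ×ˢ R)) {x : X} (hx : x ∈ V)
    (g : Lp ℝ 2 (μ.restrict R)) :
    ∫ y, (H m₁ x y - H m₂ x y - ∑ i, (m₁ - m₂) i * pd i (fun m' => H m' x y) a) * g y
        ∂(μ.restrict R) =
      (∫ y, H m₁ x y * g y ∂(μ.restrict R)) - (∫ y, H m₂ x y * g y ∂(μ.restrict R)) -
        ∑ i, (m₁ - m₂) i * ∫ y, pd i (fun m' => H m' x y) a * g y ∂(μ.restrict R) := by
  have i₁ := integrable_kernel_mul (μ := μ) hV hR h₁ hx g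
  have i₂ := integrable_kernel_mul (μ := μ) hV hR h₂ hx g
  have i₃ := fun i => integrable_kernel_mul (μ := μ)
    (κ := fun x y => pd i (fun m' => H m' x y) a) hV hR (continuousOn_pd_section ha hcm i) hx g
  simp_rw [← integral_const_mul]
  have i₁₂ : Integrable (fun y => H m₁ x y * g y - H m₂ x y * g y) (μ.restrict R) := i₁.sub i₂
  rw [← integral_finsetSum _ fun i _ => (i₃ i).const_mul _, ← integral_sub i₁ i₂,
    ← integral_sub i₁₂ (integrable_finsetSum _ fun i _ => (i₃ i).const_mul _)]
  refine integral_congr_ae (Eventually.of_forall fun y => ?_)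
  simp only [sub_mul, Finset.sum_mul, mul_assoc]

/-- The remainder operator is the integral operator of the remainder kernel, which is uniformly
small by `abs_sub_sub_partial_le`; a sup bound on a kernel controls the operator norm. -/
theorem hasStrictFDerivAt_kernelOp (hV : IsCompact V) (hR : IsCompact R) (hB' : IsOpen B')
    (hdm : ∀ i, ∀ m ∈ B', ∀ x ∈ V, ∀ y ∈ R,
      LineDifferentiableAt ℝ (fun m' => H m' x y) m (stdVec i))
    (hcm : ∀ i, ContinuousOn
      (fun z : Eu p × X × Y => pd i (fun m' => H m' z.2.1 z.2.2) z.1) (B' ×ˢ V ×ˢ R))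
    {a : Eu p} (ha : a ∈ B') (hac : ContinuousOn (fun z : X × Y => H a z.1 z.2) (V ×ˢ R)) :
    HasStrictFDerivAt (fun m => kernelOp μ ν R V (H m)) (kernelOpDeriv μ ν R V H a) a := by
  obtain ⟨C, hC0, hC⟩ := exists_norm_kernelOp_le μ ν hV hR
  refine HasStrictFDerivAt.of_isLittleO (Asymptotics.isLittleO_iff.2 fun ε hε => ?_)
  -- Chosen so that `C * p * ε' ≤ ε`; the added one avoids dividing by zero.
  set ε' := ε / (C * p + 1) with hε'
  have hε'0 : 0 < ε' := by positivity
  obtain ⟨δ, hδ, hball, hpd⟩ := exists_uniform_partial hV hR hB' hcm ha hε'0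
  have hnear : ∀ᶠ w : Eu p × Eu p in 𝓝 (a, a), ‖w.2 - a‖ + ‖w.1 - w.2‖ < δ ∧
      w.1 ∈ Metric.ball a δ ∧ w.2 ∈ Metric.ball a δ := by
    refine Filter.Eventually.and ?_ (Filter.Eventually.and ?_ ?_)
    · refine (Continuous.tendsto (by fun_prop) _).eventually_lt_const ?_
      simpa using hδ
    · exact continuous_fst.continuousAt.eventually (Metric.ball_mem_nhds a hδ)
    · exact continuous_snd.continuousAt.eventually (Metric.ball_mem_nhds a hδ)
  filter_upwards [hnear] with w ⟨hw, hw1, hw2⟩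
  have hc1 := continuousOn_kernel_of_mem_ball hV hR hdm hcm hball hac hw1
  have hc2 := continuousOn_kernel_of_mem_ball hV hR hdm hcm hball hac hw2
  have hcpd := continuousOn_pd_section ha hcm
  have hle := hC (kernelOp μ ν R V (H w.1) - kernelOp μ ν R V (H w.2) -
      kernelOpDeriv μ ν R V H a (w.1 - w.2))
    (fun x y => H w.1 x y - H w.2 x y - ∑ i, (w.1 - w.2) i * pd i (fun m' => H m' x y) a)
    (p * ε' * ‖w.1 - w.2‖) ?_ ?_ (by positivity) ?_
  · refine hle.trans ?_
    rw [← mul_assoc]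
    gcongr
    rw [hε', ← mul_assoc, mul_div_assoc', div_le_iff₀ (by positivity)]
    nlinarith
  · exact (hc1.sub hc2).sub (continuousOn_finsetSum _ fun i _ => continuousOn_const.mul (hcpd i))
  · intro g
    have hs : kernelOpDeriv μ ν R V H a (w.1 - w.2) g =
        ∑ i, (w.1 - w.2) i • kernelOp μ ν R V (fun x y => pd i (fun m' => H m' x y) a) g := by
      rw [kernelOpDeriv_apply]
      simp
    simp only [_root_.sub_apply]
    rw [hs]
    have hsum : ∀ᵐ x ∂(ν.restrict V), (∑ i, (w.1 - w.2) i • kernelOp μ ν R V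
        (fun x y => pd i (fun m' => H m' x y) a) g : Lp ℝ 2 (ν.restrict V)) x =
        ∑ i, (w.1 - w.2) i * ∫ y, pd i (fun m' => H m' x y) a * g y ∂(μ.restrict R) := by
      have h1 : ∀ᵐ x ∂(ν.restrict V), ∀ i, ((w.1 - w.2) i • kernelOp μ ν R V
          (fun x y => pd i (fun m' => H m' x y) a) g : Lp ℝ 2 (ν.restrict V)) x =
          (w.1 - w.2) i * ∫ y, pd i (fun m' => H m' x y) a * g y ∂(μ.restrict R) := by
        refine ae_all_iff.2 fun i => ?_
        filter_upwards [Lp.coeFn_smul ((w.1 - w.2) i) (kernelOp μ ν R V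
          (fun x y => pd i (fun m' => H m' x y) a) g),
          isKernelOp_kernelOp (μ := μ) (ν := ν)
            (κ := fun x y => pd i (fun m' => H m' x y) a) hV hR (hcpd i) g] with x h1 h2
        rw [h1, Pi.smul_apply, h2, smul_eq_mul]
      filter_upwards [h1, Lp.coeFn_fun_finsetSum Finset.univ (fun i => (w.1 - w.2) i •
        kernelOp μ ν R V (fun x y => pd i (fun m' => H m' x y) a) g)] with x h1 h2
      rw [h2]
      exact Finset.sum_congr rfl fun i _ => h1 i
    filter_upwards [Lp.coeFn_sub (kernelOp μ ν R V (H w.1) g - kernelOp μ ν R V (H w.2) g)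
        (∑ i, (w.1 - w.2) i • kernelOp μ ν R V (fun x y => pd i (fun m' => H m' x y) a) g),
      Lp.coeFn_sub (kernelOp μ ν R V (H w.1) g) (kernelOp μ ν R V (H w.2) g), hsum,
      isKernelOp_kernelOp (μ := μ) (ν := ν) hV hR hc1 g,
      isKernelOp_kernelOp (μ := μ) (ν := ν) hV hR hc2 g,
      ae_restrict_mem hV.measurableSet] with x e1 e2 e3 e4 e5 hx
    rw [e1, Pi.sub_apply, e2, Pi.sub_apply, e3, e4, e5,
      integral_sub_sub_partial hV hR hcm ha hc1 hc2 hx g]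
  · intro x hx y hy
    exact abs_sub_sub_partial_le (f := fun m => H m x y)
      (fun i m hm => hdm i m (hball hm) x hx y hy) (fun i m hm => hpd i m hm x hx y hy) hw

/-- `opDA` differentiates pointwise in `x`, whereas the operator derivative lives in `L²`. The same
remainder estimate at one fixed `x` shows that the two agree. -/
theorem lineDeriv_kernel_integral (hV : IsCompact V) (hR : IsCompact R) (hB' : IsOpen B')
    (hdm : ∀ i, ∀ m ∈ B', ∀ x ∈ V, ∀ y ∈ R,
      LineDifferentiableAt ℝ (fun m' => H m' x y) m (stdVec i))
    (hcm : ∀ i, ContinuousOn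
      (fun z : Eu p × X × Y => pd i (fun m' => H m' z.2.1 z.2.2) z.1) (B' ×ˢ V ×ˢ R))
    {a : Eu p} (ha : a ∈ B') (hac : ContinuousOn (fun z : X × Y => H a z.1 z.2) (V ×ˢ R))
    {x : X} (hx : x ∈ V) (q : Eu p) (g : Lp ℝ 2 (μ.restrict R)) :
    lineDeriv ℝ (fun m => ∫ y, H m x y * g y ∂(μ.restrict R)) a q =
      ∑ i, q i * ∫ y, pd i (fun m' => H m' x y) a * g y ∂(μ.restrict R) := by
  set L : Eu p →L[ℝ] ℝ := ∑ i, (EuclideanSpace.proj i : Eu p →L[ℝ] ℝ).smulRight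
    (∫ y, pd i (fun m' => H m' x y) a * g y ∂(μ.restrict R)) with hL
  have hLa : ∀ q, L q = ∑ i, q i * ∫ y, pd i (fun m' => H m' x y) a * g y ∂(μ.restrict R) := by
    intro q
    simp [hL]
  have hd : HasFDerivAt (fun m => ∫ y, H m x y * g y ∂(μ.restrict R)) L a := by
    refine HasFDerivAt.of_isLittleO (Asymptotics.isLittleO_iff.2 fun ε hε => ?_)
    set c := (μ.restrict R univ ^ (1 / 2 : ℝ)).toReal * ‖g‖ with hc
    have hc0 : 0 ≤ c := mul_nonneg ENNReal.toReal_nonneg (norm_nonneg _)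
    set ε' := ε / (c * p + 1) with hε'
    have hε'0 : 0 < ε' := by positivity
    obtain ⟨δ, hδ, hball, hpd⟩ := exists_uniform_partial hV hR hB' hcm ha hε'0
    filter_upwards [Metric.ball_mem_nhds a hδ] with m hm
    have hcm1 := continuousOn_kernel_of_mem_ball hV hR hdm hcm hball hac hm
    rw [hLa, ← integral_sub_sub_partial hV hR hcm ha hcm1 hac hx g]
    have hb : ∀ y ∈ R, |H m x y - H a x y - ∑ i, (m - a) i * pd i (fun m' => H m' x y) a| ≤
        p * ε' * ‖m - a‖ := by
      intro y hy
      exact abs_sub_sub_partial_le (f := fun m => H m x y)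
        (fun i m hm => hdm i m (hball hm) x hx y hy) (fun i m hm => hpd i m hm x hx y hy)
        (by simpa using mem_ball_iff_norm.1 hm)
    have := abs_kernel_integral_le (V := {x}) (κ := fun x y => H m x y - H a x y -
      ∑ i, (m - a) i * pd i (fun m' => H m' x y) a) (μ := μ) (M := p * ε' * ‖m - a‖) hR
      (by positivity)
      (by rintro x' rfl y hy; exact hb y hy) (mem_singleton x) g
    refine this.trans ?_
    rw [← hc, mul_right_comm]
    gcongr
    rw [hε', mul_div_assoc', div_mul_eq_mul_div, div_le_iff₀ (by positivity)]
    nlinarith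
  rw [← hLa]
  exact hd.hasLineDerivAt q |>.lineDeriv

end KernelFamily

/-! ### Bi-Lipschitz parametrizations and surface measure -/

section Charts

open Metric
open scoped ENNReal NNReal

variable {d k : ℕ}

/-- The inclusion of `ℝᵏ` in `ℝᵈ` by padding with zeros. -/
noncomputable def pad (k d : ℕ) : Eu k →L[ℝ] Eu d :=
  LinearMap.toContinuousLinearMap
    { toFun := fun z => WithLp.toLp 2 fun i : Fin d => if h : i.val < k then z ⟨i, h⟩ else 0
      map_add' := fun x y => by ext i; by_cases h : i.val < k <;> simp [h]
      map_smul' := fun c x => by ext i; by_cases h : i.val < k <;> simp [h] }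

lemma pad_apply (z : Eu k) (i : Fin d) :
    pad k d z i = if h : i.val < k then z ⟨i, h⟩ else 0 := rfl

attribute [irreducible] pad

lemma continuous_pad_apply (i : Fin d) : Continuous fun z => pad k d z i :=
  ((EuclideanSpace.proj i : Eu d →L[ℝ] ℝ) ∘L pad k d).continuous

lemma norm_pad (hk : k ≤ d) (z : Eu k) : ‖pad k d z‖ = ‖z‖ := by
  obtain ⟨e, rfl⟩ := Nat.exists_eq_add_of_le hk
  rw [EuclideanSpace.norm_eq, EuclideanSpace.norm_eq, Fin.sum_univ_add]
  simp [pad_apply]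

lemma isometry_pad (hk : k ≤ d) : Isometry (pad k d) :=
  AddMonoidHomClass.isometry_of_norm _ (norm_pad hk)

lemma exists_pad_eq (hk : k ≤ d) {w : Eu d} (hw : ∀ i, k ≤ i.val → w i = 0) :
    ∃ z : Eu k, pad k d z = w := by
  refine ⟨WithLp.toLp 2 fun j => w (Fin.castLE hk j), ?_⟩
  ext i
  rw [pad_apply]
  split_ifs with h
  · rfl
  · exact (hw i (not_lt.1 h)).symm

lemma pad_mem_modelSet_iff {J : Set (Fin d)} {z : Eu k} :
    pad k d z ∈ modelSet k J ↔ ∀ i ∈ J, 0 ≤ pad k d z i := by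
  refine ⟨fun h => h.2, fun h => ⟨fun i hi => ?_, h⟩⟩
  rw [pad_apply, dif_neg (not_lt.2 hi)]

/-- The part of a ball of `ℝᵏ` lying in the model with faces `J`. -/
def modelBall (k : ℕ) {d : ℕ} (J : Set (Fin d)) (z₀ : Eu k) (r : ℝ) : Set (Eu k) :=
  {z | z ∈ ball z₀ r ∧ ∀ i ∈ J, 0 ≤ pad k d z i}

lemma modelBall_subset {J : Set (Fin d)} {z₀ : Eu k} {r : ℝ} : modelBall k J z₀ r ⊆ ball z₀ r :=
  fun _ hz => hz.1

lemma modelBall_eq {J : Set (Fin d)} {z₀ : Eu k} {r : ℝ} :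
    modelBall k J z₀ r = ball z₀ r ∩ ⋂ i ∈ J, {z | 0 ≤ pad k d z i} := by
  ext z; simp [modelBall]

lemma convex_modelBall {J : Set (Fin d)} {z₀ : Eu k} {r : ℝ} : Convex ℝ (modelBall k J z₀ r) := by
  rw [modelBall_eq]
  refine (convex_ball _ _).inter (convex_iInter₂ fun i _ => ?_)
  exact convex_halfSpace_ge (f := fun z => pad k d z i)
    (((EuclideanSpace.proj i : Eu d →L[ℝ] ℝ) ∘L pad k d).toLinearMap.isLinear) 0

lemma measurableSet_modelBall {J : Set (Fin d)} {z₀ : Eu k} {r : ℝ} :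
    MeasurableSet (modelBall k J z₀ r) := by
  rw [modelBall_eq]
  refine isOpen_ball.measurableSet.inter (IsClosed.measurableSet ?_)
  exact isClosed_biInter fun i _ => isClosed_le continuous_const (continuous_pad_apply i)

/-- Moving `z₀` slightly along `(1, …, 1)` makes all face coordinates strictly positive. -/
lemma interior_modelBall_nonempty {J : Set (Fin d)} (hJ : ∀ i ∈ J, i.val < k) {z₀ : Eu k} {r : ℝ}
    (hr : 0 < r) (hz₀ : ∀ i ∈ J, 0 ≤ pad k d z₀ i) : (interior (modelBall k J z₀ r)).Nonempty := by
  let e : Eu k := WithLp.toLp 2 fun _ => 1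
  have hopen : IsOpen (ball z₀ r ∩ ⋂ i ∈ J, {z : Eu k | 0 < pad k d z i}) := by
    refine isOpen_ball.inter ?_
    exact (Set.toFinite J).isOpen_biInter fun i _ => isOpen_lt continuous_const (continuous_pad_apply i)
  have hcont : Filter.Tendsto (fun t : ℝ => z₀ + t • e) (𝓝[>] 0) (𝓝 z₀) := by
    have : Filter.Tendsto (fun t : ℝ => z₀ + t • e) (𝓝 0) (𝓝 (z₀ + (0 : ℝ) • e)) :=
      Continuous.tendsto (by fun_prop) _
    rw [zero_smul, add_zero] at this
    exact this.mono_left nhdsWithin_le_nhds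
  obtain ⟨t, ht1, ht2⟩ := ((hcont.eventually (ball_mem_nhds z₀ hr)).and
    (self_mem_nhdsWithin : Ioi (0 : ℝ) ∈ 𝓝[>] (0 : ℝ))).exists
  refine ⟨z₀ + t • e, interior_maximal ?_ hopen ⟨ht1, ?_⟩⟩
  · rw [modelBall_eq]
    exact inter_subset_inter_right _ (iInter₂_mono fun i _ z (hz : 0 < pad k d z i) => hz.le)
  · simp only [mem_iInter, mem_ofPred_eq]
    intro i hi
    have h1 := hz₀ i hi
    rw [pad_apply, dif_pos (hJ i hi)] at h1 ⊢
    have : (0 : ℝ) < t := ht2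
    simp only [PiLp.add_apply, PiLp.smul_apply, smul_eq_mul, e, mul_one]
    linarith

/-- `ψ` is a bi-Lipschitz `C¹` parametrization, over the ball of radius `r` around `z₀`, which maps
the model with faces `J` onto the part of `M` in the open set `O`. -/
structure IsParam (k : ℕ) (M : Set (Eu d)) (Φ : OpenPartialHomeomorph (Eu d) (Eu d))
    (J : Set (Fin d)) (z₀ : Eu k) (r : ℝ) (C : ℝ≥0) (O : Set (Eu d)) : Prop where
  pos : 0 < r
  faces : ∀ i ∈ J, i.val < k
  base : ∀ i ∈ J, 0 ≤ pad k d z₀ i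
  mem_target : ∀ z ∈ ball z₀ r, pad k d z ∈ Φ.target
  contDiffAt : ∀ z ∈ ball z₀ r, ContDiffAt ℝ 1 (fun z => Φ.symm (pad k d z)) z
  lipschitz : LipschitzOnWith C (fun z => Φ.symm (pad k d z)) (ball z₀ r)
  antilipschitz : ∀ z ∈ ball z₀ r, ∀ z' ∈ ball z₀ r,
    edist z z' ≤ C * edist (Φ.symm (pad k d z)) (Φ.symm (pad k d z'))
  isOpen : IsOpen O
  image_eq : (fun z => Φ.symm (pad k d z)) '' modelBall k J z₀ r = M ∩ O

/-- `C¹` maps are locally Lipschitz; this is applied to `Φ` at `y` and to its inverse at `Φ y`, and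
the radius is shrunk to fit both. As `pad` is isometric, a ball around `Φ y` in `ℝᵈ` cuts out
exactly the ball around `z₀` in `ℝᵏ`. -/
lemma IsAdaptedChart.exists_isParam (hk : k ≤ d) {M : Set (Eu d)}
    {Φ : OpenPartialHomeomorph (Eu d) (Eu d)} {J : Set (Fin d)} (h : IsAdaptedChart k M Φ J)
    {y : Eu d} (hy : y ∈ M) (hys : y ∈ Φ.source) :
    ∃ (z₀ : Eu k) (r : ℝ) (C : ℝ≥0) (O : Set (Eu d)), pad k d z₀ = Φ y ∧ y ∈ O ∧
      IsParam k M Φ J z₀ r C O := by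
  have hΦy : Φ y ∈ modelSet k J := (h.straightens hys).2 hy
  obtain ⟨z₀, hz₀⟩ := exists_pad_eq hk hΦy.1
  have hyt : Φ y ∈ Φ.target := Φ.map_source hys
  have hcd : ContDiffAt ℝ 1 Φ y := h.contDiffOn.contDiffAt (Φ.open_source.mem_nhds hys)
  have hcds : ContDiffAt ℝ 1 Φ.symm (Φ y) :=
    h.contDiffOn_symm.contDiffAt (Φ.open_target.mem_nhds hyt)
  obtain ⟨K₁, s₁, hs₁, hL₁⟩ := hcd.exists_lipschitzOnWith
  obtain ⟨K₂, s₂, hs₂, hL₂⟩ := hcds.exists_lipschitzOnWith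
  have hpre : Φ.symm ⁻¹' s₁ ∈ 𝓝 (Φ y) := Φ.tendsto_symm hys hs₁
  obtain ⟨r, hr, hball⟩ := Metric.mem_nhds_iff.1
    (Filter.inter_mem (Filter.inter_mem (Φ.open_target.mem_nhds hyt) hs₂) hpre)
  have hmap : ∀ z ∈ ball z₀ r, pad k d z ∈ ball (Φ y) r := fun z hz => by
    rw [← hz₀, mem_ball, (isometry_pad hk).dist_eq]; exact hz
  have hyb : Φ y ∈ ball (Φ y) r := mem_ball_self hr
  have hyO : y ∈ Φ.source ∩ Φ ⁻¹' ball (Φ y) r := ⟨hys, hyb⟩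
  suffices hp : IsParam k M Φ J z₀ r (max K₁ K₂) (Φ.source ∩ Φ ⁻¹' ball (Φ y) r) from
    ⟨z₀, r, max K₁ K₂, Φ.source ∩ Φ ⁻¹' ball (Φ y) r, hz₀, hyO, hp⟩
  constructor
  · exact hr
  · exact h.faces
  · intro i hi; rw [hz₀]; exact hΦy.2 i hi
  · exact fun z hz => (hball (hmap z hz)).1.1
  · intro z hz
    exact (h.contDiffOn_symm.contDiffAt (Φ.open_target.mem_nhds (hball (hmap z hz)).1.1)).comp z
      (pad k d).contDiff.contDiffAt
  · intro z hz z' hz'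
    refine (hL₂ (hball (hmap z hz)).1.2 (hball (hmap z' hz')).1.2).trans ?_
    rw [(isometry_pad hk).edist_eq]
    gcongr
    exact le_max_right _ _
  · intro z hz z' hz'
    have := hL₁ (hball (hmap z hz)).2 (hball (hmap z' hz')).2
    rw [Φ.right_inv (hball (hmap z hz)).1.1, Φ.right_inv (hball (hmap z' hz')).1.1,
      (isometry_pad hk).edist_eq] at this
    refine this.trans ?_
    gcongr
    exact le_max_left _ _
  · exact Φ.isOpen_inter_preimage isOpen_ball
  · ext x
    constructor
    · rintro ⟨z, hz, rfl⟩
      have ht := (hball (hmap z hz.1)).1.1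
      have hsrc := Φ.map_target ht
      have hM' : Φ.symm (pad k d z) ∈ M :=
        (h.straightens hsrc).1 (by rw [Φ.right_inv ht]; exact pad_mem_modelSet_iff.2 hz.2)
      have hb' : Φ (Φ.symm (pad k d z)) ∈ ball (Φ y) r := by
        rw [Φ.right_inv ht]; exact hmap z hz.1
      exact ⟨hM', hsrc, hb'⟩
    · rintro ⟨hxM, hxs, hxb⟩
      have hm : Φ x ∈ modelSet k J := (h.straightens hxs).2 hxM
      obtain ⟨z, hz⟩ := exists_pad_eq hk hm.1
      refine ⟨z, ⟨?_, ?_⟩, ?_⟩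
      · rw [mem_ball, ← (isometry_pad hk).dist_eq, hz, hz₀]; exact hxb
      · rw [hz]; exact hm.2
      · simp only; rw [hz, Φ.left_inv hxs]

lemma euclideanHausdorffMeasure_image_le {X Y : Type*} [EMetricSpace X] [MeasurableSpace X]
    [BorelSpace X] [EMetricSpace Y] [MeasurableSpace Y] [BorelSpace Y] {C : ℝ≥0} {f : X → Y}
    {s : Set X} (h : LipschitzOnWith C f s) (k : ℕ) :
    Measure.euclideanHausdorffMeasure k (f '' s) ≤
      (C : ℝ≥0∞) ^ (k : ℝ) * Measure.euclideanHausdorffMeasure k s := by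
  simp only [Measure.euclideanHausdorffMeasure_def, Measure.smul_apply, ENNReal.smul_def,
    smul_eq_mul]
  rw [mul_left_comm]
  gcongr
  exact h.hausdorffMeasure_image_le (Nat.cast_nonneg k)

namespace IsParam

variable {M : Set (Eu d)} {Φ : OpenPartialHomeomorph (Eu d) (Eu d)} {J : Set (Fin d)} {z₀ : Eu k}
  {r : ℝ} {C : ℝ≥0} {O : Set (Eu d)}

lemma measure_image_le (h : IsParam k M Φ J z₀ r C O) {E : Set (Eu k)} (hE : E ⊆ ball z₀ r) :
    Measure.euclideanHausdorffMeasure k ((fun z => Φ.symm (pad k d z)) '' E) ≤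
      (C : ℝ≥0∞) ^ (k : ℝ) * volume E := by
  rw [← EuclideanSpace.euclideanHausdorffMeasure_eq_volume]
  exact euclideanHausdorffMeasure_image_le (h.lipschitz.mono hE) k

lemma injOn (h : IsParam k M Φ J z₀ r C O) :
    InjOn (fun z => Φ.symm (pad k d z)) (ball z₀ r) := by
  intro z hz z' hz' e
  have := h.antilipschitz z hz z' hz'
  simp only at e
  rw [e, edist_self, mul_zero] at this
  exact edist_le_zero.1 this

lemma le_measure_image (h : IsParam k M Φ J z₀ r C O) {E : Set (Eu k)} (hE : E ⊆ ball z₀ r) :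
    volume E ≤ (C : ℝ≥0∞) ^ (k : ℝ) *
      Measure.euclideanHausdorffMeasure k ((fun z => Φ.symm (pad k d z)) '' E) := by
  set ψ : Eu k → Eu d := fun z => Φ.symm (pad k d z)
  set g := Function.invFunOn ψ (ball z₀ r)
  have hg : ∀ z ∈ ball z₀ r, g (ψ z) = z := fun z hz => h.injOn.leftInvOn_invFunOn hz
  have hgL : LipschitzOnWith C g (ψ '' E) := by
    rintro _ ⟨z, hz, rfl⟩ _ ⟨z', hz', rfl⟩
    rw [hg z (hE hz), hg z' (hE hz')]
    exact h.antilipschitz z (hE hz) z' (hE hz')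
  have him : g '' (ψ '' E) = E := by
    rw [← image_comp]
    conv_rhs => rw [← image_id E]
    exact image_congr fun z hz => hg z (hE hz)
  have := euclideanHausdorffMeasure_image_le hgL k
  rwa [him, EuclideanSpace.euclideanHausdorffMeasure_eq_volume] at this

lemma aemeasurable (h : IsParam k M Φ J z₀ r C O) :
    AEMeasurable (fun z => Φ.symm (pad k d z)) (volume.restrict (modelBall k J z₀ r)) := by
  refine ContinuousOn.aemeasurable (fun z hz => ?_) measurableSet_modelBall
  exact (h.contDiffAt z hz.1).continuousAt.continuousWithinAt

/-- With `surf_restrict_le_map` this stands in for the area formula: the Poincaré inequality only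
needs the measures to be comparable. -/
lemma map_le_surf (h : IsParam k M Φ J z₀ r C O) :
    (volume.restrict (modelBall k J z₀ r)).map (fun z => Φ.symm (pad k d z)) ≤
      ((C : ℝ≥0∞) ^ (k : ℝ)) • surf k M := by
  refine Measure.le_iff.2 fun S hS => ?_
  rw [Measure.map_apply_of_aemeasurable h.aemeasurable hS,
    Measure.restrict_apply' measurableSet_modelBall, Measure.smul_apply, surf,
    Measure.restrict_apply hS, smul_eq_mul]
  refine (h.le_measure_image (inter_subset_right.trans modelBall_subset)).trans ?_
  gcongr
  rintro _ ⟨z, ⟨hz1, hz2⟩, rfl⟩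
  exact ⟨hz1, (h.image_eq ▸ mem_image_of_mem _ hz2 :
    Φ.symm (pad k d z) ∈ M ∩ O).1⟩

lemma surf_restrict_le_map (h : IsParam k M Φ J z₀ r C O) :
    (surf k M).restrict O ≤ ((C : ℝ≥0∞) ^ (k : ℝ)) •
      (volume.restrict (modelBall k J z₀ r)).map (fun z => Φ.symm (pad k d z)) := by
  refine Measure.le_iff.2 fun S hS => ?_
  rw [Measure.smul_apply, Measure.map_apply_of_aemeasurable h.aemeasurable hS,
    Measure.restrict_apply' measurableSet_modelBall, surf, Measure.restrict_apply hS,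
    Measure.restrict_apply (hS.inter h.isOpen.measurableSet), smul_eq_mul]
  refine le_trans (measure_mono ?_) (h.measure_image_le (inter_subset_right.trans modelBall_subset))
  rintro x ⟨⟨hxS, hxO⟩, hxM⟩
  obtain ⟨z, hz, rfl⟩ := h.image_eq.ge ⟨hxM, hxO⟩
  exact ⟨z, ⟨hxS, hz⟩, rfl⟩

lemma lintegral_le_surf (h : IsParam k M Φ J z₀ r C O) {g : Eu d → ℝ≥0∞}
    (hg : AEMeasurable g (surf k M)) :
    ∫⁻ z in modelBall k J z₀ r, g (Φ.symm (pad k d z)) ≤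
      (C : ℝ≥0∞) ^ (k : ℝ) * ∫⁻ y, g y ∂(surf k M) := by
  have hac : (volume.restrict (modelBall k J z₀ r)).map (fun z => Φ.symm (pad k d z)) ≪ surf k M :=
    (Measure.absolutelyContinuous_of_le h.map_le_surf).trans
      (Measure.AbsolutelyContinuous.smul_left Measure.AbsolutelyContinuous.rfl _)
  rw [← lintegral_map' (hg.mono_ac hac) h.aemeasurable, ← smul_eq_mul, ← lintegral_smul_measure]
  exact lintegral_mono' h.map_le_surf le_rfl

lemma surf_lintegral_le (h : IsParam k M Φ J z₀ r C O) {g : Eu d → ℝ≥0∞} (hg : Measurable g) :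
    ∫⁻ y in O, g y ∂(surf k M) ≤
      (C : ℝ≥0∞) ^ (k : ℝ) * ∫⁻ z in modelBall k J z₀ r, g (Φ.symm (pad k d z)) := by
  rw [← lintegral_map' hg.aemeasurable h.aemeasurable, ← smul_eq_mul, ← lintegral_smul_measure]
  exact lintegral_mono' h.surf_restrict_le_map le_rfl

lemma const_ne_top (C : ℝ≥0) (k : ℕ) : (C : ℝ≥0∞) ^ (k : ℝ) ≠ ⊤ :=
  ENNReal.rpow_ne_top_of_nonneg (Nat.cast_nonneg k) ENNReal.coe_ne_top

lemma surf_lt_top (h : IsParam k M Φ J z₀ r C O) : surf k M O < ⊤ := by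
  have := h.surf_lintegral_le (g := fun _ => 1) measurable_const
  simp only [lintegral_const, one_mul, Measure.restrict_apply MeasurableSet.univ, univ_inter] at this
  refine this.trans_lt (ENNReal.mul_lt_top (const_ne_top C k).lt_top ?_)
  exact (measure_mono modelBall_subset).trans_lt measure_ball_lt_top

end IsParam

lemma IsCompactSubmanifold.exists_isParam {M : Set (Eu d)} (hM : IsCompactSubmanifold k M) {y : Eu d}
    (hy : y ∈ M) : ∃ (Φ : OpenPartialHomeomorph (Eu d) (Eu d)) (J : Set (Fin d)) (z₀ : Eu k) (r : ℝ)
      (C : ℝ≥0) (O : Set (Eu d)), y ∈ O ∧ IsParam k M Φ J z₀ r C O := by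
  obtain ⟨Φ, J, h, hys⟩ := hM.exists_chart y hy
  obtain ⟨z₀, r, C, O, -, hyO, hp⟩ := h.exists_isParam hM.dim_le hy hys
  exact ⟨Φ, J, z₀, r, C, O, hyO, hp⟩

lemma IsCompactSubmanifold.isFiniteMeasure_surf {M : Set (Eu d)} (hM : IsCompactSubmanifold k M) :
    IsFiniteMeasure (surf k M) := by
  have h1 : surf k M M < ⊤ := by
    refine hM.isCompact.measure_lt_top_of_nhdsWithin fun y hy => ?_
    obtain ⟨Φ, J, z₀, r, C, O, hyO, hp⟩ := hM.exists_isParam hy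
    exact ⟨O, mem_nhdsWithin_of_mem_nhds (hp.isOpen.mem_nhds hyO), hp.surf_lt_top⟩
  refine ⟨?_⟩
  rw [surf, Measure.restrict_apply_univ]
  rwa [surf, Measure.restrict_apply_self] at h1

/-- Nonempty relatively open subsets of a submanifold have positive measure. -/
lemma IsCompactSubmanifold.surf_pos {M : Set (Eu d)} (hM : IsCompactSubmanifold k M) {W : Set (Eu d)}
    (hW : IsOpen W) {y : Eu d} (hy : y ∈ M) (hyW : y ∈ W) : 0 < surf k M W := by
  obtain ⟨Φ, J, z₀, r, C, O, hyO, hp⟩ := hM.exists_isParam hy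
  obtain ⟨z, hz, hzy⟩ := hp.image_eq.ge ⟨hy, hyO⟩
  simp only at hzy
  have hcont : ContinuousAt (fun z => Φ.symm (pad k d z)) z := (hp.contDiffAt z hz.1).continuousAt
  have hpre : (fun z => Φ.symm (pad k d z)) ⁻¹' W ∈ 𝓝 z :=
    hcont.preimage_mem_nhds (hW.mem_nhds (by rwa [hzy]))
  -- The point may lie on a face, but in a convex set with nonempty interior every point is a limit
  -- of interior points.
  have hzc : z ∈ closure (interior (modelBall k J z₀ r)) := by
    rw [convex_modelBall.closure_interior_eq_closure_of_nonempty_interior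
      (interior_modelBall_nonempty hp.faces hp.pos hp.base)]
    exact subset_closure hz
  obtain ⟨U, hUW, hUo, hzU⟩ := _root_.mem_nhds_iff.1 hpre
  have hne : (U ∩ interior (modelBall k J z₀ r)).Nonempty := mem_closure_iff.1 hzc U hUo hzU
  have hpos : 0 < volume (U ∩ interior (modelBall k J z₀ r)) :=
    (hUo.inter isOpen_interior).measure_pos volume hne
  by_contra h0
  have hle := Measure.le_iff.1 hp.map_le_surf W hW.measurableSet
  rw [Measure.smul_apply, nonpos_iff_eq_zero.1 (not_lt.1 h0), smul_zero,
    Measure.map_apply_of_aemeasurable hp.aemeasurable hW.measurableSet,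
    Measure.restrict_apply' measurableSet_modelBall] at hle
  refine absurd (hpos.trans_le (measure_mono ?_)) (not_lt.2 hle)
  exact inter_subset_inter hUW interior_subset

end Charts

/-! ### A Poincaré inequality on convex sets -/

section ConvexPoincare

open Metric
open scoped ENNReal NNReal

lemma sq_lintegral_le {α : Type*} [MeasurableSpace α] (μ : Measure α) {f : α → ℝ≥0∞}
    (hf : AEMeasurable f μ) : (∫⁻ a, f a ∂μ) ^ 2 ≤ μ univ * ∫⁻ a, f a ^ 2 ∂μ := by
  have h := ENNReal.lintegral_mul_le_Lp_mul_Lq μ Real.HolderConjugate.two_two hf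
    (aemeasurable_const (b := (1 : ℝ≥0∞)))
  simp only [Pi.mul_apply, mul_one, ENNReal.one_rpow, lintegral_const, one_mul] at h
  have h2 := pow_le_pow_left₀ zero_le h 2
  rw [mul_pow] at h2
  simp only [← ENNReal.rpow_natCast, ← ENNReal.rpow_mul] at h2 ⊢
  norm_num at h2 ⊢
  rwa [mul_comm] at h2

variable {k : ℕ}

/-- The fundamental theorem of calculus along the segment, followed by Cauchy–Schwarz in `t`. -/
lemma enorm_sub_sq_le_of_segment {F : Eu k → ℝ} {K : Set (Eu k)} (hK : Convex ℝ K)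
    (hF : ∀ z ∈ K, ContDiffAt ℝ 1 F z) {x z : Eu k} (hx : x ∈ K) (hz : z ∈ K) :
    ‖F x - F z‖ₑ ^ 2 ≤ ‖x - z‖ₑ ^ 2 *
      ∫⁻ t in Icc (0 : ℝ) 1, ‖fderiv ℝ F (z + t • (x - z))‖ₑ ^ 2 := by
  have hseg : ∀ t ∈ Icc (0 : ℝ) 1, z + t • (x - z) ∈ K := fun t ht =>
    hK.add_smul_sub_mem hz hx ht
  have hcf : ContinuousOn (fun t : ℝ => fderiv ℝ F (z + t • (x - z))) (Icc 0 1) := by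
    intro t ht
    have h1 : ContinuousAt (fderiv ℝ F) (z + t • (x - z)) :=
      ((hF _ (hseg t ht)).fderiv_right (m := 0) (by norm_num)).continuousAt
    exact (ContinuousAt.comp (f := fun t : ℝ => z + t • (x - z)) h1
      (by fun_prop)).continuousWithinAt
  have hder : ∀ t ∈ uIcc (0 : ℝ) 1, HasDerivAt (fun t : ℝ => F (z + t • (x - z)))
      (fderiv ℝ F (z + t • (x - z)) (x - z)) t := by
    intro t ht
    rw [uIcc_of_le zero_le_one] at ht
    have h1 := ((hF _ (hseg t ht)).differentiableAt (by norm_num)).hasFDerivAt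
    have h2 : HasDerivAt (fun t : ℝ => z + t • (x - z)) (x - z) t := by
      simpa using ((hasDerivAt_id t).smul_const (x - z)).const_add z
    exact h1.comp_hasDerivAt t h2
  have hint := intervalIntegral.integral_eq_sub_of_hasDerivAt hder (by
    refine ContinuousOn.intervalIntegrable ?_
    rw [uIcc_of_le zero_le_one]
    exact hcf.clm_apply continuousOn_const)
  simp only [one_smul, zero_smul, add_zero, add_sub_cancel] at hint
  rw [intervalIntegral.integral_of_le zero_le_one, ← integral_Icc_eq_integral_Ioc] at hint
  rw [← hint]
  have hm : AEMeasurable (fun t : ℝ => ‖fderiv ℝ F (z + t • (x - z))‖ₑ)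
      (volume.restrict (Icc 0 1)) :=
    (hcf.enorm).aemeasurable measurableSet_Icc
  calc _ ≤ (∫⁻ t in Icc (0 : ℝ) 1, ‖fderiv ℝ F (z + t • (x - z)) (x - z)‖ₑ) ^ 2 :=
        pow_le_pow_left₀ zero_le (enorm_integral_le_lintegral_enorm _) 2
    _ ≤ (∫⁻ t in Icc (0 : ℝ) 1, ‖x - z‖ₑ * ‖fderiv ℝ F (z + t • (x - z))‖ₑ) ^ 2 := by
        gcongr with t
        rw [mul_comm]
        exact ContinuousLinearMap.le_opENorm _ _
    _ = ‖x - z‖ₑ ^ 2 * (∫⁻ t in Icc (0 : ℝ) 1, ‖fderiv ℝ F (z + t • (x - z))‖ₑ) ^ 2 := by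
        rw [lintegral_const_mul'' _ hm, mul_pow]
    _ ≤ _ := by
        gcongr
        refine (sq_lintegral_le _ hm).trans ?_
        simp

lemma lintegral_comp_add_smul_le {G : Eu k → ℝ≥0∞} (hG : Measurable G) (c : Eu k) {t : ℝ}
    (ht : 1 / 2 ≤ t) : ∫⁻ x, G (c + t • x) ≤ 2 ^ k * ∫⁻ x, G x := by
  have ht0 : 0 < t := by linarith
  have h1 : ∫⁻ x, G (c + t • x) = ∫⁻ y, G (c + y) ∂(Measure.map (fun x : Eu k => t • x) volume) := by
    rw [lintegral_map (by fun_prop) (by fun_prop)]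
  rw [h1, Measure.map_addHaar_smul _ ht0.ne', lintegral_smul_measure,
    lintegral_add_left_eq_self (fun y => G y) c, smul_eq_mul, finrank_euclideanSpace_fin]
  gcongr
  rw [abs_of_nonneg (by positivity)]
  have : (t ^ k)⁻¹ ≤ 2 ^ k := by
    rw [← inv_pow]
    gcongr
    rw [inv_le_comm₀ ht0 two_pos]
    linarith
  calc ENNReal.ofReal (t ^ k)⁻¹ ≤ ENNReal.ofReal (2 ^ k) := ENNReal.ofReal_le_ofReal this
    _ = 2 ^ k := by rw [ENNReal.ofReal_pow (by norm_num)]; norm_num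

/-- A Poincaré inequality for pairs of points of a bounded convex set. -/
theorem lintegral_enorm_sub_sq_le {F : Eu k → ℝ} {K : Set (Eu k)} (hK : Convex ℝ K)
    (hKm : MeasurableSet K) {z₀ : Eu k} {r : ℝ} (hKr : K ⊆ ball z₀ r)
    (hF : ∀ z ∈ K, ContDiffAt ℝ 1 F z) :
    ∫⁻ x in K, ∫⁻ z in K, ‖F x - F z‖ₑ ^ 2 ≤
      ENNReal.ofReal (2 * r) ^ 2 * (volume K * (2 ^ k * ∫⁻ w in K, ‖fderiv ℝ F w‖ₑ ^ 2)) := by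
  set G : Eu k → ℝ≥0∞ := K.indicator fun w => ‖fderiv ℝ F w‖ₑ ^ 2 with hG
  have hGm : Measurable G := ((measurable_fderiv ℝ F).enorm.pow_const 2).indicator hKm
  have hGI : ∫⁻ w, G w = ∫⁻ w in K, ‖fderiv ℝ F w‖ₑ ^ 2 := lintegral_indicator hKm _
  have hpt : ∀ x ∈ K, ∀ z ∈ K, ‖F x - F z‖ₑ ^ 2 ≤
      ENNReal.ofReal (2 * r) ^ 2 * ∫⁻ t in Icc (0 : ℝ) 1, G (z + t • (x - z)) := by
    intro x hx z hz
    refine (enorm_sub_sq_le_of_segment hK hF hx hz).trans ?_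
    have h1 : ‖x - z‖ₑ ≤ ENNReal.ofReal (2 * r) := by
      rw [← ofReal_norm]
      refine ENNReal.ofReal_le_ofReal ?_
      have := dist_triangle_right x z z₀
      rw [dist_eq_norm] at this
      have h2 := mem_ball.1 (hKr hx)
      have h3 := mem_ball.1 (hKr hz)
      linarith
    refine mul_le_mul' (pow_le_pow_left₀ zero_le h1 2)
      (le_of_eq (setLIntegral_congr_fun measurableSet_Icc fun t ht => ?_))
    simp only [hG]
    rw [indicator_of_mem (hK.add_smul_sub_mem hz hx ht)]
  have hm3 : Measurable fun q : (Eu k × Eu k) × ℝ => G (q.1.2 + q.2 • (q.1.1 - q.1.2)) :=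
    hGm.comp (by fun_prop)
  have hslice : ∀ t ∈ Icc (0 : ℝ) 1, ∫⁻ x in K, ∫⁻ z in K, G (z + t • (x - z)) ≤
      volume K * (2 ^ k * ∫⁻ w, G w) := by
    intro t ht
    have hm2 : Measurable fun q : Eu k × Eu k => G (q.2 + t • (q.1 - q.2)) :=
      hGm.comp (by fun_prop)
    -- The point `z + t (x - z)` scales `x` by `t` and `z` by `1 - t`. Integrating first in the
    -- variable with factor at least `1 / 2` keeps the Jacobian below `2 ^ k`.
    rcases le_total (1 / 2) t with h | h
    · rw [lintegral_lintegral_swap hm2.aemeasurable]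
      calc _ ≤ ∫⁻ _z in K, 2 ^ k * ∫⁻ w, G w := by
            gcongr with z
            refine (setLIntegral_le_lintegral _ _).trans ?_
            have := lintegral_comp_add_smul_le hGm (z - t • z) h
            refine le_trans (le_of_eq ?_) this
            refine lintegral_congr fun x => ?_
            congr 1
            rw [smul_sub]
            abel
        _ = _ := by rw [setLIntegral_const, mul_comm]
    · calc _ ≤ ∫⁻ _x in K, 2 ^ k * ∫⁻ w, G w := by
            gcongr with x
            refine (setLIntegral_le_lintegral _ _).trans ?_
            have := lintegral_comp_add_smul_le hGm (t • x) (t := 1 - t) (by linarith)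
            refine le_trans (le_of_eq ?_) this
            refine lintegral_congr fun z => ?_
            congr 1
            rw [smul_sub, sub_smul, one_smul]
            abel
        _ = _ := by rw [setLIntegral_const, mul_comm]
  calc _ ≤ ∫⁻ x in K, ∫⁻ z in K, ENNReal.ofReal (2 * r) ^ 2 *
        ∫⁻ t in Icc (0 : ℝ) 1, G (z + t • (x - z)) := by
        refine setLIntegral_mono' hKm fun x hx => ?_
        exact setLIntegral_mono' hKm fun z hz => hpt x hx z hz
    _ = ENNReal.ofReal (2 * r) ^ 2 *
        ∫⁻ x in K, ∫⁻ z in K, ∫⁻ t in Icc (0 : ℝ) 1, G (z + t • (x - z)) := by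
        have hc : ENNReal.ofReal (2 * r) ^ 2 ≠ ⊤ := ENNReal.pow_ne_top ENNReal.ofReal_ne_top
        rw [← lintegral_const_mul' _ _ hc]
        refine lintegral_congr fun x => ?_
        rw [lintegral_const_mul' _ _ hc]
    _ = ENNReal.ofReal (2 * r) ^ 2 *
        ∫⁻ t in Icc (0 : ℝ) 1, ∫⁻ x in K, ∫⁻ z in K, G (z + t • (x - z)) := by
        congr 1
        have h1 : ∀ x : Eu k, ∫⁻ z in K, ∫⁻ t in Icc (0 : ℝ) 1, G (z + t • (x - z)) =
            ∫⁻ t in Icc (0 : ℝ) 1, ∫⁻ z in K, G (z + t • (x - z)) := fun x =>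
          lintegral_lintegral_swap
            (hGm.comp (by fun_prop : Measurable fun q : Eu k × ℝ =>
              q.1 + q.2 • (x - q.1))).aemeasurable
        simp_rw [h1]
        refine lintegral_lintegral_swap (Measurable.aemeasurable ?_)
        have hm4 : Measurable fun q : (Eu k × ℝ) × Eu k => G (q.2 + q.1.2 • (q.1.1 - q.2)) :=
          hGm.comp (by fun_prop)
        exact hm4.lintegral_prod_right'
    _ ≤ ENNReal.ofReal (2 * r) ^ 2 *
        ∫⁻ _t in Icc (0 : ℝ) 1, volume K * (2 ^ k * ∫⁻ w, G w) := by
        gcongr 1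
        exact setLIntegral_mono' measurableSet_Icc hslice
    _ = _ := by rw [setLIntegral_const, hGI]; simp

end ConvexPoincare

/-! ### Local Poincaré inequalities on the submanifold -/

section Local

open Metric
open scoped ENNReal NNReal

variable {d k : ℕ}

/-- On tangent vectors the differential is the inner product with the tangential gradient. -/
lemma fderiv_apply_eq_inner_tgrad {M : Set (Eu d)} {f : Eu d → ℝ} {y : Eu d}
    (hf : DifferentiableAt ℝ f y) {w : Eu d} (hw : w ∈ tangentSpan M y) :
    fderiv ℝ f y w = ⟪tgrad M f y, w⟫ := by
  have h1 : EqOn (fderivWithin ℝ f M y) (fderiv ℝ f y) (tangentConeAt ℝ M y) :=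
    hf.differentiableWithinAt.hasFDerivWithinAt.unique_on hf.hasFDerivAt.hasFDerivWithinAt
  have h2 : fderivWithin ℝ f M y w = fderiv ℝ f y w :=
    LinearMap.eqOn_span (f := (fderivWithin ℝ f M y : Eu d →ₗ[ℝ] ℝ))
      (g := (fderiv ℝ f y : Eu d →ₗ[ℝ] ℝ)) h1 hw
  rw [tgrad, Submodule.inner_starProjection_left_eq_right,
    Submodule.starProjection_eq_self_iff.2 hw, gradientWithin, InnerProductSpace.toDual_symm_apply,
    h2]

namespace IsParam

variable {M : Set (Eu d)} {Φ : OpenPartialHomeomorph (Eu d) (Eu d)} {J : Set (Fin d)} {z₀ : Eu k}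
  {r : ℝ} {C : ℝ≥0} {O : Set (Eu d)}

/-- A convex set with interior has a tangent cone that spans `ℝᵏ`, even at corners, and the
parametrization maps this cone into that of `M`. -/
lemma fderiv_mem_tangentSpan (h : IsParam k M Φ J z₀ r C O) {z : Eu k} (hz : z ∈ modelBall k J z₀ r)
    (v : Eu k) :
    fderiv ℝ (fun z => Φ.symm (pad k d z)) z v ∈ tangentSpan M (Φ.symm (pad k d z)) := by
  set ψ : Eu k → Eu d := fun z => Φ.symm (pad k d z) with hψ
  have hu : UniqueDiffWithinAt ℝ (modelBall k J z₀ r) z :=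
    uniqueDiffWithinAt_convex convex_modelBall
      (interior_modelBall_nonempty h.faces h.pos h.base) (subset_closure hz)
  have htop : Submodule.span ℝ (tangentConeAt ℝ (modelBall k J z₀ r) z) = ⊤ :=
    (Submodule.closed_of_finiteDimensional _).submodule_topologicalClosure_eq.symm.trans
      (Submodule.dense_iff_topologicalClosure_eq_top.1 hu.1)
  have hd : HasFDerivWithinAt ψ (fderiv ℝ ψ z) (modelBall k J z₀ r) z :=
    ((h.contDiffAt z hz.1).differentiableAt (by norm_num)).hasFDerivAt.hasFDerivWithinAt
  have hmaps : ∀ w ∈ tangentConeAt ℝ (modelBall k J z₀ r) z,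
      fderiv ℝ ψ z w ∈ tangentSpan M (ψ z) := by
    intro w hw
    refine Submodule.subset_span (tangentConeAt_mono ?_ (hd.mapsTo_tangent_cone hw))
    rw [h.image_eq]
    exact inter_subset_left
  have hle : Submodule.span ℝ (tangentConeAt ℝ (modelBall k J z₀ r) z) ≤
      (tangentSpan M (ψ z)).comap (fderiv ℝ ψ z : Eu k →ₗ[ℝ] Eu d) :=
    Submodule.span_le.2 hmaps
  rw [htop] at hle
  exact hle (Submodule.mem_top (x := v))

/-- By the chain rule `f` is differentiated only along tangent vectors, so the tangential gradient
suffices. -/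
lemma enorm_fderiv_comp_le (h : IsParam k M Φ J z₀ r C O) {z : Eu k} (hz : z ∈ modelBall k J z₀ r)
    {f : Eu d → ℝ} (hf : ContDiff ℝ 1 f) :
    ‖fderiv ℝ (fun z => f (Φ.symm (pad k d z))) z‖ₑ ≤ C * ‖tgrad M f (Φ.symm (pad k d z))‖ₑ := by
  set ψ : Eu k → Eu d := fun z => Φ.symm (pad k d z) with hψ
  have hfd : DifferentiableAt ℝ f (ψ z) := (hf.differentiable (by norm_num)) _
  have hψd : DifferentiableAt ℝ ψ z := (h.contDiffAt z hz.1).differentiableAt (by norm_num)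
  have hC : ‖fderiv ℝ ψ z‖ ≤ C :=
    norm_fderiv_le_of_lipschitzOn ℝ (isOpen_ball.mem_nhds hz.1) h.lipschitz
  have hn : ‖fderiv ℝ (fun z => f (ψ z)) z‖ ≤ C * ‖tgrad M f (ψ z)‖ := by
    refine ContinuousLinearMap.opNorm_le_bound _ (by positivity) fun v => ?_
    have e : fderiv ℝ (fun z => f (ψ z)) z v = ⟪tgrad M f (ψ z), fderiv ℝ ψ z v⟫ := by
      rw [← fderiv_apply_eq_inner_tgrad hfd (h.fderiv_mem_tangentSpan hz v)]
      have : fderiv ℝ (f ∘ ψ) z = (fderiv ℝ f (ψ z)).comp (fderiv ℝ ψ z) :=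
        fderiv_comp z hfd hψd
      exact DFunLike.congr_fun this v
    rw [e]
    calc _ ≤ ‖tgrad M f (ψ z)‖ * ‖fderiv ℝ ψ z v‖ := norm_inner_le_norm _ _
      _ ≤ ‖tgrad M f (ψ z)‖ * (C * ‖v‖) := by
        gcongr
        exact (ContinuousLinearMap.le_opNorm _ _).trans (by gcongr)
      _ = _ := by ring
  rw [← ofReal_norm, ← ofReal_norm, ← ENNReal.ofReal_coe_nnreal,
    ← ENNReal.ofReal_mul (NNReal.coe_nonneg C)]
  exact ENNReal.ofReal_le_ofReal hn

lemma lintegral_enorm_fderiv_comp_le (h : IsParam k M Φ J z₀ r C O) {f : Eu d → ℝ}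
    (hf : ContDiff ℝ 1 f) (hfm : AEMeasurable (tgrad M f) (surf k M)) :
    ∫⁻ z in modelBall k J z₀ r, ‖fderiv ℝ (fun z => f (Φ.symm (pad k d z))) z‖ₑ ^ 2 ≤
      (C : ℝ≥0∞) ^ 2 * ((C : ℝ≥0∞) ^ (k : ℝ) * ∫⁻ y, ‖tgrad M f y‖ₑ ^ 2 ∂(surf k M)) := by
  calc _ ≤ ∫⁻ z in modelBall k J z₀ r, (C : ℝ≥0∞) ^ 2 * ‖tgrad M f (Φ.symm (pad k d z))‖ₑ ^ 2 := by
        refine setLIntegral_mono' measurableSet_modelBall fun z hz => ?_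
        rw [← mul_pow]
        exact pow_le_pow_left₀ zero_le (h.enorm_fderiv_comp_le hz hf) 2
    _ = (C : ℝ≥0∞) ^ 2 * ∫⁻ z in modelBall k J z₀ r, ‖tgrad M f (Φ.symm (pad k d z))‖ₑ ^ 2 := by
        rw [lintegral_const_mul' _ _ (ENNReal.pow_ne_top ENNReal.coe_ne_top)]
    _ ≤ _ := by
        gcongr 1
        exact h.lintegral_le_surf (hfm.enorm.pow_const 2)

lemma contDiffAt_comp (h : IsParam k M Φ J z₀ r C O) {z : Eu k} (hz : z ∈ ball z₀ r)
    {f : Eu d → ℝ} (hf : ContDiff ℝ 1 f) :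
    ContDiffAt ℝ 1 (fun z => f (Φ.symm (pad k d z))) z :=
  hf.contDiffAt.comp z (h.contDiffAt z hz)

/-- The local Poincaré inequality for pairs of points. -/
lemma exists_pair_bound (h : IsParam k M Φ J z₀ r C O) [IsFiniteMeasure (surf k M)] :
    ∃ A : ℝ≥0∞, A ≠ ⊤ ∧ ∀ f : Eu d → ℝ, ContDiff ℝ 1 f → AEMeasurable (tgrad M f) (surf k M) →
      ∫⁻ x in O, ∫⁻ y in O, ‖f x - f y‖ₑ ^ 2 ∂(surf k M) ∂(surf k M) ≤
        A * ∫⁻ y, ‖tgrad M f y‖ₑ ^ 2 ∂(surf k M) := by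
  set D : ℝ≥0∞ := (C : ℝ≥0∞) ^ (k : ℝ) with hD
  have hDt : D ≠ ⊤ := const_ne_top C k
  have hKt : volume (modelBall k J z₀ r) ≠ ⊤ :=
    ((measure_mono modelBall_subset).trans_lt measure_ball_lt_top).ne
  refine ⟨D * (D * (ENNReal.ofReal (2 * r) ^ 2 * (volume (modelBall k J z₀ r) *
    (2 ^ k * (C ^ 2 * D))))), ?_, fun f hf hfm => ?_⟩
  · have h1 : ENNReal.ofReal (2 * r) ^ 2 ≠ ⊤ := ENNReal.pow_ne_top ENNReal.ofReal_ne_top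
    have h2 : (2 : ℝ≥0∞) ^ k ≠ ⊤ := ENNReal.pow_ne_top (by norm_num)
    have h3 : (C : ℝ≥0∞) ^ 2 ≠ ⊤ := ENNReal.pow_ne_top ENNReal.coe_ne_top
    finiteness
  have hfc := hf.continuous
  have hm : Measurable fun q : Eu d × Eu d => ‖f q.1 - f q.2‖ₑ ^ 2 :=
    Continuous.measurable (by fun_prop)
  have hFc : ∀ z ∈ modelBall k J z₀ r, ContDiffAt ℝ 1 (fun z => f (Φ.symm (pad k d z))) z :=
    fun z hz => h.contDiffAt_comp hz.1 hf
  have hpair := lintegral_enorm_sub_sq_le convex_modelBall measurableSet_modelBall modelBall_subset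
    hFc
  calc _ ≤ D * ∫⁻ z in modelBall k J z₀ r,
        ∫⁻ y in O, ‖f (Φ.symm (pad k d z)) - f y‖ₑ ^ 2 ∂(surf k M) :=
        h.surf_lintegral_le (g := fun x => ∫⁻ y in O, ‖f x - f y‖ₑ ^ 2 ∂(surf k M))
          hm.lintegral_prod_right'
    _ ≤ D * ∫⁻ z in modelBall k J z₀ r, D * ∫⁻ z' in modelBall k J z₀ r,
          ‖f (Φ.symm (pad k d z)) - f (Φ.symm (pad k d z'))‖ₑ ^ 2 := by
        gcongr with z
        exact h.surf_lintegral_le (g := fun y => ‖f (Φ.symm (pad k d z)) - f y‖ₑ ^ 2)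
          (Continuous.measurable (by fun_prop))
    _ = D * (D * ∫⁻ z in modelBall k J z₀ r, ∫⁻ z' in modelBall k J z₀ r,
          ‖f (Φ.symm (pad k d z)) - f (Φ.symm (pad k d z'))‖ₑ ^ 2) := by
        rw [lintegral_const_mul' _ _ hDt]
    _ ≤ D * (D * (ENNReal.ofReal (2 * r) ^ 2 * (volume (modelBall k J z₀ r) *
          (2 ^ k * (C ^ 2 * (D * ∫⁻ y, ‖tgrad M f y‖ₑ ^ 2 ∂(surf k M))))))) := by
        refine mul_le_mul_right (mul_le_mul_right (hpair.trans ?_) _) _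
        gcongr 3
        exact h.lintegral_enorm_fderiv_comp_le hf hfm
    _ = _ := by ring

end IsParam

/-- The model ball is continued with positive measure across each face through its centre. -/
lemma volume_modelBall_neg_pos {J : Set (Fin d)} (hJ : ∀ i ∈ J, i.val < k) {j : Fin d} (hj : j ∈ J)
    {z₀ : Eu k} {r : ℝ} (hr : 0 < r) (hz₀ : ∀ i ∈ J, 0 ≤ pad k d z₀ i) (hz₀j : pad k d z₀ j = 0) :
    0 < volume (modelBall k (J \ {j}) z₀ r ∩ {z | pad k d z j < 0}) := by
  let e : Eu k := WithLp.toLp 2 fun i => if i.val = j.val then -1 else 1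
  have hopen : IsOpen ((ball z₀ r ∩ ⋂ i ∈ J \ {j}, {z : Eu k | 0 < pad k d z i}) ∩
      {z | pad k d z j < 0}) := by
    refine (isOpen_ball.inter ?_).inter (isOpen_lt (continuous_pad_apply j) continuous_const)
    exact (Set.toFinite _).isOpen_biInter fun i _ =>
      isOpen_lt continuous_const (continuous_pad_apply i)
  have hcont : Filter.Tendsto (fun t : ℝ => z₀ + t • e) (𝓝[>] 0) (𝓝 z₀) := by
    have : Filter.Tendsto (fun t : ℝ => z₀ + t • e) (𝓝 0) (𝓝 (z₀ + (0 : ℝ) • e)) :=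
      Continuous.tendsto (by fun_prop) _
    rw [zero_smul, add_zero] at this
    exact this.mono_left nhdsWithin_le_nhds
  obtain ⟨t, ht1, ht2⟩ := ((hcont.eventually (ball_mem_nhds z₀ hr)).and
    (self_mem_nhdsWithin : Ioi (0 : ℝ) ∈ 𝓝[>] (0 : ℝ))).exists
  have ht0 : (0 : ℝ) < t := ht2
  refine (hopen.measure_pos volume ⟨z₀ + t • e, ⟨ht1, ?_⟩, ?_⟩).trans_le (measure_mono ?_)
  · simp only [mem_iInter, mem_ofPred_eq]
    intro i hi
    have h1 := hz₀ i hi.1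
    have hne : i.val ≠ j.val := fun h => hi.2 (Fin.ext h)
    rw [pad_apply, dif_pos (hJ i hi.1)] at h1 ⊢
    simp only [PiLp.add_apply, PiLp.smul_apply, smul_eq_mul, e, hne, if_false, mul_one]
    linarith
  · simp only [mem_ofPred_eq]
    rw [pad_apply, dif_pos (hJ j hj)] at hz₀j ⊢
    simp only [PiLp.add_apply, PiLp.smul_apply, smul_eq_mul, e, if_true, hz₀j]
    linarith
  · refine inter_subset_inter_left _ ?_
    rw [modelBall_eq]
    exact inter_subset_inter_right _ (iInter₂_mono fun i _ z (hz : 0 < pad k d z i) => hz.le)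

/-- The local Poincaré inequality at a boundary point, for functions which vanish near the
boundary. -/
lemma exists_boundary_bound {M : Set (Eu d)} (hM : IsCompactSubmanifold k M) {y : Eu d}
    (hy : y ∈ bdry k M) :
    ∃ O : Set (Eu d), IsOpen O ∧ y ∈ O ∧ ∃ A : ℝ≥0∞, A ≠ ⊤ ∧ ∀ f : Eu d → ℝ, ContDiff ℝ 1 f →
      Disjoint (tsupport f) (bdry k M) → AEMeasurable (tgrad M f) (surf k M) →
      ∫⁻ x in O, ‖f x‖ₑ ^ 2 ∂(surf k M) ≤ A * ∫⁻ y, ‖tgrad M f y‖ₑ ^ 2 ∂(surf k M) := by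
  obtain ⟨hyM, Φ, J, hΦ, hys, j, hj, hyj⟩ := hy
  obtain ⟨z₀, r, C, O, hz₀, hyO, h⟩ := hΦ.exists_isParam hM.dim_le hyM hys
  set D : ℝ≥0∞ := (C : ℝ≥0∞) ^ (k : ℝ) with hD
  have hDt : D ≠ ⊤ := IsParam.const_ne_top C k
  set K := modelBall k J z₀ r with hK
  -- Dropping the face `j` enlarges the model across that face and keeps it convex; the added part
  -- `N` has positive measure.
  set K' := modelBall k (J \ {j}) z₀ r with hK'
  set N := K' ∩ {z | pad k d z j < 0} with hN
  have hK't : volume K' ≠ ⊤ := ((measure_mono modelBall_subset).trans_lt measure_ball_lt_top).ne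
  have hNpos : 0 < volume N :=
    volume_modelBall_neg_pos h.faces hj h.pos h.base (by rw [hz₀]; exact hyj)
  have hNt : volume N ≠ ⊤ := ((measure_mono inter_subset_left).trans_lt hK't.lt_top).ne
  have hNm : MeasurableSet N := measurableSet_modelBall.inter
    (isOpen_lt (continuous_pad_apply j) continuous_const).measurableSet
  have hKK' : K ⊆ K' := fun z hz => ⟨hz.1, fun i hi => hz.2 i hi.1⟩
  have hsplit : ∀ z ∈ K', z ∈ K ∨ z ∈ N := by
    intro z hz
    by_cases hzj : pad k d z j < 0
    · exact Or.inr ⟨hz, hzj⟩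
    · refine Or.inl ⟨hz.1, fun i hi => ?_⟩
      by_cases hij : i = j
      · rw [hij]; exact not_lt.1 hzj
      · exact hz.2 i ⟨hi, hij⟩
  refine ⟨O, h.isOpen, hyO, D * ((volume N)⁻¹ * (ENNReal.ofReal (2 * r) ^ 2 * (volume K' *
    (2 ^ k * (C ^ 2 * D))))), ?_, fun f hf hfb hfm => ?_⟩
  · have h1 : ENNReal.ofReal (2 * r) ^ 2 ≠ ⊤ := ENNReal.pow_ne_top ENNReal.ofReal_ne_top
    have h2 : (2 : ℝ≥0∞) ^ k ≠ ⊤ := ENNReal.pow_ne_top (by norm_num)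
    have h3 : (C : ℝ≥0∞) ^ 2 ≠ ⊤ := ENNReal.pow_ne_top ENNReal.coe_ne_top
    have h4 : (volume N)⁻¹ ≠ ⊤ := ENNReal.inv_ne_top.2 hNpos.ne'
    finiteness
  set ψ : Eu k → Eu d := fun z => Φ.symm (pad k d z) with hψ
  -- Extension by zero across the face. It is `C¹` on `K'` because `f` vanishes near boundary
  -- points, and in particular near the image of the face.
  let F : Eu k → ℝ := fun z => if 0 ≤ pad k d z j then f (ψ z) else 0
  have hFK : ∀ z ∈ K, F =ᶠ[𝓝 z] fun z => f (ψ z) := by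
    intro z hz
    rcases (hz.2 j hj).lt_or_eq with hpos | hzero
    · filter_upwards [(isOpen_lt continuous_const (continuous_pad_apply j)).mem_nhds hpos]
        with w (hw : 0 < pad k d w j)
      exact if_pos hw.le
    · have ht := h.mem_target z hz.1
      have hmem : ψ z ∈ bdry k M := by
        refine ⟨(h.image_eq.le (mem_image_of_mem _ hz)).1, Φ, J, hΦ, Φ.map_target ht, j, hj, ?_⟩
        rw [Φ.right_inv ht]
        exact hzero.symm
      have hnt : ψ z ∉ tsupport f := fun hs => Set.disjoint_left.1 hfb hs hmem
      have hf0 : ∀ᶠ w in 𝓝 z, f (ψ w) = 0 :=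
        (h.contDiffAt z hz.1).continuousAt.eventually (notMem_tsupport_iff_eventuallyEq.1 hnt)
      filter_upwards [hf0] with w hw
      simp only [F]
      rw [hw, ite_self]
  have hFN : ∀ z ∈ N, F =ᶠ[𝓝 z] fun _ => 0 := by
    intro z hz
    filter_upwards [(isOpen_lt (continuous_pad_apply j) continuous_const).mem_nhds hz.2]
      with w (hw : pad k d w j < 0)
    exact if_neg (not_le.2 hw)
  have hFc : ∀ z ∈ K', ContDiffAt ℝ 1 F z := by
    intro z hz
    rcases hsplit z hz with hz' | hz'
    · exact (h.contDiffAt_comp hz.1 hf).congr_of_eventuallyEq (hFK z hz')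
    · exact contDiffAt_const.congr_of_eventuallyEq (hFN z hz')
  have hpair := lintegral_enorm_sub_sq_le convex_modelBall measurableSet_modelBall modelBall_subset
    hFc
  have hder : ∫⁻ w in K', ‖fderiv ℝ F w‖ₑ ^ 2 ≤ ∫⁻ w in K, ‖fderiv ℝ (fun z => f (ψ z)) w‖ₑ ^ 2 := by
    calc _ ≤ ∫⁻ w in K ∪ N, ‖fderiv ℝ F w‖ₑ ^ 2 := lintegral_mono_set hsplit
      _ ≤ (∫⁻ w in K, ‖fderiv ℝ F w‖ₑ ^ 2) + ∫⁻ w in N, ‖fderiv ℝ F w‖ₑ ^ 2 :=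
          lintegral_union_le _ _ _
      _ = (∫⁻ w in K, ‖fderiv ℝ (fun z => f (ψ z)) w‖ₑ ^ 2) + ∫⁻ w in N, 0 := by
          congr 1
          · refine setLIntegral_congr_fun measurableSet_modelBall fun w hw => ?_
            rw [(hFK w hw).fderiv_eq]
          · refine setLIntegral_congr_fun hNm fun w hw => ?_
            have h0 : fderiv ℝ (fun _ : Eu k => (0 : ℝ)) w = 0 := by simp
            rw [(hFN w hw).fderiv_eq, h0, ← ofReal_norm, norm_zero]
            simp
      _ = _ := by simp
  -- On `K × N` the difference `F x - F z` is just `f (ψ x)`, so the pair inequality on `K'` already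
  -- bounds the function itself.
  have hlow : volume N * ∫⁻ z in K, ‖f (ψ z)‖ₑ ^ 2 ≤
      ∫⁻ x in K', ∫⁻ z in K', ‖F x - F z‖ₑ ^ 2 := by
    calc _ = ∫⁻ x in K, ∫⁻ z in N, ‖F x - F z‖ₑ ^ 2 := by
          rw [← lintegral_const_mul' _ _ hNt]
          refine setLIntegral_congr_fun measurableSet_modelBall fun x hx => ?_
          rw [setLIntegral_congr_fun (g := fun _ => ‖f (ψ x)‖ₑ ^ 2) hNm fun z hz => ?_]
          · rw [setLIntegral_const, mul_comm]
          · rw [(hFK x hx).eq_of_nhds, (hFN z hz).eq_of_nhds, sub_zero]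
      _ ≤ ∫⁻ x in K', ∫⁻ z in K', ‖F x - F z‖ₑ ^ 2 := by
          refine (lintegral_mono_set hKK').trans ?_
          gcongr with x
          exact inter_subset_left
  have hfc := hf.continuous
  calc _ ≤ D * ∫⁻ z in K, ‖f (ψ z)‖ₑ ^ 2 :=
        h.surf_lintegral_le (g := fun x => ‖f x‖ₑ ^ 2) (Continuous.measurable (by fun_prop))
    _ ≤ D * ((volume N)⁻¹ * (ENNReal.ofReal (2 * r) ^ 2 * (volume K' *
          (2 ^ k * (C ^ 2 * (D * ∫⁻ y, ‖tgrad M f y‖ₑ ^ 2 ∂(surf k M))))))) := by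
        refine mul_le_mul_right ?_ _
        rw [← ENNReal.div_eq_inv_mul, ENNReal.le_div_iff_mul_le (Or.inl hNpos.ne') (Or.inl hNt),
          mul_comm]
        refine hlow.trans (hpair.trans ?_)
        gcongr 3
        exact hder.trans (h.lintegral_enorm_fderiv_comp_le hf hfm)
    _ = _ := by ring

end Local

/-! ### The global Poincaré inequality -/

section Poincare

open Metric
open scoped ENNReal NNReal

variable {d k : ℕ}

/-- The functions to which the Poincaré inequality applies: continuously differentiable functions
which vanish near the boundary. -/
structure IsTest (k : ℕ) (R : Set (Eu d)) (f : Eu d → ℝ) : Prop where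
  contDiff : ContDiff ℝ 1 f
  disjoint : Disjoint (tsupport f) (bdry k R)
  aemeasurable : AEMeasurable (tgrad R f) (surf k R)

/-- The open set `U` carries a Poincaré inequality for test functions on `R`. -/
def PoincareOn (k : ℕ) (R U : Set (Eu d)) : Prop :=
  ∃ A : ℝ≥0∞, A ≠ ⊤ ∧ ∀ f : Eu d → ℝ, IsTest k R f →
    ∫⁻ x in U, ‖f x‖ₑ ^ 2 ∂(surf k R) ≤ A * ∫⁻ y, ‖tgrad R f y‖ₑ ^ 2 ∂(surf k R)

lemma PoincareOn.mono {R U U' : Set (Eu d)} (h : PoincareOn k R U) (hU : U' ⊆ U) :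
    PoincareOn k R U' := by
  obtain ⟨A, hA, hf⟩ := h
  exact ⟨A, hA, fun f hft => (lintegral_mono_set hU).trans (hf f hft)⟩

lemma PoincareOn.union {R U U' : Set (Eu d)} (h : PoincareOn k R U) (h' : PoincareOn k R U') :
    PoincareOn k R (U ∪ U') := by
  obtain ⟨A, hA, hf⟩ := h
  obtain ⟨A', hA', hf'⟩ := h'
  refine ⟨A + A', ENNReal.add_ne_top.2 ⟨hA, hA'⟩, fun f hft => (lintegral_union_le _ _ _).trans ?_⟩
  rw [add_mul]
  exact add_le_add (hf f hft) (hf' f hft)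

lemma PoincareOn.empty {R : Set (Eu d)} : PoincareOn k R ∅ :=
  ⟨0, by simp, fun f _ => by simp⟩

/-- The Poincaré inequality spreads from a subset `W` of positive measure to a set on which pairs
of points are controlled. -/
lemma PoincareOn.spread {R O W : Set (Eu d)} [IsFiniteMeasure (surf k R)] (hWO : W ⊆ O)
    (hWpos : 0 < surf k R W) (hW : PoincareOn k R W)
    (hO : ∃ A : ℝ≥0∞, A ≠ ⊤ ∧ ∀ f : Eu d → ℝ, ContDiff ℝ 1 f → AEMeasurable (tgrad R f) (surf k R) →
      ∫⁻ x in O, ∫⁻ y in O, ‖f x - f y‖ₑ ^ 2 ∂(surf k R) ∂(surf k R) ≤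
        A * ∫⁻ y, ‖tgrad R f y‖ₑ ^ 2 ∂(surf k R)) :
    PoincareOn k R O := by
  obtain ⟨A, hA, hf⟩ := hW
  obtain ⟨A', hA', hf'⟩ := hO
  set σ := surf k R
  have hWt : σ W ≠ ⊤ := measure_ne_top _ _
  have hOt : σ O ≠ ⊤ := measure_ne_top _ _
  have hinv : (σ W)⁻¹ ≠ ⊤ := ENNReal.inv_ne_top.2 hWpos.ne'
  refine ⟨(σ W)⁻¹ * (2 * (A' + σ O * A)), by finiteness, fun f hft => ?_⟩
  set I := ∫⁻ y, ‖tgrad R f y‖ₑ ^ 2 ∂σ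
  have hfc := hft.contDiff.continuous
  have hsq : ∀ x y, ‖f x‖ₑ ^ 2 ≤ 2 * (‖f x - f y‖ₑ ^ 2 + ‖f y‖ₑ ^ 2) := by
    intro x y
    have h1 : ‖f x‖ₑ ≤ ‖f x - f y‖ₑ + ‖f y‖ₑ := by
      calc ‖f x‖ₑ = ‖(f x - f y) + f y‖ₑ := by rw [sub_add_cancel]
        _ ≤ _ := enorm_add_le _ _
    have h2 := pow_le_pow_left₀ zero_le h1 2
    refine h2.trans ?_
    have := ENNReal.rpow_add_le_mul_rpow_add_rpow ‖f x - f y‖ₑ ‖f y‖ₑ (p := 2) (by norm_num)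
    norm_num at this
    exact_mod_cast this
  have hfm : Measurable fun y => ‖f y‖ₑ ^ 2 := Continuous.measurable (by fun_prop)
  have hm2 : Measurable fun q : Eu d × Eu d => ‖f q.1 - f q.2‖ₑ ^ 2 :=
    Continuous.measurable (by fun_prop)
  -- Integration of `hsq` over `x ∈ O` and `y ∈ W`: the value at `x` is compared with the values on
  -- `W`, which are already controlled.
  have hmain : σ W * ∫⁻ x in O, ‖f x‖ₑ ^ 2 ∂σ ≤ 2 * (A' + σ O * A) * I := by
    calc σ W * ∫⁻ x in O, ‖f x‖ₑ ^ 2 ∂σ = ∫⁻ x in O, ∫⁻ _y in W, ‖f x‖ₑ ^ 2 ∂σ ∂σ := by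
          rw [← lintegral_const_mul' _ _ hWt]
          refine lintegral_congr fun x => ?_
          rw [setLIntegral_const, mul_comm]
      _ ≤ ∫⁻ x in O, 2 * ((∫⁻ y in O, ‖f x - f y‖ₑ ^ 2 ∂σ) + ∫⁻ y in W, ‖f y‖ₑ ^ 2 ∂σ) ∂σ := by
          gcongr with x
          calc _ ≤ ∫⁻ y in W, 2 * (‖f x - f y‖ₑ ^ 2 + ‖f y‖ₑ ^ 2) ∂σ :=
                lintegral_mono fun y => hsq x y
            _ = 2 * ((∫⁻ y in W, ‖f x - f y‖ₑ ^ 2 ∂σ) + ∫⁻ y in W, ‖f y‖ₑ ^ 2 ∂σ) := by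
                rw [lintegral_const_mul' _ _ (by norm_num), lintegral_add_right _ hfm]
            _ ≤ _ := by
                gcongr
      _ = 2 * ((∫⁻ x in O, ∫⁻ y in O, ‖f x - f y‖ₑ ^ 2 ∂σ ∂σ) +
            σ O * ∫⁻ y in W, ‖f y‖ₑ ^ 2 ∂σ) := by
          rw [lintegral_const_mul' _ _ (by norm_num), lintegral_add_right _ measurable_const,
            setLIntegral_const, mul_comm (σ O)]
      _ ≤ 2 * (A' * I + σ O * (A * I)) := by
          gcongr
          · exact hf' f hft.contDiff hft.aemeasurable
          · exact hf f hft
      _ = _ := by ring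
  rw [mul_assoc, ← ENNReal.div_eq_inv_mul,
    ENNReal.le_div_iff_mul_le (Or.inl hWpos.ne') (Or.inl hWt), mul_comm]
  exact hmain

/-- The Poincaré inequality on a compact submanifold all of whose components have a boundary. -/
theorem IsCompactSubmanifold.poincareOn {R : Set (Eu d)} (hR : IsCompactSubmanifold k R)
    (hRbdry : ∀ y ∈ R, (connectedComponentIn R y ∩ bdry k R).Nonempty) :
    PoincareOn k R R := by
  have := hR.isFiniteMeasure_surf
  -- the points with a neighbourhood carrying a Poincaré inequality
  let G : Set (Eu d) := {y | ∃ U, IsOpen U ∧ y ∈ U ∧ PoincareOn k R U}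
  have hGo : IsOpen G := by
    rw [isOpen_iff_mem_nhds]
    rintro y ⟨U, hU, hyU, hP⟩
    exact Filter.mem_of_superset (hU.mem_nhds hyU) fun z hz => ⟨U, hU, hz, hP⟩
  -- A parametrized neighbourhood of a limit point meets a good neighbourhood in positive measure,
  -- so the inequality spreads to the limit point.
  have hGcl : ∀ y ∈ R, y ∈ closure (R ∩ G) → y ∈ G := by
    intro y hy hycl
    obtain ⟨Φ, J, z₀, r, C, O, hyO, hp⟩ := hR.exists_isParam hy
    obtain ⟨w, hwO, hwR, U, hU, hwU, hP⟩ := mem_closure_iff.1 hycl O hp.isOpen hyO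
    refine ⟨O, hp.isOpen, hyO, PoincareOn.spread (W := O ∩ U)
      inter_subset_left ?_ (hP.mono inter_subset_right) hp.exists_pair_bound⟩
    exact hR.surf_pos (hp.isOpen.inter hU) hwR ⟨hwO, hwU⟩
  have hbG : bdry k R ⊆ G := by
    intro y hy
    obtain ⟨O, hO, hyO, A, hA, hf⟩ := exists_boundary_bound hR hy
    exact ⟨O, hO, hyO, A, hA, fun f hft => hf f hft.contDiff hft.disjoint hft.aemeasurable⟩
  -- Within `R` the set `G` is open and closed, and it contains the boundary; each component meets
  -- the boundary, so connectedness puts it inside `G`.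
  have hRG : R ⊆ G := by
    intro y hy
    set c := connectedComponentIn R y
    obtain ⟨b, hbc, hbb⟩ := hRbdry y hy
    have hcR : c ⊆ R := connectedComponentIn_subset R y
    have hpre : IsPreconnected c := isPreconnected_connectedComponentIn
    by_contra hyG
    have hopen : IsOpen ((closure (R ∩ G))ᶜ) := isClosed_closure.isOpen_compl
    have hyc : y ∈ c := mem_connectedComponentIn hy
    obtain ⟨x, hxc, hxG, hxn⟩ := hpre G _ hGo hopen
      (fun x hx => by
        by_cases h : x ∈ closure (R ∩ G)
        · exact Or.inl (hGcl x (hcR hx) h)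
        · exact Or.inr h)
      ⟨b, hbc, hbG hbb⟩ ⟨y, hyc, fun h => hyG (hGcl y hy h)⟩
    exact hxn (subset_closure ⟨hcR hxc, hxG⟩)
  refine hR.isCompact.induction_on (p := fun s => PoincareOn k R s) PoincareOn.empty
    (fun s t hst ht => ht.mono hst) (fun s t hs ht => hs.union ht) fun y hy => ?_
  obtain ⟨U, hU, hyU, hP⟩ := hRG hy
  exact ⟨U, mem_nhdsWithin_of_mem_nhds (hU.mem_nhds hyU), hP⟩

end Poincare

/-! ### The Hilbert space structure of `H¹₀(R)` -/

section H10Space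

open scoped ENNReal

variable {d k : ℕ}

/-- The derivative within `M` is determined only on tangent vectors; the projection removes the
ambiguity. Linearity of `tgrad` follows from this formula. -/
lemma tgrad_eq {M : Set (Eu d)} {f : Eu d → ℝ} {y : Eu d} (hf : DifferentiableAt ℝ f y) :
    tgrad M f y = (tangentSpan M y).starProjection ((InnerProductSpace.toDual ℝ (Eu d)).symm
      (fderiv ℝ f y)) := by
  rw [← sub_eq_zero]
  refine inner_self_eq_zero (𝕜 := ℝ) |>.1 ?_
  set x := tgrad M f y - (tangentSpan M y).starProjection
    ((InnerProductSpace.toDual ℝ (Eu d)).symm (fderiv ℝ f y)) with hx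
  have hxm : x ∈ tangentSpan M y :=
    Submodule.sub_mem _ (Submodule.starProjection_apply_mem _ _)
      (Submodule.starProjection_apply_mem _ _)
  have h1 : ⟪x, x⟫ = ⟪tgrad M f y, x⟫ - ⟪(tangentSpan M y).starProjection
      ((InnerProductSpace.toDual ℝ (Eu d)).symm (fderiv ℝ f y)), x⟫ := by
    rw [← inner_sub_left, ← hx]
  rw [h1, ← fderiv_apply_eq_inner_tgrad hf hxm, Submodule.inner_starProjection_left_eq_right,
    Submodule.starProjection_eq_self_iff.2 hxm, InnerProductSpace.toDual_symm_apply, sub_self]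

lemma tgrad_add {M : Set (Eu d)} {f g : Eu d → ℝ} (hf : Differentiable ℝ f)
    (hg : Differentiable ℝ g) : tgrad M (f + g) = tgrad M f + tgrad M g := by
  ext1 y
  rw [Pi.add_apply, tgrad_eq (hf y), tgrad_eq (hg y), tgrad_eq ((hf y).add (hg y)),
    fderiv_add (hf y) (hg y), map_add, map_add]

lemma tgrad_const_smul {M : Set (Eu d)} {f : Eu d → ℝ} (c : ℝ) (hf : Differentiable ℝ f) :
    tgrad M (c • f) = c • tgrad M f := by
  ext1 y
  rw [Pi.smul_apply, tgrad_eq (hf y), tgrad_eq ((hf y).const_smul c), fderiv_const_smul (hf y),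
    map_smulₛₗ, conj_trivial, map_smul]

/-- The graph of the gradient on test functions is already a linear space. -/
lemma mem_testGraph_of_mem_span {R : Set (Eu d)}
    {w : Lp ℝ 2 (surf k R) × Lp (Eu d) 2 (surf k R)}
    (hw : w ∈ Submodule.span ℝ (testGraph k R)) : w ∈ testGraph k R := by
  induction hw using Submodule.span_induction with
  | mem x hx => exact hx
  | zero =>
    refine ⟨0, contDiff_const, by simp [tsupport], Lp.coeFn_zero _ _ _, ?_⟩
    have h0 : tgrad R (0 : Eu d → ℝ) = 0 := by
      have := tgrad_const_smul (M := R) (f := (0 : Eu d → ℝ)) 0 (differentiable_const 0)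
      simpa using this
    rw [h0]
    exact Lp.coeFn_zero _ _ _
  | add x y _ _ hx hy =>
    obtain ⟨f, hf, hfd, hf1, hf2⟩ := hx
    obtain ⟨g, hg, hgd, hg1, hg2⟩ := hy
    refine ⟨f + g, hf.add hg, ?_, (Lp.coeFn_add _ _).trans (hf1.add hg1), ?_⟩
    · exact (hfd.union_left hgd).mono_left (tsupport_add f g)
    · rw [tgrad_add (hf.differentiable (by simp)) (hg.differentiable (by simp))]
      exact (Lp.coeFn_add _ _).trans (hf2.add hg2)
  | smul c x _ hx =>
    obtain ⟨f, hf, hfd, hf1, hf2⟩ := hx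
    refine ⟨c • f, contDiff_const.smul hf, ?_, (Lp.coeFn_smul _ _).trans (hf1.const_smul c), ?_⟩
    · exact hfd.mono_left (closure_mono (Function.support_const_smul_subset c f))
    · rw [tgrad_const_smul c (hf.differentiable (by simp))]
      exact (Lp.coeFn_smul _ _).trans (hf2.const_smul c)

lemma eLpNorm_two_sq {α G : Type*} [MeasurableSpace α] [NormedAddCommGroup G] (μ : Measure α)
    (f : α → G) : eLpNorm f 2 μ ^ 2 = ∫⁻ x, ‖f x‖ₑ ^ 2 ∂μ := by
  have := eLpNorm_nnreal_pow_eq_lintegral (f := f) (μ := μ) (p := 2) (by norm_num)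
  simpa using this

/-- The Poincaré inequality on `H¹₀(R)`. -/
lemma exists_norm_H10fn_le {R : Set (Eu d)} (hR : PoincareOn k R R) :
    ∃ c : ℝ, 0 ≤ c ∧ ∀ u : H10 k R, ‖H10fn u‖ ≤ c * ‖H10grad u‖ := by
  obtain ⟨A, hA, hf⟩ := hR
  refine ⟨Real.sqrt A.toReal, Real.sqrt_nonneg _, fun u => ?_⟩
  have hcl : IsClosed {w : Lp ℝ 2 (surf k R) × Lp (Eu d) 2 (surf k R) |
      ‖w.1‖ ≤ Real.sqrt A.toReal * ‖w.2‖} := isClosed_le (by fun_prop) (by fun_prop)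
  refine closure_minimal (fun w hw => ?_) hcl u.2
  obtain ⟨f, hfs, hfd, hf1, hf2⟩ := mem_testGraph_of_mem_span hw
  have ht : IsTest k R f := ⟨hfs.of_le (by exact_mod_cast le_top), hfd,
    (Lp.aestronglyMeasurable w.2).aemeasurable.congr hf2⟩
  have h1 := hf f ht
  rw [surf, Measure.restrict_restrict_of_subset Subset.rfl, ← surf, ← eLpNorm_two_sq,
    ← eLpNorm_two_sq, ← eLpNorm_congr_ae hf1, ← eLpNorm_congr_ae hf2] at h1
  have h2 := ENNReal.toReal_mono (ENNReal.mul_ne_top hA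
    (ENNReal.pow_ne_top (Lp.eLpNorm_ne_top w.2))) h1
  rw [ENNReal.toReal_mul, ENNReal.toReal_pow, ENNReal.toReal_pow, ← Lp.norm_def, ← Lp.norm_def]
    at h2
  change ‖w.1‖ ≤ Real.sqrt A.toReal * ‖w.2‖
  refine abs_le_of_sq_le_sq' ?_ (by positivity) |>.2
  rwa [mul_pow, Real.sq_sqrt ENNReal.toReal_nonneg]

instance {R : Set (Eu d)} : CompleteSpace (H10 k R) :=
  (Submodule.isClosed_topologicalClosure _).completeSpace_coe

/-- The gradient as a continuous linear map on `H¹₀(R)`. -/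
noncomputable def gradMap (k : ℕ) (R : Set (Eu d)) : H10 k R →L[ℝ] Lp (Eu d) 2 (surf k R) :=
  ContinuousLinearMap.snd ℝ _ _ ∘L (H10 k R).subtypeL

/-- The inclusion of `H¹₀(R)` in `L²(R)` as a continuous linear map. -/
noncomputable def fnMap (k : ℕ) (R : Set (Eu d)) : H10 k R →L[ℝ] Lp ℝ 2 (surf k R) :=
  ContinuousLinearMap.fst ℝ _ _ ∘L (H10 k R).subtypeL

/-- By Poincaré the gradient controls the whole graph norm, so the range of the gradient is closed
in `L²` and hence a Hilbert space. -/
lemma gradMap_antilipschitz {R : Set (Eu d)} (hR : PoincareOn k R R) :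
    ∃ c, AntilipschitzWith c (gradMap k R) := by
  obtain ⟨c, hc, h⟩ := exists_norm_H10fn_le hR
  refine ⟨⟨max c 1, by positivity⟩, AddMonoidHomClass.antilipschitz_of_bound _ fun u => ?_⟩
  change max ‖H10fn u‖ ‖H10grad u‖ ≤ max c 1 * ‖H10grad u‖
  refine max_le ((h u).trans ?_) ?_
  · gcongr; exact le_max_left _ _
  · exact le_mul_of_one_le_left (norm_nonneg _) (le_max_right _ _)

/-- `H¹₀(R)` is identified with the closed space of gradients. -/
noncomputable def gradEquiv {R : Set (Eu d)} (hR : PoincareOn k R R) :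
    H10 k R ≃L[ℝ] LinearMap.range (gradMap k R : H10 k R →ₗ[ℝ] Lp (Eu d) 2 (surf k R)) :=
  ContinuousLinearMap.equivRange (f := gradMap k R)
    (gradMap_antilipschitz hR).choose_spec.injective
    ((gradMap_antilipschitz hR).choose_spec.isClosed_range (gradMap k R).uniformContinuous)

lemma inner_gradEquiv {R : Set (Eu d)} (hR : PoincareOn k R R) (u v : H10 k R) :
    ⟪gradEquiv hR u, gradEquiv hR v⟫ = gradInner u v := by
  change ⟪H10grad u, H10grad v⟫ = _
  exact L2.inner_def (H10grad u) (H10grad v)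

end H10Space

/-! ### Transfer of the abstract theorem to `H¹₀(R)` -/

section Operators

variable {p d k l : ℕ} {R V : Set (Eu d)}

/-- The integral operator with kernel `κ` between the `L²` spaces of two submanifolds. -/
noncomputable def surfOp (k l : ℕ) (R V : Set (Eu d)) (κ : Eu d → Eu d → ℝ) :
    Lp ℝ 2 (surf k R) →L[ℝ] Lp ℝ 2 (surf l V) :=
  kernelOp (Measure.euclideanHausdorffMeasure k) (Measure.euclideanHausdorffMeasure l) R V κ

/-- The derivative in the parameter of a family of integral operators. -/
noncomputable def surfOpDeriv (k l : ℕ) (R V : Set (Eu d)) (H : Eu p → Eu d → Eu d → ℝ)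
    (m : Eu p) : Eu p →L[ℝ] Lp ℝ 2 (surf k R) →L[ℝ] Lp ℝ 2 (surf l V) :=
  kernelOpDeriv (Measure.euclideanHausdorffMeasure k) (Measure.euclideanHausdorffMeasure l) R V H m

lemma surfOp_ae_eq (hR : IsCompactSubmanifold k R) (hV : IsCompactSubmanifold l V)
    {κ : Eu d → Eu d → ℝ} (hκ : ContinuousOn (fun z : Eu d × Eu d => κ z.1 z.2) (V ×ˢ R))
    (g : Lp ℝ 2 (surf k R)) :
    surfOp k l R V κ g =ᵐ[surf l V] fun x => ∫ y, κ x y * g y ∂(surf k R) := by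
  have h1 : IsFiniteMeasure ((Measure.euclideanHausdorffMeasure k).restrict R) :=
    hR.isFiniteMeasure_surf
  have h2 : IsFiniteMeasure ((Measure.euclideanHausdorffMeasure l).restrict V) :=
    hV.isFiniteMeasure_surf
  exact isKernelOp_kernelOp hV.isCompact hR.isCompact hκ g

lemma isCompactOperator_surfOp (hR : IsCompactSubmanifold k R) (hV : IsCompactSubmanifold l V)
    {κ : Eu d → Eu d → ℝ} (hκ : ContinuousOn (fun z : Eu d × Eu d => κ z.1 z.2) (V ×ˢ R)) :
    IsCompactOperator (surfOp k l R V κ) := by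
  have h1 : IsFiniteMeasure ((Measure.euclideanHausdorffMeasure k).restrict R) :=
    hR.isFiniteMeasure_surf
  have h2 : IsFiniteMeasure ((Measure.euclideanHausdorffMeasure l).restrict V) :=
    hV.isFiniteMeasure_surf
  exact isCompactOperator_kernelOp hV.isCompact hR.isCompact hκ

variable {H : Eu p → Eu d → Eu d → ℝ} {B B' : Set (Eu p)}

lemma Reg1.continuousOn_section (hH : Reg1 B V R H) {m : Eu p} (hm : m ∈ B) :
    ContinuousOn (fun z : Eu d × Eu d => H m z.1 z.2) (V ×ˢ R) :=
  hH.cont.comp (f := fun z : Eu d × Eu d => (m, z.1, z.2)) (by fun_prop)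
    (fun _ hz => ⟨hm, hz.1, hz.2⟩)

lemma hasStrictFDerivAt_surfOp (hR : IsCompactSubmanifold k R) (hV : IsCompactSubmanifold l V)
    (hB' : IsOpen B') (hH : Reg2 B' V R H) {m : Eu p} (hm : m ∈ B')
    (hc : ContinuousOn (fun z : Eu d × Eu d => H m z.1 z.2) (V ×ˢ R)) :
    HasStrictFDerivAt (fun m => surfOp k l R V (H m)) (surfOpDeriv k l R V H m) m := by
  have h1 : IsFiniteMeasure ((Measure.euclideanHausdorffMeasure k).restrict R) :=
    hR.isFiniteMeasure_surf
  have h2 : IsFiniteMeasure ((Measure.euclideanHausdorffMeasure l).restrict V) :=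
    hV.isFiniteMeasure_surf
  exact hasStrictFDerivAt_kernelOp hV.isCompact hR.isCompact hB' hH.diff_m hH.cont_m hm hc

lemma opA_ae_eq (hR : IsCompactSubmanifold k R) (hV : IsCompactSubmanifold l V)
    (hH : Reg1 B V R H) {m : Eu p} (hm : m ∈ B) (u : H10 k R) :
    surfOp k l R V (H m) (fnMap k R u) =ᵐ[surf l V] opA H m u :=
  surfOp_ae_eq hR hV (hH.continuousOn_section hm) _

lemma opDA_ae_eq (hR : IsCompactSubmanifold k R) (hV : IsCompactSubmanifold l V)
    (hB' : IsOpen B') (hH : Reg2 B' V R H) {m : Eu p} (hm : m ∈ B')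
    (hc : ContinuousOn (fun z : Eu d × Eu d => H m z.1 z.2) (V ×ˢ R)) (q : Eu p) (u : H10 k R) :
    surfOpDeriv k l R V H m q (fnMap k R u) =ᵐ[surf l V] opDA H q m u := by
  have h1 : IsFiniteMeasure ((Measure.euclideanHausdorffMeasure k).restrict R) :=
    hR.isFiniteMeasure_surf
  have h2 : IsFiniteMeasure ((Measure.euclideanHausdorffMeasure l).restrict V) :=
    hV.isFiniteMeasure_surf
  have hs : surfOpDeriv k l R V H m q (fnMap k R u) =
      ∑ i, q i • surfOp k l R V (fun x y => pd i (fun m' => H m' x y) m) (fnMap k R u) := by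
    have : surfOpDeriv k l R V H m q =
        ∑ i, q i • surfOp k l R V (fun x y => pd i (fun m' => H m' x y) m) :=
      kernelOpDeriv_apply m q
    rw [this]
    simp
  have h2 : ∀ᵐ x ∂(surf l V), ∀ i, (q i • surfOp k l R V
      (fun x y => pd i (fun m' => H m' x y) m) (fnMap k R u) : Lp ℝ 2 (surf l V)) x =
      q i * ∫ y, pd i (fun m' => H m' x y) m * H10fn u y ∂(surf k R) := by
    refine ae_all_iff.2 fun i => ?_
    filter_upwards [Lp.coeFn_smul (q i) (surfOp k l R V
      (fun x y => pd i (fun m' => H m' x y) m) (fnMap k R u)),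
      surfOp_ae_eq hR hV (κ := fun x y => pd i (fun m' => H m' x y) m)
        (continuousOn_pd_section hm hH.cont_m i) (fnMap k R u)] with x e1 e2
    rw [e1, Pi.smul_apply, e2, smul_eq_mul]
    rfl
  rw [hs]
  filter_upwards [h2, Lp.coeFn_fun_finsetSum Finset.univ (fun i => q i • surfOp k l R V
    (fun x y => pd i (fun m' => H m' x y) m) (fnMap k R u)),
    ae_restrict_mem hV.isCompact.measurableSet] with x e1 e2 hx
  rw [e2, Finset.sum_congr rfl fun i _ => e1 i]
  exact (lineDeriv_kernel_integral (μ := Measure.euclideanHausdorffMeasure k) hV.isCompact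
    hR.isCompact hB' hH.diff_m hH.cont_m hm hc hx q (H10fn u)).symm

lemma inner_eq_l2Inner {φ ψ : Lp ℝ 2 (surf l V)} {f g : Eu d → ℝ} (hf : φ =ᵐ[surf l V] f)
    (hg : ψ =ᵐ[surf l V] g) : ⟪φ, ψ⟫ = l2Inner l V f g := by
  rw [L2.inner_def]
  refine integral_congr_ae ?_
  filter_upwards [hf, hg] with x h1 h2
  rw [h1, h2]
  simp [mul_comm]

lemma norm_eq_l2Norm {φ : Lp ℝ 2 (surf l V)} {f : Eu d → ℝ} (hf : φ =ᵐ[surf l V] f) :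
    ‖φ‖ = l2Norm l V f := by
  rw [← Real.sqrt_sq (norm_nonneg φ), ← real_inner_self_eq_norm_sq, inner_eq_l2Inner hf hf, l2Norm,
    l2Inner]
  simp_rw [sq_abs, pow_two]

/-- `E_m` is carried into the spectral subspace of the operator `A_m^* A_m` by any identification of
`H¹₀(R)` with a Hilbert space. -/
lemma mem_specSpan_of_mem_eigenSpan {E : Type*} [NormedAddCommGroup E] [InnerProductSpace ℝ E]
    [CompleteSpace E] (e : H10 k R ≃L[ℝ] E) (he : ∀ u v, ⟪e u, e v⟫ = gradInner u v) {m : Eu p}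
    {A : E →L[ℝ] Lp ℝ 2 (surf l V)} (hA : ∀ u, A (e u) =ᵐ[surf l V] opA H m u) {β : ℝ}
    {u : H10 k R} (hu : u ∈ eigenSpan k l R V H β m) :
    e u ∈ specSpan (gram A) (Ioi (β ^ 2)) := by
  suffices h : eigenSpan k l R V H β m ≤
      (specSpan (gram A) (Ioi (β ^ 2))).comap (e.toLinearEquiv : H10 k R →ₗ[ℝ] E) from h hu
  refine Submodule.span_le.2 ?_
  rintro φ ⟨lam, hlam, -, hφ⟩
  -- The adjoint is defined by testing against all of `H¹₀(R)`; as `e` is onto and carries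
  -- `gradInner` to the inner product, the tested identity is the operator identity.
  have heig : gram A (e φ) = lam • e φ := by
    refine ext_inner_right ℝ fun y => ?_
    obtain ⟨χ, rfl⟩ := e.surjective y
    have h1 := hφ χ
    rw [← inner_eq_l2Inner (hA χ) (hA φ), ← he, map_smul] at h1
    rw [inner_gram, real_inner_comm, h1, real_inner_comm]
  exact mem_specSpan_of_eigen (mem_Ioi.2 hlam) heig

/-- Lipschitz stability, given an identification of `H¹₀(R)` with a Hilbert space. -/
theorem exists_lipschitz_stability_of_equiv {E : Type*} [NormedAddCommGroup E]
    [InnerProductSpace ℝ E] [CompleteSpace E] (e : H10 k R ≃L[ℝ] E)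
    (he : ∀ u v, ⟪e u, e v⟫ = gradInner u v)
    (hR : IsCompactSubmanifold k R) (hV : IsCompactSubmanifold l V)
    (hB : IsCompact B) (hB' : IsOpen B') (hBB' : B ⊆ B') (hR1 : Reg1 B V R H) (hR2 : Reg2 B' V R H)
    (hU1 : Uniq1 k l B R V H) (hU2 : Uniq2 k l B R V H) {A₁ A₂ β : ℝ} (hA₁ : 0 < A₁) (hβ : 0 < β) :
    ∃ C : ℝ, 0 < C ∧ ∀ m ∈ B, ∀ m' ∈ B,
      ∀ u ∈ eigenSpan k l R V H β m, ∀ v ∈ eigenSpan k l R V H β m',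
        A₁ ≤ l2Norm l V (opA H m' v) → gradNorm v ≤ A₂ →
        C * ‖m - m'‖ ≤ l2Norm l V (fun x => opA H m u x - opA H m' v x) := by
  set J : E →L[ℝ] Lp ℝ 2 (surf k R) := fnMap k R ∘L e.symm.toContinuousLinearMap with hJ
  let A : Eu p → E →L[ℝ] Lp ℝ 2 (surf l V) := fun m => surfOp k l R V (H m) ∘L J
  -- Composition with the fixed map `J` is continuous and linear in the operator, so strict
  -- differentiability passes from `L²(R)` to `E`.
  let T : (Lp ℝ 2 (surf k R) →L[ℝ] Lp ℝ 2 (surf l V)) →L[ℝ] E →L[ℝ] Lp ℝ 2 (surf l V) :=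
    (ContinuousLinearMap.compL ℝ E (Lp ℝ 2 (surf k R)) (Lp ℝ 2 (surf l V))).flip J
  let A' : Eu p → Eu p →L[ℝ] E →L[ℝ] Lp ℝ 2 (surf l V) := fun m => T ∘L surfOpDeriv k l R V H m
  have hJe : ∀ u, J (e u) = fnMap k R u := fun u => by simp [hJ]
  have hAe : ∀ m ∈ B, ∀ u, A m (e u) =ᵐ[surf l V] opA H m u := fun m hm u => by
    have h1 : A m (e u) = surfOp k l R V (H m) (fnMap k R u) := by rw [← hJe]; rfl
    rw [h1]
    exact opA_ae_eq hR hV hR1 hm u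
  have hnorm : ∀ u, ‖e u‖ = gradNorm u := fun u => by
    rw [gradNorm, ← Real.sqrt_sq (norm_nonneg (e u)), ← real_inner_self_eq_norm_sq, he, gradInner]
    simp_rw [real_inner_self_eq_norm_sq]
  have hU1e : ∀ m₁ ∈ B, ∀ m₂ ∈ B, ∀ x y, A m₁ x = A m₂ y → y ≠ 0 → m₁ = m₂ ∧ x = y := by
    intro m₁ h₁ m₂ h₂ x y hxy hy
    obtain ⟨u, rfl⟩ := e.surjective x
    obtain ⟨v, rfl⟩ := e.surjective y
    have hae : opA H m₁ u =ᵐ[surf l V] opA H m₂ v := by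
      refine (hAe m₁ h₁ u).symm.trans ?_
      rw [hxy]
      exact hAe m₂ h₂ v
    have hv0 : v ≠ 0 := fun h => hy (by rw [h, map_zero])
    obtain ⟨hm, huv⟩ := hU1 m₁ h₁ m₂ h₂ u v hae (Or.inr hv0)
    exact ⟨hm, by rw [huv]⟩
  have hU2e : ∀ q, ‖q‖ = 1 → ∀ m ∈ B, ∀ x y, A' m q x = A m y → x = 0 := by
    intro q hq m hm x y hxy
    obtain ⟨u, rfl⟩ := e.surjective x
    obtain ⟨v, rfl⟩ := e.surjective y
    have hD := opDA_ae_eq hR hV hB' hR2 (hBB' hm) (hR1.continuousOn_section hm) q u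
    have hxy' : surfOpDeriv k l R V H m q (fnMap k R u) = A m (e v) := by
      rw [← hxy, ← hJe]; rfl
    rw [hxy'] at hD
    rw [(hU2 q hq m hm u v (hD.symm.trans (hAe m hm v))).1, map_zero]
  obtain ⟨C, hC, hstab⟩ := exists_lipschitz_stability (A := A) (A' := A') (A₂ := A₂) hB
    (fun m hm => T.hasStrictFDerivAt.comp m (hasStrictFDerivAt_surfOp hR hV hB' hR2 (hBB' hm)
      (hR1.continuousOn_section hm)))
    (fun m hm => (isCompactOperator_surfOp hR hV (hR1.continuousOn_section hm)).comp_clm J)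
    hU1e hU2e hA₁ hβ
  refine ⟨C, hC, fun m hm m' hm' u hu v hv hv1 hv2 => ?_⟩
  have := hstab m hm m' hm' (e u) (mem_specSpan_of_mem_eigenSpan e he (hAe m hm) hu)
    (e v) (mem_specSpan_of_mem_eigenSpan e he (hAe m' hm') hv)
    (by rwa [norm_eq_l2Norm (hAe m' hm' v)]) (by rwa [hnorm])
  rwa [norm_eq_l2Norm ((Lp.coeFn_sub _ _).trans ((hAe m hm u).sub (hAe m' hm' v)))] at this

end Operators

end LipStab

theorem mainTheorem2 {p d k l : ℕ} (R V : Set (LipStab.Eu d))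
    (hR : LipStab.IsCompactSubmanifold k R)
    (hRbdry : ∀ y ∈ R, (connectedComponentIn R y ∩ LipStab.bdry k R).Nonempty)
    (hV : LipStab.IsCompactSubmanifold l V)
    (B B' : Set (LipStab.Eu p)) (hB : IsCompact B) (hB' : IsOpen B') (hBB' : B ⊆ B')
    (H : LipStab.Eu p → LipStab.Eu d → LipStab.Eu d → ℝ)
    (hR1 : LipStab.Reg1 B V R H) (hR2 : LipStab.Reg2 B' V R H)
    (hU1 : LipStab.Uniq1 k l B R V H) (hU2 : LipStab.Uniq2 k l B R V H)
    (A₁ A₂ β : ℝ) (hA₁ : 0 < A₁) (hA₂ : 0 < A₂) (hβ : 0 < β) :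
    ∃ C : ℝ, 0 < C ∧ ∀ m ∈ B, ∀ m' ∈ B,
      ∀ u ∈ LipStab.eigenSpan k l R V H β m, ∀ v ∈ LipStab.eigenSpan k l R V H β m',
        A₁ ≤ LipStab.l2Norm l V (LipStab.opA H m' v) →
        LipStab.gradNorm v ≤ A₂ →
        C * ‖m - m'‖ ≤
          LipStab.l2Norm l V (fun x => LipStab.opA H m u x - LipStab.opA H m' v x) := by
  -- The boundary condition on components enters here: on a closed component nonzero constants would
  -- have zero gradient.
  have hP := hR.poincareOn hRbdry
  have : CompleteSpace (LinearMap.range (LipStab.gradMap k R :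
      LipStab.H10 k R →ₗ[ℝ] Lp (LipStab.Eu d) 2 (LipStab.surf k R))) :=
    ((LipStab.gradMap_antilipschitz hP).choose_spec.isClosed_range
      (LipStab.gradMap k R).uniformContinuous).completeSpace_coe
  exact LipStab.exists_lipschitz_stability_of_equiv (LipStab.gradEquiv hP)
    (LipStab.inner_gradEquiv hP) hR hV hB hB' hBB' hR1 hR2 hU1 hU2 hA₁ hβ
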